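/- Let $G$ be a split reductive group over a field of characteristic $0$ with maximal torus $T$, Borel subgroup $B_G\supset T$, Dynkin vertex set $I$, simple roots $\alpha_i\in X^\star(T)$ and simple coroots $\alpha_i^\vee\in X_\star(T)$ ($i\in I$), and let $\mathfrak g^\vee$ be the complex Lie algebra of the Langlands dual group of $G$, with Cartan subalgebra $\mathbb C\otimes X^\star(T)$ and Chevalley generators $e_i$, $e_{-i}=f_i$ ($i\in I$), so that $[h,e_{\pm i}]=\pm\langle h,\alpha_i^\vee\rangle e_{\pm i}$ for $h\in X^\star(T)$ and $[e_i,f_i]=\alpha_i$. A $\mathfrak g^\vee$-module $V$ is *locally finite* if $V=\bigoplus_{\mu\in X_\star(T)}V(\mu)$, where $V(\mu)$ is the weight space of weight $\mu$, and $U(\mathfrak g^\vee)v$ is finite-dimensional for each $v\in V$. For $i\in I\sqcup -I$ and $v\neq 0$ let $\ell_i(v)$ be the smallest $\ell\ge 0$ with $e_i^{\ell+1}v=0$, and let $V_i^{<\ell}=\ker e_i^{\ell}$. A basis $\mathbf B$ of $V$ is *($\mathfrak g^\vee$-)perfect* if $\mathbf B\cap V(\mu)$ is a basis of $V(\mu)$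 for each $\mu$, and for each $i\in I\sqcup -I$ there is a bijection $\tilde e_i$ from a subset of $\mathbf B$ onto a subset of $\mathbf B$ such that $\tilde e_i(b)$ is defined if and only if $e_i(b)\ne 0$, and in that case $$e_i(b)\in\mathbb C^\times\cdot\tilde e_i(b)+V_i^{<\ell_i(b)-1}.$$ The crystal $\mathcal B(V,\mathbf B)$ is the Kashiwara crystal on the set $\mathbf B$ with $\tilde\gamma(b)=\mu$ for $b\in V(\mu)$, $\tilde\varepsilon_i(b)=\ell_i(b)$, $\tilde\varphi_i(b)=\ell_i(b)+\langle\alpha_i,\tilde\gamma(b)\rangle$, and the partial bijections $\tilde e_i$, $i\in I$. A crystal is *normal* if every $\tilde e_i$ ($i\in I$) differs from the identity, and, for all $b$ and all $i\in I$, $\tilde\varepsilon_i(b)$ (resp. $\tilde\varphi_i(b)$) is the largest $n\ge 0$ such that $\tilde e_i^{\,n}(b)$ (resp. $\tilde e_i^{-n}(b)$) is defined. **Theorem.** Let $\mathbf B$ and $\mathbf B'$ be perfect bases of a locally finite $\mathfrak g^\vee$-module $V$. Then the crystals $\mathcal B(V,\mathbf B)$ and $\mathcal B(V,\mathbf B')$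 are normal (provided that $V\ne 0$) and isomorphic: there is a bijection $\mathbf B\to\mathbf B'$ that preserves $\tilde\gamma$ and all $\tilde\varphi_i$, $\tilde\varepsilon_i$ and commutes with all partial bijections $\tilde e_i$, $i\in I$ (domains included). So, up to isomorphism, the crystal depends only on $V$ and not on the choice of the perfect basis. -/

import Mathlib

noncomputable section

variable {ι X Y : Type*} [AddCommGroup X] [AddCommGroup Y]

/-! ### The Lie algebra of the Langlands dual group

`P : RootDatum ι X Y` is the root datum of a split reductive group `G` with maximal torus `T`:
`X = X^*(T)` and `Y = X_*(T)` are the character and cocharacter lattices, `P.root` and `P.coroot`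
are the roots and the coroots of `G`.  The base `b` is the choice of a Borel subgroup, and
`b.support` is the vertex set `I` of the Dynkin diagram.  In the dual group the roles of `X` and
`Y` are exchanged: its Cartan subalgebra is `ℂ ⊗ X`, its simple roots are the simple coroots of
`G`, and its simple coroots are the simple roots of `G`. -/

/-- Generators of the dual Lie algebra: `H x` for `x` in the character lattice, and the
Chevalley generators `E i`, `F i` for `i` in the vertex set of the Dynkin diagram. -/
inductive DualGen {P : RootDatum ι X Y} (b : P.Base) : Type _
  | H (x : X) : DualGen b
  | E (i : b.support) : DualGen b
  | F (i : b.support) : DualGen b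

namespace DualGen

variable {P : RootDatum ι X Y} (b : P.Base)

/-- The generator `H x` in the free Lie algebra. -/
def freeH (x : X) : FreeLieAlgebra ℂ (DualGen b) := FreeLieAlgebra.of ℂ (DualGen.H x)

/-- The generator `E i` in the free Lie algebra. -/
def freeE (i : b.support) : FreeLieAlgebra ℂ (DualGen b) := FreeLieAlgebra.of ℂ (DualGen.E i)

/-- The generator `F i` in the free Lie algebra. -/
def freeF (i : b.support) : FreeLieAlgebra ℂ (DualGen b) := FreeLieAlgebra.of ℂ (DualGen.F i)

/-- The Chevalley-Serre relators of the dual Lie algebra. The integer `⟨x, α_i^∨⟩` is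
`P.toLinearMap x (P.coroot i)`. -/
inductive Relator : FreeLieAlgebra ℂ (DualGen b) → Prop
  | H_add (x y : X) : Relator (freeH b (x + y) - freeH b x - freeH b y)
  | H_H (x y : X) : Relator ⁅freeH b x, freeH b y⁆
  | H_E (x : X) (i : b.support) :
      Relator (⁅freeH b x, freeE b i⁆ - P.toLinearMap x (P.coroot i) • freeE b i)
  | H_F (x : X) (i : b.support) :
      Relator (⁅freeH b x, freeF b i⁆ + P.toLinearMap x (P.coroot i) • freeF b i)
  | E_F_same (i : b.support) : Relator (⁅freeE b i, freeF b i⁆ - freeH b (P.root i))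
  | E_F_ne (i j : b.support) (hij : i ≠ j) : Relator ⁅freeE b i, freeF b j⁆
  | serre_E (i j : b.support) (hij : i ≠ j) :
      Relator (((LieAlgebra.ad ℂ (FreeLieAlgebra ℂ (DualGen b)) (freeE b i)) ^
        (1 - P.toLinearMap (P.root i) (P.coroot j)).toNat) (freeE b j))
  | serre_F (i j : b.support) (hij : i ≠ j) :
      Relator (((LieAlgebra.ad ℂ (FreeLieAlgebra ℂ (DualGen b)) (freeF b i)) ^
        (1 - P.toLinearMap (P.root i) (P.coroot j)).toNat) (freeF b j))

/-- The ideal generated by the Chevalley-Serre relators. -/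
def relatorIdeal : LieIdeal ℂ (FreeLieAlgebra ℂ (DualGen b)) :=
  LieSubmodule.lieSpan ℂ _ {r | Relator b r}

end DualGen

/-- The complex reductive Lie algebra `𝔤^∨` of the Langlands dual group. -/
def DualLieAlgebra {P : RootDatum ι X Y} (b : P.Base) : Type _ :=
  FreeLieAlgebra ℂ (DualGen b) ⧸ DualGen.relatorIdeal b

namespace DualLieAlgebra

variable {P : RootDatum ι X Y} (b : P.Base)

instance : LieRing (DualLieAlgebra b) :=
  inferInstanceAs (LieRing (FreeLieAlgebra ℂ (DualGen b) ⧸ DualGen.relatorIdeal b))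

instance : LieAlgebra ℂ (DualLieAlgebra b) :=
  inferInstanceAs (LieAlgebra ℂ (FreeLieAlgebra ℂ (DualGen b) ⧸ DualGen.relatorIdeal b))

/-- The quotient map from the free Lie algebra. -/
def mk : FreeLieAlgebra ℂ (DualGen b) →ₗ⁅ℂ⁆ DualLieAlgebra b :=
  { (LieSubmodule.Quotient.mk' (DualGen.relatorIdeal b) :
        FreeLieAlgebra ℂ (DualGen b) →ₗ[ℂ] FreeLieAlgebra ℂ (DualGen b) ⧸ DualGen.relatorIdeal b) with
    map_lie' := fun {x y} => LieSubmodule.Quotient.mk_bracket (I := DualGen.relatorIdeal b) x y }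

/-- The element of the Cartan subalgebra given by a character of `T`. -/
def H (x : X) : DualLieAlgebra b := mk b (DualGen.freeH b x)

/-- The Chevalley generators `e_i`, indexed by `I ⊔ -I`: `e_i = E_i` for `i` in `I`
(the left summand), and `e_{-i} = F_i` (the right summand). -/
def e : b.support ⊕ b.support → DualLieAlgebra b
  | .inl i => mk b (DualGen.freeE b i)
  | .inr i => mk b (DualGen.freeF b i)

theorem mk_relator {r : FreeLieAlgebra ℂ (DualGen b)} (hr : DualGen.Relator b r) :
    mk b r = 0 :=
  (LieSubmodule.Quotient.mk_eq_zero' (N := DualGen.relatorIdeal b) (m := r)).2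
    (LieSubmodule.subset_lieSpan hr)

theorem lie_H_E (x : X) (i : b.support) :
    ⁅H b x, e b (.inl i)⁆ = P.toLinearMap x (P.coroot i) • e b (.inl i) := by
  have h := mk_relator b (DualGen.Relator.H_E (b := b) x i)
  rw [map_sub, LieHom.map_lie, map_zsmul, sub_eq_zero] at h
  exact h

end DualLieAlgebra

/-! ### Locally finite modules -/

section Modules

variable {P : RootDatum ι X Y} (b : P.Base)
variable (V : Type*) [AddCommGroup V] [Module ℂ V]
  [LieRingModule (DualLieAlgebra b) V] [LieModule ℂ (DualLieAlgebra b) V]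

/-- The action of a Chevalley generator on `V`. -/
def chevalleyAct (i : b.support ⊕ b.support) : Module.End ℂ V :=
  LieModule.toEnd ℂ (DualLieAlgebra b) V (DualLieAlgebra.e b i)

/-- The weight space `V(μ)`, for a cocharacter `μ` of `T`. -/
def dualWeightSpace (μ : Y) : Submodule ℂ V where
  carrier := {v | ∀ x : X, ⁅DualLieAlgebra.H b x, v⁆ = P.toLinearMap x μ • v}
  add_mem' {v w} hv hw x := by rw [lie_add, hv x, hw x, smul_add]
  zero_mem' x := by rw [lie_zero, smul_zero]
  smul_mem' c v hv x := by rw [lie_smul, hv x, smul_comm]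

open scoped Classical in
/-- `V` is the direct sum of its weight spaces, and each cyclic submodule `U(𝔤^∨) v` is
finite-dimensional. -/
structure IsLocallyFiniteDualModule : Prop where
  weight_decomposition : DirectSum.IsInternal (fun μ : Y => dualWeightSpace b V μ)
  finite_cyclic (v : V) :
    FiniteDimensional ℂ (LieSubmodule.lieSpan ℂ (DualLieAlgebra b) ({v} : Set V))

variable {V}

/-- `ℓ_i(v)`, the smallest `ℓ ≥ 0` with `e_i ^ (ℓ + 1) v = 0` (used for `v ≠ 0`). -/
def ell (i : b.support ⊕ b.support) (v : V) : ℕ :=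
  sInf {n : ℕ | ((chevalleyAct b V i) ^ (n + 1)) v = 0}

variable (V)

/-- The subspace `V_i^{<ℓ} = {v : ℓ_i(v) < ℓ} = {v : e_i ^ ℓ v = 0}`. -/
def ellLT (i : b.support ⊕ b.support) (l : ℕ) : Submodule ℂ V :=
  LinearMap.ker ((chevalleyAct b V i) ^ l)

/-- A perfect basis of `V`: a basis compatible with the weight decomposition, with, for each
`i ∈ I ⊔ -I`, a partial bijection `ẽ_i` of the basis that is defined at `v` exactly when
`e_i v ≠ 0`, and then `e_i v ∈ ℂˣ ẽ_i(v) + V_i^{< ℓ_i(v) - 1}`. -/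
structure PerfectBasis where
  /-- The basis, as a subset of `V`. -/
  carrier : Set V
  linearIndependent : LinearIndependent ℂ (fun v : carrier => (v : V))
  span_eq_top : Submodule.span ℂ carrier = ⊤
  span_weight (μ : Y) :
    Submodule.span ℂ (carrier ∩ (dualWeightSpace b V μ : Set V)) = dualWeightSpace b V μ
  /-- The partial bijections `ẽ_i`. -/
  op : b.support ⊕ b.support → (carrier ≃. carrier)
  op_isSome_iff (i : b.support ⊕ b.support) (v : carrier) :
    (op i v).isSome ↔ chevalleyAct b V i v ≠ 0
  op_spec (i : b.support ⊕ b.support) (v w : carrier) (h : w ∈ op i v) :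
    ∃ c : ℂ, c ≠ 0 ∧ chevalleyAct b V i v - c • (w : V) ∈ ellLT b V i (ell b i (v : V) - 1)

end Modules

/-! ### Kashiwara crystals -/

/-- Nonnegative powers of a partial bijection. -/
def partialNPow {B : Type*} (f : B ≃. B) : ℕ → (B ≃. B)
  | 0 => PEquiv.refl B
  | n + 1 => (partialNPow f n).trans f

/-- Integer powers of a partial bijection. -/
def partialZPow {B : Type*} (f : B ≃. B) : ℤ → (B ≃. B)
  | .ofNat n => partialNPow f n
  | .negSucc n => partialNPow f.symm (n + 1)

/-- A Kashiwara crystal on the set `B`; the value `-∞` is `⊥`. -/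
structure KashiwaraCrystal {P : RootDatum ι X Y} (b : P.Base) (B : Type*) where
  /-- The weight map `γ`. -/
  wt : B → Y
  /-- The functions `φ_i`. -/
  phi : b.support → B → WithBot ℤ
  /-- The functions `ε_i`. -/
  eps : b.support → B → WithBot ℤ
  /-- The partial bijections `ẽ_i`. -/
  op : b.support → (B ≃. B)
  crystal (i : b.support) :
    (op i = PEquiv.refl B ∧ ∀ v, eps i v = ⊥ ∧ phi i v = ⊥) ∨
    ((∀ v, ∃ p q : ℤ, phi i v = p ∧ eps i v = q ∧
        p - q = P.toLinearMap (P.root i) (wt v)) ∧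
      ∀ (n : ℤ) (v w : B), w ∈ partialZPow (op i) n v → wt w = wt v + n • P.coroot i)

namespace KashiwaraCrystal

variable {P : RootDatum ι X Y} {b : P.Base} {B B' : Type*}

/-- The support of a crystal. -/
def supp (C : KashiwaraCrystal b B) : Set b.support := {i | C.op i ≠ PEquiv.refl B}

/-- Upper normality: `ε_i(v)` is the largest `n ≥ 0` such that `ẽ_i ^ n` is defined at `v`. -/
def IsUpperNormal (C : KashiwaraCrystal b B) : Prop :=
  ∀ i ∈ C.supp, ∀ v : B, ∃ k : ℕ, C.eps i v = ((k : ℤ) : WithBot ℤ) ∧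
    IsGreatest {n : ℕ | (partialZPow (C.op i) (n : ℤ) v).isSome} k

/-- Lower normality: `φ_i(v)` is the largest `n ≥ 0` such that `ẽ_i ^ (-n)` is defined at `v`. -/
def IsLowerNormal (C : KashiwaraCrystal b B) : Prop :=
  ∀ i ∈ C.supp, ∀ v : B, ∃ k : ℕ, C.phi i v = ((k : ℤ) : WithBot ℤ) ∧
    IsGreatest {n : ℕ | (partialZPow (C.op i) (-(n : ℤ)) v).isSome} k

/-- A normal crystal. -/
structure IsNormal (C : KashiwaraCrystal b B) : Prop where
  upper : C.IsUpperNormal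
  lower : C.IsLowerNormal
  supp_eq : C.supp = Set.univ

/-- An isomorphism of crystals: a bijection that preserves the weight and all `φ_i`, `ε_i`, and
commutes with all partial bijections `ẽ_i` (including their domains). -/
structure Iso (C : KashiwaraCrystal b B) (C' : KashiwaraCrystal b B') where
  /-- The underlying bijection. -/
  toEquiv : B ≃ B'
  wt_eq (v : B) : C'.wt (toEquiv v) = C.wt v
  phi_eq (i : b.support) (v : B) : C'.phi i (toEquiv v) = C.phi i v
  eps_eq (i : b.support) (v : B) : C'.eps i (toEquiv v) = C.eps i v
  op_eq (i : b.support) (v : B) : C'.op i (toEquiv v) = (C.op i v).map toEquiv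

end KashiwaraCrystal

/-! ### The crystal associated to a perfect basis -/

namespace PerfectBasis

variable {P : RootDatum ι X Y} {b : P.Base}
variable {V : Type*} [AddCommGroup V] [Module ℂ V]
  [LieRingModule (DualLieAlgebra b) V] [LieModule ℂ (DualLieAlgebra b) V]

theorem weight_unique {μ ν : Y} {v : V} (hv : v ≠ 0)
    (hμ : v ∈ dualWeightSpace b V μ) (hν : v ∈ dualWeightSpace b V ν) : μ = ν := by
  have key : ∀ x : X, P.toLinearMap x μ = P.toLinearMap x ν := fun x => by
    have h : P.toLinearMap x μ • v = P.toLinearMap x ν • v := (hμ x).symm.trans (hν x)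
    rw [← Int.cast_smul_eq_zsmul ℂ, ← Int.cast_smul_eq_zsmul ℂ] at h
    exact_mod_cast smul_left_injective ℂ hv h
  apply (LinearMap.IsPerfPair.bijective_right P.toLinearMap).1
  ext x
  simpa using key x

theorem act_weight {μ : Y} {v : V} (i : b.support) (hv : v ∈ dualWeightSpace b V μ) :
    chevalleyAct b V (.inl i) v ∈ dualWeightSpace b V (μ + P.coroot i) := by
  intro x
  change ⁅DualLieAlgebra.H b x, ⁅DualLieAlgebra.e b (.inl i), v⁆⁆ =
    P.toLinearMap x (μ + P.coroot i) • ⁅DualLieAlgebra.e b (.inl i), v⁆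
  rw [leibniz_lie, DualLieAlgebra.lie_H_E, hv x, map_add, add_smul, smul_lie, lie_smul, add_comm]

theorem act_pow_weight {μ : Y} {v : V} (i : b.support) (hv : v ∈ dualWeightSpace b V μ) (n : ℕ) :
    ((chevalleyAct b V (.inl i)) ^ n) v ∈ dualWeightSpace b V (μ + n • P.coroot i) := by
  induction n with
  | zero => simpa using hv
  | succ n ih =>
    rw [pow_succ', Module.End.mul_apply, succ_nsmul, ← add_assoc]
    exact act_weight i ih

theorem exists_weight (hV : IsLocallyFiniteDualModule b V) (B : PerfectBasis b V)
    (v : B.carrier) : ∃ μ : Y, (v : V) ∈ dualWeightSpace b V μ := by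
  classical
  by_contra! hcon
  have hle : (⊤ : Submodule ℂ V) ≤ Submodule.span ℂ (B.carrier \ {(v : V)}) := by
    rw [← hV.weight_decomposition.submodule_iSup_eq_top]
    refine iSup_le fun μ => ?_
    rw [← B.span_weight μ]
    refine Submodule.span_mono fun w hw => ⟨hw.1, fun h => hcon μ ?_⟩
    rw [← Set.mem_singleton_iff.1 h]
    exact hw.2
  have hind : LinearIndepOn ℂ id B.carrier := B.linearIndependent
  have h := LinearIndepOn.notMem_span hind v.2
  rw [Set.image_id] at h
  exact h (hle trivial)

/-- The weight of a basis vector. -/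
def weight (hV : IsLocallyFiniteDualModule b V) (B : PerfectBasis b V) (v : B.carrier) : Y :=
  (exists_weight hV B v).choose

theorem weight_spec (hV : IsLocallyFiniteDualModule b V) (B : PerfectBasis b V)
    (v : B.carrier) : (v : V) ∈ dualWeightSpace b V (weight hV B v) :=
  (exists_weight hV B v).choose_spec

theorem weight_op (hV : IsLocallyFiniteDualModule b V) (B : PerfectBasis b V) (i : b.support)
    (v w : B.carrier) (h : w ∈ B.op (.inl i) v) :
    weight hV B w = weight hV B v + P.coroot i := by
  have hne : chevalleyAct b V (.inl i) v ≠ 0 :=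
    (B.op_isSome_iff (.inl i) v).1 (Option.isSome_iff_exists.2 ⟨w, h⟩)
  obtain ⟨c, hc, hmem⟩ := B.op_spec (.inl i) v w h
  set m := ell b (.inl i) (v : V) - 1 with hm
  have hpow : ((chevalleyAct b V (.inl i)) ^ (m + 1)) (v : V) ≠ 0 := by
    intro h0
    have hle : ell b (.inl i) (v : V) ≤ m := Nat.sInf_le h0
    have hm0 : m = 0 := by omega
    rw [hm0] at h0
    exact hne (by simpa using h0)
  have heq : ((chevalleyAct b V (.inl i)) ^ (m + 1)) (v : V) =
      c • ((chevalleyAct b V (.inl i)) ^ m) (w : V) := by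
    have := LinearMap.mem_ker.1 hmem
    rw [map_sub, map_smul, sub_eq_zero] at this
    rw [pow_succ, Module.End.mul_apply, this]
  have h1 := act_pow_weight i (weight_spec hV B v) (m + 1)
  have h2 := Submodule.smul_mem _ c (act_pow_weight i (weight_spec hV B w) m)
  rw [← heq] at h2
  have h3 := weight_unique hpow h1 h2
  rw [succ_nsmul', ← add_assoc] at h3
  exact (add_right_cancel h3).symm

theorem weight_partialNPow {B : Type*} {γ : B → Y} {f : B ≃. B} {a : Y}
    (hf : ∀ v w, w ∈ f v → γ w = γ v + a) (n : ℕ) (v w : B) (h : w ∈ partialNPow f n v) :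
    γ w = γ v + n • a := by
  induction n generalizing w with
  | zero =>
    have : v = w := by simpa [partialNPow] using h
    simp [this]
  | succ n ih =>
    obtain ⟨u, hu, hw⟩ := (PEquiv.mem_trans _ _ _ _).1 h
    rw [hf u w hw, ih u hu, succ_nsmul, add_assoc]

theorem weight_partialZPow {B : Type*} {γ : B → Y} {f : B ≃. B} {a : Y}
    (hf : ∀ v w, w ∈ f v → γ w = γ v + a) (n : ℤ) (v w : B) (h : w ∈ partialZPow f n v) :
    γ w = γ v + n • a := by
  cases n with
  | ofNat n => simpa using weight_partialNPow hf n v w h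
  | negSucc n =>
    have hf' : ∀ v w, w ∈ f.symm v → γ w = γ v + -a := fun v w hw => by
      rw [hf w v (f.mem_iff_mem.1 hw)]; abel
    rw [weight_partialNPow hf' (n + 1) v w h, negSucc_zsmul, smul_neg]

/-- The crystal associated to a perfect basis: `γ` is the weight, `ε_i = ℓ_i`,
`φ_i = ε_i + ⟨α_i, γ⟩`, and the partial bijections are the `ẽ_i`, `i ∈ I`. -/
def crystal (hV : IsLocallyFiniteDualModule b V) (B : PerfectBasis b V) :
    KashiwaraCrystal b B.carrier where
  wt := weight hV B
  phi i v := (((ell b (.inl i) (v : V) : ℤ) + P.toLinearMap (P.root i) (weight hV B v) : ℤ) :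
    WithBot ℤ)
  eps i v := ((ell b (.inl i) (v : V) : ℤ) : WithBot ℤ)
  op i := B.op (.inl i)
  crystal i := Or.inr ⟨fun v => ⟨_, _, rfl, rfl, by ring⟩,
    fun n v w h => weight_partialZPow (weight_op hV B i) n v w h⟩

end PerfectBasis

end

/-! The proof has two halves. The first supplies what is needed of complete reducibility: a locally
finite module is generated by its highest weight vectors
(`IsLocallyFinite.eq_top_of_highestWeightVectors`), and the submodule generated by a set of highest
weight vectors has no highest weight vectors outside the linear span of this set
(`IsLocallyFinite.mem_span_of_mem_lieSpan`). Both facts reduce to a finite-dimensional module `M`.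
The trace form of `M` is nondegenerate on the image of `𝔤^∨` in `End M` (`traceRadical_le`), so it
yields a Casimir operator. Its eigenvalue strictly grows from a dominant weight `μ` of `M` to `μ +
γ`, for `γ ≠ 0` a sum of simple coroots acting nontrivially (`casimirEigenvalue_ne`); hence it
separates the weights that matter. Applied to a submodule of `V × V` that is the graph of the wanted
map, the two facts extend each weight-preserving bijection between bases of highest weight vectors
to an automorphism of `V` (`IsLocallyFinite.exists_equiv`).

The second half concerns perfect bases. Perfectness makes each kernel of `e_i ^ n` a span of basis
vectors (`nilIndex_lt_of_mem_support`). So the highest weight vectors of weight `μ` in `𝐁` and in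
`𝐁'` are two bases of one space, and some automorphism `g` of `V` matches them (`exists_matches`).
Call `b` and `b'` related if `b'` occurs in `g b` and `b` occurs in `g⁻¹ b'`. Related elements have
the same weight and the same `ℓ_i`, and `ẽ_i` preserves and reflects the relation
(`Matches.related_iff`). A highest weight basis vector has exactly one partner; any other basis
vector is moved to a greater height by a maximal power of some `ẽ_i`, so by induction it also has
exactly one partner (`Matches.existsUnique`). This is the isomorphism.

Normality follows from `𝔰𝔩₂`-theory: `ẽ_i` lowers `ℓ_i` by one, and an element lies in the image of
`ẽ_i` as soon as `φ_i > 0` (`exists_op_of_pos`). -/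

noncomputable section

/-! ### Relations among the generators, and weight modules -/

namespace DualLieAlgebra

variable {ι X Y : Type*} [AddCommGroup X] [AddCommGroup Y]
variable {P : RootDatum ι X Y} (b : P.Base)

theorem lie_H_F (x : X) (i : b.support) :
    ⁅H b x, e b (.inr i)⁆ = -(P.toLinearMap x (P.coroot i) • e b (.inr i)) := by
  have h := mk_relator b (DualGen.Relator.H_F (b := b) x i)
  rw [map_add, LieHom.map_lie, map_zsmul] at h
  exact eq_neg_of_add_eq_zero_left h

theorem lie_H_H (x y : X) : ⁅H b x, H b y⁆ = 0 := by
  have h := mk_relator b (DualGen.Relator.H_H (b := b) x y)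
  rwa [LieHom.map_lie] at h

theorem lie_E_F_same (i : b.support) : ⁅e b (.inl i), e b (.inr i)⁆ = H b (P.root i) := by
  have h := mk_relator b (DualGen.Relator.E_F_same (b := b) i)
  rw [map_sub, LieHom.map_lie, sub_eq_zero] at h
  exact h

theorem lie_E_F_ne {i j : b.support} (hij : i ≠ j) :
    ⁅e b (.inl i), e b (.inr j)⁆ = 0 := by
  have h := mk_relator b (DualGen.Relator.E_F_ne (b := b) i j hij)
  rwa [LieHom.map_lie] at h

theorem mk_surjective : Function.Surjective (mk b) :=
  LieSubmodule.Quotient.surjective_mk' (DualGen.relatorIdeal b)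

/-- A Lie subalgebra that contains the generators is everything. -/
theorem lieSubalgebra_eq_top (S : LieSubalgebra ℂ (DualLieAlgebra b))
    (hH : ∀ x, H b x ∈ S) (he : ∀ i, e b i ∈ S) : S = ⊤ := by
  let g : DualGen b → S
    | .H x => ⟨H b x, hH x⟩
    | .E i => ⟨e b (.inl i), he _⟩
    | .F i => ⟨e b (.inr i), he _⟩
  have key : S.incl.comp (FreeLieAlgebra.lift ℂ g) = mk b := by
    apply FreeLieAlgebra.hom_ext
    rintro (x | i | i) <;> rw [LieHom.comp_apply, FreeLieAlgebra.lift_of_apply] <;> rfl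
  rw [eq_top_iff]
  rintro y -
  obtain ⟨z, rfl⟩ := mk_surjective b y
  rw [← key]
  exact (FreeLieAlgebra.lift ℂ g z).2

/-- The weights of the Chevalley generators. -/
def wt : b.support ⊕ b.support → Y
  | .inl i => P.coroot i
  | .inr i => -P.coroot i

@[simp] theorem wt_inl (i : b.support) : wt b (.inl i) = P.coroot i := rfl
@[simp] theorem wt_inr (i : b.support) : wt b (.inr i) = -P.coroot i := rfl

theorem lie_H_e (x : X) (i : b.support ⊕ b.support) :
    ⁅H b x, e b i⁆ = P.toLinearMap x (wt b i) • e b i := by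
  rcases i with i | i
  · exact lie_H_E b x i
  · rw [lie_H_F, wt_inr, map_neg, neg_smul]

section Modules

variable {M : Type*} [AddCommGroup M] [Module ℂ M]
  [LieRingModule (DualLieAlgebra b) M] [LieModule ℂ (DualLieAlgebra b) M]

variable {b} in
theorem lie_H_of_mem {μ : Y} {v : M} (hv : v ∈ dualWeightSpace b M μ) (x : X) :
    ⁅H b x, v⁆ = (P.toLinearMap x μ : ℂ) • v := by
  rw [hv x, Int.cast_smul_eq_zsmul]

variable {b} in
theorem lie_e_mem {μ : Y} {v : M} (i : b.support ⊕ b.support)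
    (hv : v ∈ dualWeightSpace b M μ) : ⁅e b i, v⁆ ∈ dualWeightSpace b M (μ + wt b i) := by
  intro x
  rw [leibniz_lie, lie_H_e, hv x, map_add, add_smul, smul_lie, lie_smul, add_comm]

/-- The elements that map `N` to itself form a Lie subalgebra, so generators suffice. -/
theorem lie_mem_of_generators (N : Submodule ℂ M)
    (hH : ∀ x, ∀ v ∈ N, ⁅H b x, v⁆ ∈ N) (he : ∀ i, ∀ v ∈ N, ⁅e b i, v⁆ ∈ N)
    (y : DualLieAlgebra b) (v : M) (hv : v ∈ N) : ⁅y, v⁆ ∈ N := by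
  let S : LieSubalgebra ℂ (DualLieAlgebra b) :=
    { carrier := {y | ∀ v ∈ N, ⁅y, v⁆ ∈ N}
      add_mem' := fun {y z} hy hz v hv => by rw [add_lie]; exact N.add_mem (hy v hv) (hz v hv)
      zero_mem' := fun v hv => by rw [zero_lie]; exact N.zero_mem
      smul_mem' := fun c y hy v hv => by rw [smul_lie]; exact N.smul_mem c (hy v hv)
      lie_mem' := fun {y z} hy hz v hv => by
        rw [lie_lie]; exact N.sub_mem (hy _ (hz v hv)) (hz _ (hy v hv)) }
  have : y ∈ S := by
    rw [lieSubalgebra_eq_top b S hH he]; trivial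
  exact this v hv

-- Vandermonde-type elimination: a character that separates two weights removes one term of the sum
-- and multiplies another by a nonzero scalar.
variable {b} in
theorem mem_of_sum_mem_of_stable {N : Submodule ℂ M} (hN : ∀ x, ∀ v ∈ N, ⁅H b x, v⁆ ∈ N)
    (s : Finset Y) (f : Y → M) (hf : ∀ ν ∈ s, f ν ∈ dualWeightSpace b M ν)
    (hs : ∑ ν ∈ s, f ν ∈ N) : ∀ ν ∈ s, f ν ∈ N := by
  classical
  suffices key : ∀ (ν₀ : Y) (t : Finset Y), ν₀ ∉ t → ∀ f : Y → M,
      (∀ ν, f ν ∈ dualWeightSpace b M ν) → f ν₀ + ∑ ν ∈ t, f ν ∈ N → f ν₀ ∈ N by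
    intro ν hν
    have := key ν (s.erase ν) (by simp) (fun κ => if κ ∈ s then f κ else 0) (fun κ => by
      by_cases h : κ ∈ s <;> simp [h, hf]) (by
        rw [Finset.add_sum_erase s (fun κ => if κ ∈ s then f κ else 0) hν]
        rwa [Finset.sum_congr rfl (g := f) (fun κ hκ => if_pos hκ)])
    simpa [hν] using this
  intro ν₀ t
  induction t using Finset.induction_on with
  | empty => intro _ f _ h; simpa using h
  | insert ν₁ t hν₁ ih =>
    intro hν₀ f hf h
    simp only [Finset.mem_insert, not_or] at hν₀
    obtain ⟨x, hx⟩ : ∃ x : X, P.toLinearMap x ν₀ ≠ P.toLinearMap x ν₁ := by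
      by_contra! hcon
      apply hν₀.1
      apply (LinearMap.IsPerfPair.bijective_right P.toLinearMap).1
      ext x
      simpa using hcon x
    -- The operator `H x` minus its eigenvalue at `ν₁` kills `f ν₁`.
    have h2 := ih hν₀.2 (fun ν => ((P.toLinearMap x ν : ℂ) - P.toLinearMap x ν₁) • f ν)
      (fun ν => Submodule.smul_mem _ _ (hf ν)) (by
        have h3 := N.sub_mem (hN x _ h) (N.smul_mem (P.toLinearMap x ν₁ : ℂ) h)
        have hl : ∀ ν, ⁅H b x, f ν⁆ = (P.toLinearMap x ν : ℂ) • f ν :=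
          fun ν => lie_H_of_mem (hf ν) x
        rw [Finset.sum_insert hν₁] at h3
        simp only [lie_add, lie_sum, hl, smul_add, Finset.smul_sum] at h3
        convert h3 using 1
        simp only [sub_smul, Finset.sum_sub_distrib]
        abel)
    have hne : ((P.toLinearMap x ν₀ : ℂ) - P.toLinearMap x ν₁) ≠ 0 :=
      sub_ne_zero.2 (by exact_mod_cast hx)
    exact (N.smul_mem_iff hne).1 h2

variable (M) in
/-- `M` is spanned by its weight vectors. -/
def IsWeightModule : Prop := ⨆ μ : Y, dualWeightSpace b M μ = ⊤

variable {b}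

theorem IsWeightModule.exists_sum (hM : IsWeightModule b M) (v : M) :
    ∃ (s : Finset Y) (f : Y → M), (∀ ν, f ν ∈ dualWeightSpace b M ν) ∧ ∑ ν ∈ s, f ν = v := by
  have hv : v ∈ ⨆ μ : Y, dualWeightSpace b M μ := by rw [hM]; trivial
  obtain ⟨f, hf, rfl⟩ := (Submodule.mem_iSup_iff_exists_finsupp _ _).1 hv
  exact ⟨f.support, f, hf, rfl⟩

theorem mem_weightSpace_coe (N : LieSubmodule ℂ (DualLieAlgebra b) M) {μ : Y} {v : N} :
    v ∈ dualWeightSpace b N μ ↔ (v : M) ∈ dualWeightSpace b M μ := by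
  refine forall_congr' fun x => ?_
  rw [Subtype.ext_iff]
  simp

theorem IsWeightModule.lieSubmodule (hM : IsWeightModule b M)
    (N : LieSubmodule ℂ (DualLieAlgebra b) M) : IsWeightModule b N := by
  rw [IsWeightModule, eq_top_iff]
  rintro ⟨v, hv⟩ -
  obtain ⟨s, f, hf, rfl⟩ := hM.exists_sum v
  have hN := mem_of_sum_mem_of_stable (b := b) (N := N.toSubmodule) (fun x v hv => N.lie_mem hv)
    s f (fun ν _ => hf ν) hv
  have : (⟨∑ ν ∈ s, f ν, hv⟩ : N) = ∑ ν ∈ s.attach, ⟨f ν, hN ν ν.2⟩ := by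
    ext; simp [Finset.sum_attach s f]
  rw [this]
  refine Submodule.sum_mem _ fun ν _ => ?_
  exact Submodule.mem_iSup_of_mem (ν : Y) ((mem_weightSpace_coe N).2 (hf ν))

variable (b M) in
theorem iSupIndep_weightSpace : iSupIndep (fun μ : Y => dualWeightSpace b M μ) := by
  rw [iSupIndep_iff_finsetSum_eq_zero_imp_eq_zero]
  intro s f hf h μ hμ
  simpa using mem_of_sum_mem_of_stable (b := b) (M := M) (N := ⊥) (fun x v hv => by simp_all)
    s f hf (by simpa using h) μ hμ

variable (b M) in
/-- The weights of a finite-dimensional module are finite in number. -/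
theorem finite_weights [FiniteDimensional ℂ M] :
    {μ : Y | dualWeightSpace b M μ ≠ ⊥}.Finite :=
  WellFoundedGT.finite_ne_bot_of_iSupIndep (iSupIndep_weightSpace b M)

end Modules

end DualLieAlgebra

/-! ### Representations of `𝔰𝔩₂` -/

section SlTwo

/-- Linear operators that satisfy the commutation relations of the standard basis of `𝔰𝔩₂`. -/
structure IsSlTwoAction {V : Type*} [AddCommGroup V] [Module ℂ V] (e f h : Module.End ℂ V) :
    Prop where
  e_f (v : V) : e (f v) = f (e v) + h v
  h_e (v : V) : h (e v) = e (h v) + (2 : ℂ) • e v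
  h_f (v : V) : h (f v) = f (h v) - (2 : ℂ) • f v

namespace IsSlTwoAction

variable {V : Type*} [AddCommGroup V] [Module ℂ V] {e f h : Module.End ℂ V}

theorem symm (A : IsSlTwoAction e f h) : IsSlTwoAction f e (-h) where
  e_f v := by simp [A.e_f]
  h_e v := by simp [A.h_f]; abel
  h_f v := by simp [A.h_e]; abel

theorem h_pow_e (A : IsSlTwoAction e f h) {c : ℂ} {x : V} (hx : h x = c • x) (n : ℕ) :
    h ((e ^ n) x) = (c + 2 * n) • (e ^ n) x := by
  induction n with
  | zero => simpa using hx
  | succ n ih =>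
    rw [pow_succ', Module.End.mul_apply, A.h_e, ih, map_smul, ← add_smul]
    congr 1; push_cast; ring

theorem pow_e_f (A : IsSlTwoAction e f h) {c : ℂ} {x : V} (hx : h x = c • x) (n : ℕ) :
    (e ^ (n + 1)) (f x) = f ((e ^ (n + 1)) x) + ((n + 1) * (c + n)) • (e ^ n) x := by
  induction n with
  | zero => simp [A.e_f, hx]
  | succ n ih =>
    have h2 : (e ^ (n + 1)) x = e ((e ^ n) x) := by rw [pow_succ', Module.End.mul_apply]
    rw [pow_succ', Module.End.mul_apply, ih, map_add, A.e_f, map_smul, A.h_pow_e hx,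
      Module.End.mul_apply, ← h2]
    push_cast; module

/-- On a module on which `f` is locally nilpotent, `e ^ p` is injective on the vectors of weight
`-p`; the statement is relative to a submodule `N`. -/
theorem mem_of_pow_e_mem (A : IsSlTwoAction e f h) {N : Submodule ℂ V}
    (he : ∀ v ∈ N, e v ∈ N) (hf : ∀ v ∈ N, f v ∈ N) (s : ℕ) (p : ℕ) (x : V)
    (hx : h x = (-(p : ℂ)) • x) (hs : (f ^ s) x ∈ N) (hp : (e ^ p) x ∈ N) : x ∈ N := by
  have hpow : ∀ n : ℕ, ∀ v ∈ N, (e ^ n) v ∈ N := by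
    intro n
    induction n with
    | zero => simp
    | succ n ih => intro v hv; rw [pow_succ', Module.End.mul_apply]; exact he _ (ih v hv)
  induction s generalizing p x with
  | zero => simpa using hs
  | succ s ih =>
    -- `f x` has weight `-(p + 2)`. In `e ^ (p + 1) (f x)` the term in `e ^ p x` has coefficient `(p
    -- + 1) * (-p + p) = 0`, so the induction on `s` applies to `f x`.
    have hfx : f x ∈ N := by
      apply ih (p + 2) (f x)
      · rw [A.h_f, hx, map_smul, ← sub_smul]; congr 1; push_cast; ring
      · rwa [pow_succ, Module.End.mul_apply] at hs
      · have h1 : (e ^ (p + 1)) (f x) ∈ N := by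
          rw [A.pow_e_f hx]
          refine N.add_mem (hf _ ?_) (by simp)
          rw [pow_succ', Module.End.mul_apply]; exact he _ hp
        rw [pow_succ', Module.End.mul_apply]; exact he _ h1
    -- For `k < p` the coefficient `(k + 1) * (k - p)` is nonzero, so membership of `e ^ k x`
    -- follows from that of `e ^ (k + 1) x` and of `f x`; this descends from `e ^ p x` to `x`.
    have key : ∀ j, j ≤ p → (e ^ (p - j)) x ∈ N := by
      intro j
      induction j with
      | zero => intro _; simpa using hp
      | succ j ihj =>
        intro hj
        obtain ⟨k, hk⟩ : ∃ k, p = k + j + 1 := ⟨p - (j + 1), by omega⟩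
        have h1 := ihj (by omega)
        rw [show p - j = k + 1 by omega] at h1
        rw [show p - (j + 1) = k by omega]
        have h2 := A.pow_e_f hx k
        have h3 : (((k : ℂ) + 1) * (-(p : ℂ) + k)) • (e ^ k) x ∈ N := by
          rw [← sub_eq_iff_eq_add'.2 h2]
          exact N.sub_mem (hpow _ _ hfx) (hf _ h1)
        refine (N.smul_mem_iff (mul_ne_zero (by exact_mod_cast k.succ_ne_zero) ?_)).1 h3
        rw [hk]; push_cast
        intro h0
        have : ((j + 1 : ℕ) : ℂ) = 0 := by push_cast; linear_combination -h0
        exact absurd this (by exact_mod_cast j.succ_ne_zero)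
    simpa using key p le_rfl

/-- A highest weight vector of weight `m` lies in the image of `e ^ n` for `n ≤ m`. -/
theorem exists_pow_e_eq (A : IsSlTwoAction e f h) {m : ℕ} {x : V}
    (hx : h x = (m : ℂ) • x) (hex : e x = 0) (n : ℕ) (hn : n ≤ m) :
    ∃ c : ℂ, (e ^ n) (c • (f ^ n) x) = x := by
  have step : ∀ k : ℕ, e ((f ^ (k + 1)) x) = (((k : ℂ) + 1) * (m - k)) • (f ^ k) x := by
    intro k
    have h1 := A.symm.pow_e_f (c := -(m : ℂ)) (x := x) (by simp [hx]) k
    rw [hex, map_zero] at h1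
    rw [eq_comm, ← sub_eq_zero] at h1
    rw [← sub_eq_zero, ← h1]
    module
  have main : ∀ n ≤ m, ∃ c : ℂ, c ≠ 0 ∧ (e ^ n) ((f ^ n) x) = c • x := by
    intro n
    induction n with
    | zero => intro _; exact ⟨1, one_ne_zero, by simp⟩
    | succ n ih =>
      intro hn
      obtain ⟨c, hc, h1⟩ := ih (by omega)
      refine ⟨((n : ℂ) + 1) * (m - n) * c, mul_ne_zero (mul_ne_zero ?_ ?_) hc, ?_⟩
      · exact_mod_cast n.succ_ne_zero
      · rw [sub_ne_zero]; exact_mod_cast (by omega : m ≠ n)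
      · rw [pow_succ e, Module.End.mul_apply, step, map_smul, h1, smul_smul]
  obtain ⟨c, hc, h1⟩ := main n hn
  exact ⟨c⁻¹, by rw [map_smul, h1, smul_smul, inv_mul_cancel₀ hc, one_smul]⟩

end IsSlTwoAction

end SlTwo

end

/-! ### Heights and positivity in the coroot cone; triangular decomposition -/

noncomputable section

section RootDatum

variable {ι X Y : Type*} [AddCommGroup X] [AddCommGroup Y]
variable {P : RootDatum ι X Y} (b : P.Base)

/-- The submonoid generated by the simple coroots with index in `S`. -/
def corootCone (S : Set b.support) : AddSubmonoid Y :=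
  AddSubmonoid.closure ((fun i : b.support => P.coroot i) '' S)

theorem coroot_mem_corootCone {S : Set b.support} {i : b.support} (hi : i ∈ S) :
    P.coroot i ∈ corootCone b S :=
  AddSubmonoid.subset_closure ⟨i, hi, rfl⟩

/-- Makes `x` a faithful grading of the cone; later inductions measure weights by it. -/
theorem height_pos {x : X} (hx : ∀ i : b.support, P.toLinearMap x (P.coroot i) = 2)
    {S : Set b.support} {β : Y} (hβ : β ∈ corootCone b S) :
    ∃ n : ℕ, P.toLinearMap x β = 2 * n ∧ (n = 0 → β = 0) := by
  induction hβ using AddSubmonoid.closure_induction with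
  | mem γ hγ =>
    obtain ⟨i, -, rfl⟩ := hγ
    exact ⟨1, by simp [hx], by simp⟩
  | zero => exact ⟨0, by simp, by simp⟩
  | add γ γ' _ _ hγ hγ' =>
    obtain ⟨n, hn, h0⟩ := hγ
    obtain ⟨n', hn', h0'⟩ := hγ'
    refine ⟨n + n', by rw [map_add, hn, hn']; push_cast; ring, fun h => ?_⟩
    rw [h0 (by omega), h0' (by omega), add_zero]

variable [Finite ι]

/-- The sum of the positive roots pairs to `2` with every simple coroot. -/
theorem exists_height [P.IsReduced] :
    ∃ x ∈ Submodule.span ℤ (Set.range P.root),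
      ∀ i : b.support, P.toLinearMap x (P.coroot i) = 2 := by
  classical
  have := Fintype.ofFinite ι
  refine ⟨∑ j ∈ Finset.univ.filter (fun j => b.IsPos j), P.root j,
    Submodule.sum_mem _ fun j _ => Submodule.subset_span ⟨j, rfl⟩, fun i => ?_⟩
  have hi : b.IsPos (i : ι) := b.isPos_of_mem_support i.2
  rw [map_sum, LinearMap.sum_apply, ← Finset.sum_erase_add _ (a := (i : ι)) _ (by simp [hi])]
  have hneg : ∀ j, P.pairing (P.reflectionPerm i j) i = -P.pairing j i := fun j => by
    rw [← RootPairing.pairing_reflectionPerm, RootPairing.pairing_reflectionPerm_self_right]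
  -- The simple reflection permutes the other positive roots and changes the sign of the pairing, so
  -- these terms cancel in pairs.
  have hz : ∑ j ∈ (Finset.univ.filter (fun j => b.IsPos j)).erase (i : ι),
      P.toLinearMap (P.root j) (P.coroot i) = 0 := by
    refine Finset.sum_involution (fun j _ => P.reflectionPerm i j) ?_ ?_ ?_ ?_
    · intro j _
      rw [RootPairing.root_coroot_eq_pairing, RootPairing.root_coroot_eq_pairing, hneg,
        add_neg_cancel]
    · intro j _ hne heq
      apply hne
      have h2 : P.pairing (P.reflectionPerm i j) i = P.pairing j i := by rw [heq]
      rw [hneg] at h2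
      rw [RootPairing.root_coroot_eq_pairing]
      omega
    · intro j hj
      simp only [Finset.mem_erase, Finset.mem_filter, Finset.mem_univ, true_and] at hj ⊢
      refine ⟨fun h => ?_, hj.2.reflectionPerm i.2 hj.1⟩
      have h2 := hj.2
      have h3 : j = P.reflectionPerm i i := by
        conv_rhs => arg 2; rw [← h]
        rw [RootPairing.reflectionPerm_self]
      have h4 := b.height_reflectionPerm_self i
      rw [RootPairing.Base.isPos_iff] at h2 hi
      rw [h3] at h2
      have : b.height (P.reflectionPerm i i) = - b.height i := h4
      omega
    · intro j _
      simp
  rw [hz, zero_add]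
  simp

/-- An element of the cone of the simple coroots that pairs nonpositively with all simple roots
vanishes. -/
theorem eq_zero_of_mem_corootCone [P.IsReduced] {β : Y} (hβ : β ∈ corootCone b Set.univ)
    (h : ∀ i : b.support, P.toLinearMap (P.root i) β ≤ 0) : β = 0 := by
  classical
  have := Fintype.ofFinite ι
  -- The form of a simple coroot with `β` is a nonnegative multiple of the pairing of its root with
  -- `β`. The case `γ = β` then makes a sum of squares nonpositive.
  have h1 : ∀ γ ∈ corootCone b Set.univ, P.CorootForm γ β ≤ 0 := by
    intro γ hγ
    induction hγ using AddSubmonoid.closure_induction with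
    | mem γ hγ =>
      obtain ⟨i, -, rfl⟩ := hγ
      have h2 := congrArg (fun z => P.toLinearMap z β) (P.corootForm_self_smul_root i)
      simp only [map_smul, LinearMap.smul_apply, smul_eq_mul,
        RootPairing.toLinearMap_apply_CoPolarization, map_nsmul, nsmul_eq_mul] at h2
      have h3 : 0 ≤ P.CorootForm (P.coroot i) (P.coroot i) := by
        rw [RootPairing.corootForm_apply_apply]
        exact Finset.sum_nonneg fun j _ => mul_self_nonneg _
      have h4 := mul_nonpos_of_nonneg_of_nonpos h3 (h i)
      push_cast at h2
      dsimp only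
      linarith
    | zero => simp
    | add γ γ' _ _ hγ hγ' => rw [map_add, LinearMap.add_apply]; omega
  have h2 := h1 β hβ
  rw [RootPairing.corootForm_apply_apply] at h2
  have h3 : ∀ j, P.toLinearMap (P.root j) β = 0 := by
    have h4 := (Finset.sum_eq_zero_iff_of_nonneg (s := Finset.univ)
      (f := fun j => P.root' j β * P.root' j β) (fun j _ => mul_self_nonneg _)).1
      (le_antisymm h2 (Finset.sum_nonneg fun j _ => mul_self_nonneg _))
    intro j
    exact mul_self_eq_zero.1 (h4 j (Finset.mem_univ j))
  -- All roots vanish on `β`, and the height function lies in their span, so `β` has height zero.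
  obtain ⟨x, hx, hx'⟩ := exists_height b
  obtain ⟨n, hn, h0⟩ := height_pos b hx' hβ
  have h5 : P.toLinearMap x β = 0 := by
    clear hx' hn
    induction hx using Submodule.span_induction with
    | mem x hx => obtain ⟨j, rfl⟩ := hx; exact h3 j
    | zero => simp
    | add x y _ _ hx hy => simp_all
    | smul c x _ hx => simp_all
  exact h0 (by omega)

end RootDatum

namespace DualLieAlgebra

variable {ι X Y : Type*} [AddCommGroup X] [AddCommGroup Y]
variable {P : RootDatum ι X Y} (b : P.Base)

/-! ### Triangular decomposition -/

/-- The index of `e_i` (for `true`) or of `f_i` (for `false`). -/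
def side (s : Bool) (i : b.support) : b.support ⊕ b.support := if s then .inl i else .inr i

/-- The sign attached to a side. -/
def sgn (s : Bool) : ℤ := if s then 1 else -1

theorem wt_side (s : Bool) (i : b.support) : wt b (side b s i) = sgn s • P.coroot i := by
  cases s <;> simp [side, sgn]

theorem exists_side (i : b.support ⊕ b.support) : ∃ s j, i = side b s j := by
  rcases i with j | j
  · exact ⟨true, j, rfl⟩
  · exact ⟨false, j, rfl⟩

/-- The span of the Cartan generators. -/
def cartan : Submodule ℂ (DualLieAlgebra b) := Submodule.span ℂ (Set.range (H b))

/-- The subalgebra generated by the `e_i`, or by the `f_i`. -/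
def nilp (s : Bool) : LieSubalgebra ℂ (DualLieAlgebra b) :=
  LieSubalgebra.lieSpan ℂ _ (Set.range fun i => e b (side b s i))

theorem e_side_mem_nilp (s : Bool) (i : b.support) : e b (side b s i) ∈ nilp b s :=
  LieSubalgebra.subset_lieSpan ⟨i, rfl⟩

theorem lie_H_mem_nilp (s : Bool) (x : X) {y : DualLieAlgebra b} (hy : y ∈ nilp b s) :
    ⁅H b x, y⁆ ∈ nilp b s := by
  induction hy using LieSubalgebra.lieSpan_induction with
  | mem y hy =>
    obtain ⟨i, rfl⟩ := hy
    rw [lie_H_e]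
    exact zsmul_mem (e_side_mem_nilp b s i) _
  | zero => rw [lie_zero]; exact zero_mem _
  | smul c y _ hy => rw [lie_smul]; exact (nilp b s).smul_mem c hy
  | add y z _ _ hy hz => rw [lie_add]; exact add_mem hy hz
  | lie y z hy' hz' hy hz =>
    rw [leibniz_lie]; exact add_mem ((nilp b s).lie_mem hy hz') ((nilp b s).lie_mem hy' hz)

theorem lie_cartan_mem_nilp (s : Bool) {h y : DualLieAlgebra b} (hh : h ∈ cartan b)
    (hy : y ∈ nilp b s) : ⁅h, y⁆ ∈ nilp b s := by
  induction hh using Submodule.span_induction with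
  | mem h hh => obtain ⟨x, rfl⟩ := hh; exact lie_H_mem_nilp b s x hy
  | zero => rw [zero_lie]; exact zero_mem _
  | add h h' _ _ h1 h2 => rw [add_lie]; exact add_mem h1 h2
  | smul c h _ h1 => rw [smul_lie]; exact (nilp b s).smul_mem c h1

/-- For generators the bracket lies in the Cartan part. The Leibniz rule propagates this, since the
bracket of an element of the sum with `nilp b s` falls back into `nilp b s`. -/
theorem lie_e_not_side_mem (s : Bool) (j : b.support) {y : DualLieAlgebra b}
    (hy : y ∈ nilp b s) : ⁅e b (side b (!s) j), y⁆ ∈ (nilp b s).toSubmodule ⊔ cartan b := by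
  have key : ∀ u ∈ (nilp b s).toSubmodule ⊔ cartan b, ∀ z ∈ nilp b s, ⁅u, z⁆ ∈ nilp b s := by
    intro u hu z hz
    obtain ⟨u₁, h1, u₂, h2, rfl⟩ := Submodule.mem_sup.1 hu
    rw [add_lie]
    exact add_mem ((nilp b s).lie_mem h1 hz) (lie_cartan_mem_nilp b s h2 hz)
  induction hy using LieSubalgebra.lieSpan_induction with
  | mem y hy =>
    obtain ⟨i, rfl⟩ := hy
    apply Submodule.mem_sup_right
    dsimp only
    by_cases hij : i = j
    · subst hij
      cases s
      · exact (lie_E_F_same b i).symm ▸ Submodule.subset_span ⟨_, rfl⟩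
      · change ⁅e b (.inr i), e b (.inl i)⁆ ∈ _
        rw [← lie_skew, lie_E_F_same]
        exact neg_mem (Submodule.subset_span ⟨_, rfl⟩)
    · have : ⁅e b (side b (!s) j), e b (side b s i)⁆ = 0 := by
        cases s
        · exact lie_E_F_ne b (Ne.symm hij)
        · change ⁅e b (.inr j), e b (.inl i)⁆ = 0
          rw [← lie_skew, lie_E_F_ne b hij, neg_zero]
      rw [this]; exact zero_mem _
  | zero => rw [lie_zero]; exact zero_mem _
  | smul c y _ hy => rw [lie_smul]; exact Submodule.smul_mem _ c hy
  | add y z _ _ hy hz => rw [lie_add]; exact add_mem hy hz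
  | lie y z hy' hz' hy hz =>
    rw [leibniz_lie]
    refine add_mem (Submodule.mem_sup_left (key _ hy _ hz')) ?_
    rw [← lie_skew]
    exact neg_mem (Submodule.mem_sup_left (key _ hz _ hy'))

theorem lie_e_cartan_mem (s : Bool) (j : b.support) {y : DualLieAlgebra b}
    (hy : y ∈ cartan b) : ⁅e b (side b s j), y⁆ ∈ nilp b s := by
  rw [← lie_skew]
  exact neg_mem (lie_cartan_mem_nilp b s hy (e_side_mem_nilp b s j))

theorem lie_H_cartan (x : X) {y : DualLieAlgebra b} (hy : y ∈ cartan b) : ⁅H b x, y⁆ = 0 := by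
  induction hy using Submodule.span_induction with
  | mem h hh => obtain ⟨y, rfl⟩ := hh; exact lie_H_H b x y
  | zero => rw [lie_zero]
  | add h h' _ _ h1 h2 => rw [lie_add, h1, h2, add_zero]
  | smul c h _ h1 => rw [lie_smul, h1, smul_zero]

/-- The sum is stable under bracketing with each generator, so it is a subalgebra that contains the
generators. -/
theorem sup_nilp_cartan :
    (nilp b true).toSubmodule ⊔ cartan b ⊔ (nilp b false).toSubmodule = ⊤ := by
  set T := (nilp b true).toSubmodule ⊔ cartan b ⊔ (nilp b false).toSubmodule with hT
  have hs : ∀ s, (nilp b s).toSubmodule ≤ T := by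
    rintro (_ | _)
    · exact le_sup_right
    · exact le_sup_left.trans le_sup_left
  have hc : cartan b ≤ T := le_sup_right.trans le_sup_left
  -- Listing the summands from side `s` on lets one argument treat both sides.
  have hsplit : ∀ v ∈ T, ∀ s, ∃ v₁ ∈ nilp b s, ∃ v₂ ∈ cartan b, ∃ v₃ ∈ nilp b (!s),
      v = v₁ + v₂ + v₃ := by
    intro v hv s
    obtain ⟨w, hw, v₃, h3, rfl⟩ := Submodule.mem_sup.1 hv
    obtain ⟨v₁, h1, v₂, h2, rfl⟩ := Submodule.mem_sup.1 hw
    cases s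
    · exact ⟨v₃, h3, v₂, h2, v₁, h1, by abel⟩
    · exact ⟨v₁, h1, v₂, h2, v₃, h3, rfl⟩
  have hstab := lie_mem_of_generators b T (fun x v hv => by
      obtain ⟨v₁, h1, v₂, h2, v₃, h3, rfl⟩ := hsplit v hv true
      rw [lie_add, lie_add]
      refine add_mem (add_mem (hs _ (lie_H_mem_nilp b _ x h1)) ?_) (hs _ (lie_H_mem_nilp b _ x h3))
      rw [lie_H_cartan b x h2]; exact zero_mem _)
    (fun i v hv => by
      obtain ⟨s, j, rfl⟩ := exists_side b i
      obtain ⟨v₁, h1, v₂, h2, v₃, h3, rfl⟩ := hsplit v hv s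
      rw [lie_add, lie_add]
      refine add_mem (add_mem (hs _ ((nilp b s).lie_mem (e_side_mem_nilp b s j) h1))
        (hs _ (lie_e_cartan_mem b s j h2))) ?_
      have h4 := lie_e_not_side_mem b (!s) j h3
      rw [Bool.not_not] at h4
      exact sup_le (hs _) hc h4)
  let S : LieSubalgebra ℂ (DualLieAlgebra b) :=
    { T with lie_mem' := fun {y z} _ hz => hstab y z hz }
  have hS := lieSubalgebra_eq_top b S (fun x => hc (Submodule.subset_span ⟨x, rfl⟩))
    (fun i => by
      obtain ⟨s, j, rfl⟩ := exists_side b i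
      exact hs s (e_side_mem_nilp b s j))
  rw [eq_top_iff]
  rintro y -
  have : y ∈ S := by rw [hS]; trivial
  exact this

/-- The weight vectors in `nilp b s` whose weight is a nonzero element of the cone of the simple
coroots, up to the sign of `s`. -/
def nilpWeightVectors (s : Bool) : Set (DualLieAlgebra b) :=
  {y | y ∈ nilp b s ∧ ∃ β ∈ corootCone b Set.univ, β ≠ 0 ∧
    y ∈ dualWeightSpace b (DualLieAlgebra b) (sgn s • β)}

theorem lie_mem_weightSpace {M : Type*} [AddCommGroup M] [Module ℂ M]
    [LieRingModule (DualLieAlgebra b) M] [LieModule ℂ (DualLieAlgebra b) M] {μ ν : Y}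
    {y : DualLieAlgebra b} {v : M} (hy : y ∈ dualWeightSpace b (DualLieAlgebra b) μ)
    (hv : v ∈ dualWeightSpace b M ν) : ⁅y, v⁆ ∈ dualWeightSpace b M (μ + ν) := by
  intro x
  rw [leibniz_lie, hy x, hv x, map_add, add_smul, smul_lie, lie_smul]

/-- The span is closed under brackets: weights add, and by positivity of heights two nonzero
elements of the cone cannot sum to zero. -/
theorem nilp_le_span [Finite ι] [P.IsReduced] (s : Bool) :
    (nilp b s).toSubmodule ≤ Submodule.span ℂ (nilpWeightVectors b s) := by
  obtain ⟨x, -, hx⟩ := exists_height b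
  have hne : ∀ i : b.support, P.coroot i ≠ 0 := fun i => P.ne_zero' i
  let S : LieSubalgebra ℂ (DualLieAlgebra b) :=
    { Submodule.span ℂ (nilpWeightVectors b s) with
      lie_mem' := by
        intro y z hy hz
        change ⁅y, z⁆ ∈ Submodule.span ℂ (nilpWeightVectors b s)
        induction hy, hz using Submodule.span_induction₂ with
        | mem_mem y z hy hz =>
          obtain ⟨hy, β, hβ, hβ0, hyβ⟩ := hy
          obtain ⟨hz, γ, hγ, hγ0, hzγ⟩ := hz
          refine Submodule.subset_span ⟨(nilp b s).lie_mem hy hz, β + γ, add_mem hβ hγ, ?_, ?_⟩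
          · obtain ⟨n, hn, hn0⟩ := height_pos b hx hβ
            obtain ⟨m, hm, hm0⟩ := height_pos b hx hγ
            intro h0
            have := congrArg (P.toLinearMap x) h0
            rw [map_add, hn, hm, map_zero] at this
            exact hβ0 (hn0 (by omega))
          · rw [smul_add]; exact lie_mem_weightSpace b hyβ hzγ
        | zero_left y hy => rw [zero_lie]; exact zero_mem _
        | zero_right y hy => rw [lie_zero]; exact zero_mem _
        | add_left y z w _ _ _ h1 h2 => rw [add_lie]; exact add_mem h1 h2
        | add_right y z w _ _ _ h1 h2 => rw [lie_add]; exact add_mem h1 h2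
        | smul_left c y z _ _ h => rw [smul_lie]; exact Submodule.smul_mem _ c h
        | smul_right c y z _ _ h => rw [lie_smul]; exact Submodule.smul_mem _ c h }
  have : nilp b s ≤ S := by
    refine LieSubalgebra.lieSpan_le.2 ?_
    rintro _ ⟨i, rfl⟩
    refine Submodule.subset_span ⟨e_side_mem_nilp b s i, P.coroot i,
      coroot_mem_corootCone b (Set.mem_univ i), hne i, ?_⟩
    intro x
    rw [lie_H_e, wt_side]
  exact this

theorem span_weightVectors [Finite ι] [P.IsReduced] :
    Submodule.span ℂ ((cartan b : Set (DualLieAlgebra b)) ∪ ⋃ s, nilpWeightVectors b s) = ⊤ := by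
  rw [eq_top_iff, ← sup_nilp_cartan b]
  refine sup_le (sup_le ?_ fun y hy => Submodule.subset_span (Or.inl hy)) ?_
  · exact (nilp_le_span b true).trans (Submodule.span_mono fun y hy =>
      Or.inr (Set.mem_iUnion.2 ⟨true, hy⟩))
  · exact (nilp_le_span b false).trans (Submodule.span_mono fun y hy =>
      Or.inr (Set.mem_iUnion.2 ⟨false, hy⟩))

end DualLieAlgebra

end

/-! ### Locally finite modules and highest weight vectors -/

noncomputable section

namespace DualLieAlgebra

variable {ι X Y : Type*} [AddCommGroup X] [AddCommGroup Y]
variable {P : RootDatum ι X Y} (b : P.Base)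
variable (M : Type*) [AddCommGroup M] [Module ℂ M]
  [LieRingModule (DualLieAlgebra b) M] [LieModule ℂ (DualLieAlgebra b) M]

/-- `M` is spanned by weight vectors and by finite-dimensional submodules. -/
structure IsLocallyFinite : Prop where
  weight : IsWeightModule b M
  finite (v : M) : ∃ N : LieSubmodule ℂ (DualLieAlgebra b) M, v ∈ N ∧ FiniteDimensional ℂ N

/-- The vertices `i` for which `e_i` acts nontrivially. -/
def active : Set b.support := {i | ∃ v : M, ⁅e b (.inl i), v⁆ ≠ 0}

variable {M}

theorem isLocallyFinite_of_dualModule (hM : IsLocallyFiniteDualModule b M) :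
    IsLocallyFinite b M where
  weight := by
    classical
    exact hM.weight_decomposition.submodule_iSup_eq_top
  finite v := ⟨_, LieSubmodule.subset_lieSpan (Set.mem_singleton v), hM.finite_cyclic v⟩

theorem IsWeightModule.isLocallyFinite [FiniteDimensional ℂ M] (hM : IsWeightModule b M) :
    IsLocallyFinite b M where
  weight := hM
  finite _ := ⟨⊤, trivial, inferInstance⟩

/-- If `e_i` acts by zero, so does `h_i = [e_i, f_i]`, and then so does `2 f_i = -[h_i, f_i]`. -/
theorem active_of_lie_f_ne_zero {i : b.support} {v : M} (hv : ⁅e b (.inr i), v⁆ ≠ 0) :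
    i ∈ active b M := by
  by_contra hi
  have he : ∀ w : M, ⁅e b (.inl i), w⁆ = 0 := fun w => by
    by_contra hw; exact hi ⟨w, hw⟩
  have hh : ∀ w : M, ⁅H b (P.root i), w⁆ = 0 := fun w => by
    rw [← lie_E_F_same, lie_lie, he, he, lie_zero, sub_zero]
  apply hv
  have h1 := congrArg (fun y => ⁅y, v⁆) (lie_H_F b (P.root i) i)
  rw [RootPairing.root_coroot_two, ← Int.cast_smul_eq_zsmul ℂ] at h1
  simp only [lie_lie, hh, lie_zero, sub_zero, neg_lie, smul_lie] at h1
  simpa using h1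

theorem isSlTwoAction (i : b.support) :
    IsSlTwoAction (chevalleyAct b M (.inl i)) (chevalleyAct b M (.inr i))
      (LieModule.toEnd ℂ (DualLieAlgebra b) M (H b (P.root i))) where
  e_f v := by
    change ⁅_, ⁅_, v⁆⁆ = ⁅_, ⁅_, v⁆⁆ + ⁅_, v⁆
    rw [← lie_E_F_same, lie_lie]; abel
  h_e v := by
    change ⁅H b _, ⁅e b (.inl i), v⁆⁆ = ⁅_, ⁅_, v⁆⁆ + (2 : ℂ) • ⁅_, v⁆
    rw [leibniz_lie, lie_H_E, RootPairing.root_coroot_two, ← Int.cast_smul_eq_zsmul ℂ, smul_lie]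
    push_cast
    abel
  h_f v := by
    change ⁅H b _, ⁅e b (.inr i), v⁆⁆ = ⁅_, ⁅_, v⁆⁆ - (2 : ℂ) • ⁅_, v⁆
    rw [leibniz_lie, lie_H_F, RootPairing.root_coroot_two, ← Int.cast_smul_eq_zsmul ℂ, neg_lie,
      smul_lie]
    push_cast
    abel

theorem chevalleyAct_apply (i : b.support ⊕ b.support) (v : M) :
    chevalleyAct b M i v = ⁅e b i, v⁆ := rfl

variable {b}

theorem chevalleyAct_pow_mem {μ : Y} {v : M} (i : b.support ⊕ b.support)
    (hv : v ∈ dualWeightSpace b M μ) (n : ℕ) :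
    ((chevalleyAct b M i) ^ n) v ∈ dualWeightSpace b M (μ + n • wt b i) := by
  induction n with
  | zero => simpa using hv
  | succ n ih =>
    rw [pow_succ', Module.End.mul_apply, succ_nsmul, ← add_assoc]
    exact lie_e_mem i ih

theorem chevalleyAct_pow_mem_lieSubmodule (N : LieSubmodule ℂ (DualLieAlgebra b) M) {v : M}
    (i : b.support ⊕ b.support) (hv : v ∈ N) (n : ℕ) : ((chevalleyAct b M i) ^ n) v ∈ N := by
  induction n with
  | zero => simpa using hv
  | succ n ih =>
    rw [pow_succ', Module.End.mul_apply]
    exact N.lie_mem ih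

theorem exists_finset_weights (N : LieSubmodule ℂ (DualLieAlgebra b) M)
    [FiniteDimensional ℂ N] :
    ∃ s : Finset Y, ∀ μ, ∀ v ∈ N, v ∈ dualWeightSpace b M μ → v ≠ 0 → μ ∈ s := by
  refine ⟨(finite_weights b N).toFinset, fun μ v hv hμ h0 => ?_⟩
  rw [Set.Finite.mem_toFinset]
  intro hbot
  have h1 : (⟨v, hv⟩ : N) ∈ dualWeightSpace b N μ := (mem_weightSpace_coe N).2 hμ
  rw [hbot, Submodule.mem_bot] at h1
  exact h0 (congrArg Subtype.val h1)

theorem nsmul_coroot_injective (i : b.support) :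
    Function.Injective fun n : ℕ => n • P.coroot i := by
  intro n m hnm
  have h1 := congrArg (P.toLinearMap (P.root i)) hnm
  simp only [map_nsmul, RootPairing.root_coroot_two, nsmul_eq_mul] at h1
  omega

/-- The vectors `e_i ^ n v` have pairwise distinct weights inside a finite-dimensional submodule, so
they cannot all be nonzero. -/
theorem IsLocallyFinite.exists_pow_eq_zero (hM : IsLocallyFinite b M) {μ : Y} {v : M}
    (hv : v ∈ dualWeightSpace b M μ) (i : b.support ⊕ b.support) :
    ∃ n, ((chevalleyAct b M i) ^ n) v = 0 := by
  obtain ⟨N, hN, _⟩ := hM.finite v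
  obtain ⟨s, hs⟩ := exists_finset_weights N
  by_contra! hne
  have hinj : Function.Injective fun n : ℕ => μ + n • wt b i := by
    intro n m hnm
    have h1 := add_left_cancel hnm
    rcases i with i | i
    · exact nsmul_coroot_injective i h1
    · simp only [wt_inr, smul_neg, neg_inj] at h1
      exact nsmul_coroot_injective i h1
  have hsub : Set.range (fun n : ℕ => μ + n • wt b i) ⊆ s := by
    rintro _ ⟨n, rfl⟩
    exact hs _ _ (chevalleyAct_pow_mem_lieSubmodule N i hN n) (chevalleyAct_pow_mem i hv n) (hne n)
  exact Set.infinite_range_of_injective hinj (s.finite_toSet.subset hsub)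

/-- If `e_i ^ p` maps a vector of `α_i`-weight `-p` to a submodule `N`, then it lies in `N`. -/
theorem IsLocallyFinite.mem_of_pow_mem (hM : IsLocallyFinite b M)
    (N : LieSubmodule ℂ (DualLieAlgebra b) M) {μ : Y} {v : M}
    (hv : v ∈ dualWeightSpace b M μ) (i : b.support) (p : ℕ)
    (hp : P.toLinearMap (P.root i) μ = -p)
    (h : ((chevalleyAct b M (.inl i)) ^ p) v ∈ N) : v ∈ N := by
  obtain ⟨s, hs⟩ := hM.exists_pow_eq_zero hv (.inr i)
  refine (isSlTwoAction b i).mem_of_pow_e_mem (N := N.toSubmodule) (fun v hv => N.lie_mem hv)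
    (fun v hv => N.lie_mem hv) s p v ?_ (by rw [hs]; exact zero_mem _) h
  rw [LieModule.toEnd_apply_apply, lie_H_of_mem hv, hp]
  push_cast
  rfl

/-- If the `α_i`-weight were `-(p + 1)`, the injectivity of `e_i ^ (p + 1)` modulo `N` would put `v`
into `N`. Vectors that are highest modulo `N` thus have dominant weights. -/
theorem IsLocallyFinite.pairing_nonneg (hM : IsLocallyFinite b M)
    (N : LieSubmodule ℂ (DualLieAlgebra b) M) {μ : Y} {v : M}
    (hv : v ∈ dualWeightSpace b M μ) (hvN : v ∉ N) (i : b.support)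
    (h : ⁅e b (.inl i), v⁆ ∈ N) : 0 ≤ P.toLinearMap (P.root i) μ := by
  by_contra! hneg
  obtain ⟨p, hp⟩ : ∃ p : ℕ, P.toLinearMap (P.root i) μ = -((p + 1 : ℕ) : ℤ) :=
    ⟨(-P.toLinearMap (P.root i) μ - 1).toNat, by push_cast; omega⟩
  apply hvN
  refine hM.mem_of_pow_mem N hv i (p + 1) hp ?_
  rw [pow_succ, Module.End.mul_apply]
  exact chevalleyAct_pow_mem_lieSubmodule N _ h p

/-- Relative to a submodule `N`, every weight vector outside `N` generates a highest weight
vector outside `N`. -/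
theorem IsLocallyFinite.exists_primitive [Finite ι] [P.IsReduced] (hM : IsLocallyFinite b M)
    (N : LieSubmodule ℂ (DualLieAlgebra b) M) {μ : Y} {v : M}
    (hv : v ∈ dualWeightSpace b M μ) (hvN : v ∉ N) :
    ∃ γ ∈ corootCone b (active b M),
      ∃ x ∈ LieSubmodule.lieSpan ℂ (DualLieAlgebra b) {v},
        x ∉ N ∧ x ∈ dualWeightSpace b M (μ + γ) ∧ ∀ i, ⁅e b (.inl i), x⁆ ∈ N := by
  obtain ⟨x₀, -, hx₀⟩ := exists_height b
  obtain ⟨N', hvN', _⟩ := hM.finite v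
  obtain ⟨s, hs⟩ := exists_finset_weights N'
  have hle : LieSubmodule.lieSpan ℂ (DualLieAlgebra b) {v} ≤ N' :=
    LieSubmodule.lieSpan_le.2 (by simpa using hvN')
  -- Among the weight vectors outside `N` reached by adding active coroots to `μ`, one of greatest
  -- height is taken. Heights are bounded because the finite-dimensional `N'` has finitely many
  -- weights.
  let p : ℤ → Prop := fun n => ∃ γ ∈ corootCone b (active b M),
      ∃ x ∈ LieSubmodule.lieSpan ℂ (DualLieAlgebra b) {v},
        x ∉ N ∧ x ∈ dualWeightSpace b M (μ + γ) ∧ P.toLinearMap x₀ (μ + γ) = n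
  have hbdd : ∃ c : ℤ, ∀ n, p n → n ≤ c := by
    obtain ⟨c, hc⟩ := (s.image (P.toLinearMap x₀)).bddAbove
    refine ⟨c, ?_⟩
    rintro n ⟨γ, -, x, hx, hxN, hxw, rfl⟩
    exact hc (Finset.mem_coe.2 (Finset.mem_image_of_mem _
      (hs _ x (hle hx) hxw fun h => hxN (h ▸ zero_mem _))))
  obtain ⟨n, ⟨γ, hγ, x, hx, hxN, hxw, hn⟩, hmax⟩ := Int.exists_greatest_of_bdd hbdd
    ⟨_, 0, zero_mem _, v, LieSubmodule.subset_lieSpan rfl, hvN, by simpa using hv, rfl⟩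
  refine ⟨γ, hγ, x, hx, hxN, hxw, fun i => ?_⟩
  by_contra hi
  have hact : i ∈ active b M := ⟨x, fun h => hi (h ▸ zero_mem _)⟩
  have h1 := hmax (P.toLinearMap x₀ (μ + (γ + P.coroot i)))
    ⟨γ + P.coroot i, add_mem hγ (coroot_mem_corootCone b hact), _,
      LieSubmodule.lie_mem _ hx, hi, by rw [← add_assoc]; exact lie_e_mem (.inl i) hxw, rfl⟩
  rw [← add_assoc, map_add, hn, hx₀] at h1
  omega

/-- The span of the vectors `f_{i_1} ⋯ f_{i_n} v`. -/
def lowerSpan (v : M) : Submodule ℂ M :=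
  Submodule.span ℂ (Set.range fun l : List b.support => l.foldr (fun i w => ⁅e b (.inr i), w⁆) v)

theorem foldr_mem_weightSpace {μ : Y} {v : M} (hv : v ∈ dualWeightSpace b M μ)
    (l : List b.support) :
    ∃ ν, l.foldr (fun i w => ⁅e b (.inr i), w⁆) v ∈ dualWeightSpace b M ν := by
  induction l with
  | nil => exact ⟨μ, hv⟩
  | cons i l ih => obtain ⟨ν, hν⟩ := ih; exact ⟨_, lie_e_mem (.inr i) hν⟩

/-- The span of the lowering monomials is stable under the generators: `e_i` moves to the right past
each `f_j`, leaving a Cartan term when `i = j`, and finally kills `v`. -/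
theorem lieSpan_le_lowerSpan {μ : Y} {v : M} (hv : v ∈ dualWeightSpace b M μ)
    (he : ∀ i, ⁅e b (.inl i), v⁆ = 0) :
    (LieSubmodule.lieSpan ℂ (DualLieAlgebra b) {v}).toSubmodule ≤ lowerSpan (b := b) v := by
  have hmem : ∀ l : List b.support,
      l.foldr (fun i w => ⁅e b (.inr i), w⁆) v ∈ lowerSpan (b := b) v :=
    fun l => Submodule.subset_span ⟨l, rfl⟩
  have hspan : ∀ y : DualLieAlgebra b,
      (∀ l : List b.support,
        ⁅y, l.foldr (fun i w => ⁅e b (.inr i), w⁆) v⁆ ∈ lowerSpan (b := b) v) →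
      ∀ w ∈ lowerSpan (b := b) v, ⁅y, w⁆ ∈ lowerSpan (b := b) v := by
    intro y hy w hw
    induction hw using Submodule.span_induction with
    | mem w hw => obtain ⟨l, rfl⟩ := hw; exact hy l
    | zero => rw [lie_zero]; exact zero_mem _
    | add w w' _ _ h h' => rw [lie_add]; exact add_mem h h'
    | smul c w _ h => rw [lie_smul]; exact Submodule.smul_mem _ c h
  have hH : ∀ x, ∀ w ∈ lowerSpan (b := b) v, ⁅H b x, w⁆ ∈ lowerSpan (b := b) v := by
    intro x
    refine hspan _ fun l => ?_
    obtain ⟨ν, hν⟩ := foldr_mem_weightSpace hv l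
    rw [lie_H_of_mem hν]
    exact Submodule.smul_mem _ _ (hmem l)
  have hF : ∀ i, ∀ w ∈ lowerSpan (b := b) v, ⁅e b (.inr i), w⁆ ∈ lowerSpan (b := b) v :=
    fun i => hspan _ fun l => hmem (i :: l)
  have hE : ∀ i, ∀ w ∈ lowerSpan (b := b) v, ⁅e b (.inl i), w⁆ ∈ lowerSpan (b := b) v := by
    intro i
    refine hspan _ fun l => ?_
    induction l with
    | nil => rw [List.foldr_nil, he]; exact zero_mem _
    | cons j l ih =>
      rw [List.foldr_cons, leibniz_lie]
      refine add_mem ?_ (hF j _ ih)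
      by_cases hij : i = j
      · subst hij; rw [lie_E_F_same]; exact hH _ _ (hmem l)
      · rw [lie_E_F_ne b hij, zero_lie]; exact zero_mem _
  have hstab := lie_mem_of_generators b (lowerSpan (b := b) v) hH
    (fun i => by rcases i with i | i; exacts [hE i, hF i])
  let N : LieSubmodule ℂ (DualLieAlgebra b) M :=
    { lowerSpan (b := b) v with lie_mem := fun {y w} hw => hstab y w hw }
  have : LieSubmodule.lieSpan ℂ (DualLieAlgebra b) {v} ≤ N :=
    LieSubmodule.lieSpan_le.2 (Set.singleton_subset_iff.2 (hmem []))
  exact this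

/-- A nonzero monomial of positive length lowers the weight by a nonzero sum of active coroots; only
the empty monomial keeps the weight `μ`. -/
theorem lowerSpan_le [Finite ι] [P.IsReduced] {μ : Y} {v : M}
    (hv : v ∈ dualWeightSpace b M μ) :
    lowerSpan (b := b) v ≤ Submodule.span ℂ {v} ⊔
      ⨆ γ ∈ {γ | γ ∈ corootCone b (active b M) ∧ γ ≠ 0}, dualWeightSpace b M (μ - γ) := by
  obtain ⟨x, -, hx⟩ := exists_height b
  have key : ∀ l : List b.support, l.foldr (fun i w => ⁅e b (.inr i), w⁆) v = 0 ∨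
      ∃ γ ∈ corootCone b (active b M), (l ≠ [] → γ ≠ 0) ∧
        l.foldr (fun i w => ⁅e b (.inr i), w⁆) v ∈ dualWeightSpace b M (μ - γ) := by
    intro l
    induction l with
    | nil => exact Or.inr ⟨0, zero_mem _, by simp, by simpa using hv⟩
    | cons i l ih =>
      rw [List.foldr_cons]
      by_cases h0 : ⁅e b (.inr i), l.foldr (fun i w => ⁅e b (.inr i), w⁆) v⁆ = 0
      · exact Or.inl h0
      right
      rcases ih with ih | ⟨γ, hγ, -, hw⟩
      · rw [ih, lie_zero] at h0; exact absurd rfl h0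
      refine ⟨γ + P.coroot i,
        add_mem hγ (coroot_mem_corootCone b (active_of_lie_f_ne_zero b h0)), fun _ h => ?_, ?_⟩
      · obtain ⟨n, hn, -⟩ := height_pos b hx hγ
        have := congrArg (P.toLinearMap x) h
        rw [map_add, hn, hx, map_zero] at this
        omega
      · rw [← sub_sub, sub_eq_add_neg]
        exact lie_e_mem (.inr i) hw
  refine Submodule.span_le.2 ?_
  rintro _ ⟨l, rfl⟩
  rcases key l with h | ⟨γ, hγ, hγ0, hw⟩
  · dsimp only; rw [h]; exact zero_mem _
  · by_cases hl : l = []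
    · subst hl
      exact Submodule.mem_sup_left (Submodule.mem_span_singleton_self v)
    · refine Submodule.mem_sup_right ?_
      have hle := le_biSup (fun γ => dualWeightSpace b M (μ - γ))
        (show γ ∈ {γ | γ ∈ corootCone b (active b M) ∧ γ ≠ 0} from ⟨hγ, hγ0 hl⟩)
      exact hle hw

/-- The weights of the submodule generated by a highest weight vector. -/
theorem mem_lieSpan_primitive [Finite ι] [P.IsReduced] {μ ν : Y} {v w : M}
    (hv : v ∈ dualWeightSpace b M μ) (he : ∀ i, ⁅e b (.inl i), v⁆ = 0)
    (hw : w ∈ LieSubmodule.lieSpan ℂ (DualLieAlgebra b) {v})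
    (hν : w ∈ dualWeightSpace b M ν) (h0 : w ≠ 0) :
    (∃ c : ℂ, w = c • v) ∨ ∃ γ ∈ corootCone b (active b M), γ ≠ 0 ∧ μ = ν + γ := by
  have h1 := lowerSpan_le hv (lieSpan_le_lowerSpan hv he hw)
  obtain ⟨u, hu, z, hz, hsum⟩ := Submodule.mem_sup.1 h1
  obtain ⟨c, rfl⟩ := Submodule.mem_span_singleton.1 hu
  have hdis := (iSupIndep_weightSpace b M) ν
  by_cases hcon : ∃ γ ∈ corootCone b (active b M), γ ≠ 0 ∧ μ = ν + γ
  · exact Or.inr hcon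
  left
  have hz' : z ∈ ⨆ κ, ⨆ (_ : κ ≠ ν), dualWeightSpace b M κ := by
    suffices hle : ⨆ γ ∈ {γ | γ ∈ corootCone b (active b M) ∧ γ ≠ 0},
        dualWeightSpace b M (μ - γ) ≤ ⨆ κ, ⨆ (_ : κ ≠ ν), dualWeightSpace b M κ from hle hz
    refine iSup₂_le fun γ hγ => ?_
    exact le_iSup₂_of_le (f := fun κ (_ : κ ≠ ν) => dualWeightSpace b M κ) (μ - γ)
      (fun h => hcon ⟨γ, hγ.1, hγ.2, by rw [← h]; abel⟩) le_rfl
  by_cases hμ : μ = ν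
  · subst hμ
    refine ⟨c, ?_⟩
    have h2 : w - c • v ∈ dualWeightSpace b M μ :=
      Submodule.sub_mem _ hν (Submodule.smul_mem _ c hv)
    have h3 : w - c • v = z := by rw [← hsum]; abel
    rw [← sub_eq_zero]
    exact (Submodule.disjoint_def.1 hdis) _ h2 (h3 ▸ hz')
  · exfalso
    apply h0
    refine (Submodule.disjoint_def.1 hdis) _ hν ?_
    rw [← hsum]
    refine add_mem (Submodule.smul_mem _ c ?_) hz'
    exact (le_iSup₂_of_le (f := fun κ (_ : κ ≠ ν) => dualWeightSpace b M κ) μ hμ le_rfl :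
      dualWeightSpace b M μ ≤ _) hv

end DualLieAlgebra

end

/-! ### Weights of the adjoint module, and the trace form of a finite-dimensional module -/

noncomputable section

namespace DualLieAlgebra

attribute [local instance] LieRing.ofAssociativeRing

variable {ι X Y : Type*} [AddCommGroup X] [AddCommGroup Y]
variable {P : RootDatum ι X Y} (b : P.Base)
variable {M : Type*} [AddCommGroup M] [Module ℂ M]
  [LieRingModule (DualLieAlgebra b) M] [LieModule ℂ (DualLieAlgebra b) M]

section Weights

variable {b}

/-- The elements of `S` of other weights lie in the sum of the other weight spaces, which is
independent of that of weight `μ`. -/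
theorem mem_span_inter_weightSpace {S : Set M} (hS : ∀ s ∈ S, ∃ μ, s ∈ dualWeightSpace b M μ)
    {μ : Y} {v : M} (hv : v ∈ dualWeightSpace b M μ) (hvS : v ∈ Submodule.span ℂ S) :
    v ∈ Submodule.span ℂ (S ∩ (dualWeightSpace b M μ : Set M)) := by
  have hle : Submodule.span ℂ S ≤ Submodule.span ℂ (S ∩ (dualWeightSpace b M μ : Set M)) ⊔
      ⨆ κ, ⨆ (_ : κ ≠ μ), dualWeightSpace b M κ := by
    refine Submodule.span_le.2 fun s hs => ?_
    obtain ⟨κ, hκ⟩ := hS s hs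
    by_cases h : κ = μ
    · subst h
      exact Submodule.mem_sup_left (Submodule.subset_span ⟨hs, hκ⟩)
    · refine Submodule.mem_sup_right ?_
      exact (le_iSup₂_of_le (f := fun κ (_ : κ ≠ μ) => dualWeightSpace b M κ) κ h le_rfl :
        dualWeightSpace b M κ ≤ _) hκ
  obtain ⟨u, hu, z, hz, rfl⟩ := Submodule.mem_sup.1 (hle hvS)
  have huμ : u ∈ dualWeightSpace b M μ :=
    (Submodule.span_le.2 Set.inter_subset_right :
      Submodule.span ℂ (S ∩ (dualWeightSpace b M μ : Set M)) ≤ dualWeightSpace b M μ) hu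
  have hzμ : z ∈ dualWeightSpace b M μ := by
    have := Submodule.sub_mem _ hv huμ
    rwa [add_sub_cancel_left] at this
  have := (Submodule.disjoint_def.1 ((iSupIndep_weightSpace b M) μ)) z hzμ hz
  rw [this, add_zero]
  exact hu

theorem cartan_le_weightSpace : cartan b ≤ dualWeightSpace b (DualLieAlgebra b) 0 := by
  intro y hy x
  rw [lie_H_cartan b x hy, map_zero, zero_smul]

theorem weight_unique_of_ne_zero {μ ν : Y} {v : M} (hv : v ≠ 0)
    (hμ : v ∈ dualWeightSpace b M μ) (hν : v ∈ dualWeightSpace b M ν) : μ = ν := by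
  by_contra h
  refine hv ((Submodule.disjoint_def.1 ((iSupIndep_weightSpace b M).pairwiseDisjoint h)) v hμ hν)

theorem sgn_smul_ne_zero {γ : Y} (hγ : γ ≠ 0) (s : Bool) : sgn s • γ ≠ 0 := by
  cases s <;> simpa [sgn] using hγ

variable [Finite ι] [P.IsReduced]

/-- The weights of the adjoint module. -/
theorem weight_cases {β : Y} {y : DualLieAlgebra b}
    (hy : y ∈ dualWeightSpace b (DualLieAlgebra b) β) (h0 : y ≠ 0) :
    (β = 0 ∧ y ∈ cartan b) ∨ ∃ s, ∃ γ ∈ corootCone b Set.univ, γ ≠ 0 ∧ β = sgn s • γ := by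
  have h1 : y ∈ Submodule.span ℂ
      ((cartan b : Set (DualLieAlgebra b)) ∪ ⋃ s, nilpWeightVectors b s) := by
    rw [span_weightVectors]; trivial
  have h2 := mem_span_inter_weightSpace (b := b) (fun z hz => by
    rcases hz with hz | hz
    · exact ⟨0, cartan_le_weightSpace hz⟩
    · obtain ⟨s, -, γ, -, -, hz⟩ := Set.mem_iUnion.1 hz
      exact ⟨_, hz⟩) hy h1
  by_cases hcon : ∃ s, ∃ γ ∈ corootCone b Set.univ, γ ≠ 0 ∧ β = sgn s • γ
  · exact Or.inr hcon
  left
  have h3 : y ∈ cartan b := by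
    refine (Submodule.span_le.2 ?_ : _ ≤ cartan b) h2
    rintro z ⟨hz | hz, hzβ⟩
    · exact hz
    · obtain ⟨s, -, γ, hγ, hγ0, hz⟩ := Set.mem_iUnion.1 hz
      by_cases hz0 : z = 0
      · rw [hz0]; exact zero_mem _
      · exact absurd ⟨s, γ, hγ, hγ0, weight_unique_of_ne_zero hz0 hzβ hz⟩ hcon
  exact ⟨weight_unique_of_ne_zero h0 hy (cartan_le_weightSpace h3), h3⟩

theorem mem_cartan_of_weight_zero {y : DualLieAlgebra b}
    (hy : y ∈ dualWeightSpace b (DualLieAlgebra b) 0) : y ∈ cartan b := by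
  by_cases h0 : y = 0
  · rw [h0]; exact zero_mem _
  rcases weight_cases hy h0 with h | ⟨s, γ, -, hγ, h⟩
  · exact h.2
  · exact absurd h.symm (sgn_smul_ne_zero hγ s)

theorem isWeightModule_adjoint : IsWeightModule b (DualLieAlgebra b) := by
  rw [IsWeightModule, eq_top_iff, ← span_weightVectors b]
  refine Submodule.span_le.2 ?_
  rintro z (hz | hz)
  · exact Submodule.mem_iSup_of_mem 0 (cartan_le_weightSpace hz)
  · obtain ⟨s, -, γ, -, -, hz⟩ := Set.mem_iUnion.1 hz
    exact Submodule.mem_iSup_of_mem _ hz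

end Weights

/-! ### The action of the Cartan subalgebra -/

/-- Formal linear combinations of the Cartan generators. -/
def cartanComb : (X →₀ ℂ) →ₗ[ℂ] DualLieAlgebra b := Finsupp.linearCombination ℂ (H b)

/-- The eigenvalue of a linear combination of Cartan generators on a weight space. -/
def cartanEval (P : RootDatum ι X Y) (μ : Y) : (X →₀ ℂ) →ₗ[ℂ] ℂ :=
  Finsupp.linearCombination ℂ fun x => (P.toLinearMap x μ : ℂ)

theorem cartanEval_add (μ ν : Y) (c : X →₀ ℂ) :
    cartanEval P (μ + ν) c = cartanEval P μ c + cartanEval P ν c := by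
  simp only [cartanEval, Finsupp.linearCombination_apply, map_add, Int.cast_add, smul_add]
  exact Finsupp.sum_add

theorem mem_cartan_iff {y : DualLieAlgebra b} : y ∈ cartan b ↔ ∃ c, cartanComb b c = y :=
  Finsupp.mem_span_range_iff_exists_finsupp

variable {b}

/-- A formal combination has an eigenvalue at each `μ`, whatever linear relations hold among the `H
x` in the quotient. -/
theorem lie_cartanComb {μ : Y} {v : M} (hv : v ∈ dualWeightSpace b M μ) (c : X →₀ ℂ) :
    ⁅cartanComb b c, v⁆ = cartanEval P μ c • v := by
  induction c using Finsupp.induction_linear with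
  | zero => simp
  | add c c' h h' => rw [map_add, map_add, add_lie, h, h', add_smul]
  | single x r =>
    simp only [cartanComb, cartanEval, Finsupp.linearCombination_single, smul_lie,
      lie_H_of_mem hv, smul_smul, smul_eq_mul]

/-- A basis of weight vectors. -/
theorem IsWeightModule.exists_basis [FiniteDimensional ℂ M] (hM : IsWeightModule b M) :
    ∃ (n : ℕ) (m : Module.Basis (Fin n) ℂ M) (ν : Fin n → Y),
      ∀ j, m j ∈ dualWeightSpace b M (ν j) := by
  have hspan : ⊤ ≤ Submodule.span ℂ (⋃ μ : Y, (dualWeightSpace b M μ : Set M)) := by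
    rw [← hM]
    exact iSup_le fun μ v hv => Submodule.subset_span (Set.mem_iUnion.2 ⟨μ, hv⟩)
  let B := Module.Basis.ofSpan hspan
  have : Finite _ := Module.Finite.finite_basis B
  obtain ⟨n, ⟨ε⟩⟩ := Finite.exists_equiv_fin (↥((linearIndepOn_empty ℂ id).extend
    (Set.empty_subset (⋃ μ : Y, (dualWeightSpace b M μ : Set M)))))
  have h : ∀ j, ∃ μ, (B.reindex ε) j ∈ dualWeightSpace b M μ := fun j =>
    Set.mem_iUnion.1 (Module.Basis.ofSpan_subset hspan ⟨ε.symm j, by simp [B]⟩)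
  choose ν hν using h
  exact ⟨n, B.reindex ε, ν, hν⟩

theorem traceForm_cartanComb [FiniteDimensional ℂ M] {n : ℕ} (m : Module.Basis (Fin n) ℂ M)
    (ν : Fin n → Y) (hν : ∀ j, m j ∈ dualWeightSpace b M (ν j)) (c c' : X →₀ ℂ) :
    LieModule.traceForm ℂ (DualLieAlgebra b) M (cartanComb b c) (cartanComb b c') =
      ∑ j, cartanEval P (ν j) c * cartanEval P (ν j) c' := by
  rw [LieModule.traceForm_apply_apply, LinearMap.trace_eq_matrix_trace ℂ m, Matrix.trace]
  refine Finset.sum_congr rfl fun j _ => ?_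
  rw [Matrix.diag_apply, LinearMap.toMatrix_apply, LinearMap.comp_apply,
    LieModule.toEnd_apply_apply, LieModule.toEnd_apply_apply, lie_cartanComb (hν j),
    lie_smul, lie_cartanComb (hν j)]
  simp [mul_comm]

theorem cartanComb_act_eq_zero [FiniteDimensional ℂ M] {n : ℕ} (m : Module.Basis (Fin n) ℂ M)
    (ν : Fin n → Y) (hν : ∀ j, m j ∈ dualWeightSpace b M (ν j)) (c : X →₀ ℂ)
    (h : ∀ j, cartanEval P (ν j) c = 0) :
    LieModule.toEnd ℂ (DualLieAlgebra b) M (cartanComb b c) = 0 := by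
  refine m.ext fun j => ?_
  rw [LieModule.toEnd_apply_apply, lie_cartanComb (hν j), h, zero_smul, LinearMap.zero_apply]

/-- Weights are integral on `X`, so conjugating coefficients conjugates eigenvalues. Pairing a
Cartan element with its conjugate then gives a sum of absolute squares. -/
theorem cartanEval_conj (μ : Y) (c : X →₀ ℂ) :
    cartanEval P μ (c.mapRange (starRingEnd ℂ) (map_zero _)) =
      starRingEnd ℂ (cartanEval P μ c) := by
  induction c using Finsupp.induction_linear with
  | zero => simp
  | add c c' h h' =>
    rw [Finsupp.mapRange_add (by simp), map_add, map_add, map_add, h, h']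
  | single x r => simp [cartanEval]

/-! ### Nondegeneracy of the trace form -/

/-- Invariance under `H x` shows that `⟨x, μ + ν⟩` annihilates the value of the form; if that value
were nonzero, `μ + ν` would pair to zero with every `x`. -/
theorem traceForm_eq_zero_of_weight {μ ν : Y} {y z : DualLieAlgebra b}
    (hy : y ∈ dualWeightSpace b (DualLieAlgebra b) μ)
    (hz : z ∈ dualWeightSpace b (DualLieAlgebra b) ν) (hne : μ + ν ≠ 0) :
    LieModule.traceForm ℂ (DualLieAlgebra b) M y z = 0 := by
  by_contra h0
  apply hne
  apply (LinearMap.IsPerfPair.bijective_right P.toLinearMap).1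
  ext x
  have h1 := LieModule.traceForm_apply_lie_apply ℂ (DualLieAlgebra b) M y (H b x) z
  rw [← lie_skew, lie_H_of_mem hy, lie_H_of_mem hz, map_neg, LinearMap.neg_apply, map_smul,
    map_smul, LinearMap.smul_apply, smul_eq_mul, smul_eq_mul, ← neg_mul] at h1
  have h2 := mul_right_cancel₀ h0 h1
  have h3 : (((P.toLinearMap x) (μ + ν) : ℤ) : ℂ) = 0 := by
    rw [map_add]; push_cast; rw [← h2]; ring
  simpa using (by exact_mod_cast h3 : (P.toLinearMap x) (μ + ν) = 0)

variable (b M) in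
/-- The radical of the trace form. -/
def traceRadical : LieSubmodule ℂ (DualLieAlgebra b) (DualLieAlgebra b) :=
  { LinearMap.ker (LieModule.traceForm ℂ (DualLieAlgebra b) M) with
    lie_mem := fun {y z} hz => by
      change LieModule.traceForm ℂ (DualLieAlgebra b) M ⁅y, z⁆ = 0
      have hz' : LieModule.traceForm ℂ (DualLieAlgebra b) M z = 0 := hz
      ext w
      rw [← lie_skew, map_neg, LinearMap.neg_apply, LieModule.traceForm_apply_lie_apply, hz']
      simp }

theorem mem_traceRadical {y : DualLieAlgebra b} :
    y ∈ traceRadical b M ↔ LieModule.traceForm ℂ (DualLieAlgebra b) M y = 0 := Iff.rfl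

variable (b M) in
/-- The kernel of the action on `M`. -/
def actKer : LieSubmodule ℂ (DualLieAlgebra b) (DualLieAlgebra b) :=
  { carrier := {y | LieModule.toEnd ℂ (DualLieAlgebra b) M y = 0}
    add_mem' := fun {y z} (hy : _ = 0) (hz : _ = 0) => by
      change _ = 0; rw [map_add, hy, hz, add_zero]
    zero_mem' := map_zero _
    smul_mem' := fun c y (hy : _ = 0) => by change _ = 0; rw [map_smul, hy, smul_zero]
    lie_mem := fun {y z} hz => by
      have hz' : LieModule.toEnd ℂ (DualLieAlgebra b) M z = 0 := hz
      change LieModule.toEnd ℂ (DualLieAlgebra b) M ⁅y, z⁆ = 0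
      rw [LieHom.map_lie, hz', lie_zero] }

theorem mem_actKer {y : DualLieAlgebra b} :
    y ∈ actKer b M ↔ LieModule.toEnd ℂ (DualLieAlgebra b) M y = 0 := Iff.rfl

theorem mem_actKer_of_traceRadical_of_cartan [FiniteDimensional ℂ M] (hM : IsWeightModule b M)
    {y : DualLieAlgebra b} (hy : y ∈ traceRadical b M) (hc : y ∈ cartan b) :
    y ∈ actKer b M := by
  obtain ⟨n, m, ν, hν⟩ := hM.exists_basis
  obtain ⟨c, rfl⟩ := (mem_cartan_iff b).1 hc
  rw [mem_actKer]
  refine cartanComb_act_eq_zero m ν hν c ?_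
  have h1 := traceForm_cartanComb m ν hν c (c.mapRange (starRingEnd ℂ) (map_zero _))
  rw [mem_traceRadical.1 hy, LinearMap.zero_apply] at h1
  simp only [cartanEval_conj, Complex.mul_conj] at h1
  have h2 : ∑ j, Complex.normSq (cartanEval P (ν j) c) = 0 := by exact_mod_cast h1.symm
  rw [Finset.sum_eq_zero_iff_of_nonneg fun j _ => Complex.normSq_nonneg _] at h2
  exact fun j => Complex.normSq_eq_zero.1 (h2 j (Finset.mem_univ j))

theorem isNilpotent_act [FiniteDimensional ℂ M] (hM : IsWeightModule b M)
    (i : b.support ⊕ b.support) : IsNilpotent (chevalleyAct b M i) := by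
  rw [Module.End.isNilpotent_iff_of_finite]
  intro v
  obtain ⟨s, f, hf, rfl⟩ := hM.exists_sum v
  choose n hn using fun μ => (hM.isLocallyFinite b).exists_pow_eq_zero (hf μ) i
  refine ⟨∑ μ ∈ s, n μ, ?_⟩
  rw [map_sum]
  refine Finset.sum_eq_zero fun μ hμ => ?_
  exact Module.End.pow_map_zero_of_le (Finset.single_le_sum (f := n) (fun _ _ => Nat.zero_le _) hμ)
    (hn μ)

/-- `e_i` acts nilpotently on `M`, so the commutator with it is nilpotent on `End M`. -/
theorem exists_ad_pow_mem_actKer [FiniteDimensional ℂ M] (hM : IsWeightModule b M)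
    (i : b.support ⊕ b.support) (y : DualLieAlgebra b) :
    ∃ n, ((chevalleyAct b (DualLieAlgebra b) i) ^ n) y ∈ actKer b M := by
  obtain ⟨n, hn⟩ := LieAlgebra.ad_nilpotent_of_nilpotent (R := ℂ) (isNilpotent_act hM i)
  refine ⟨n, ?_⟩
  have key : ∀ n, LieModule.toEnd ℂ (DualLieAlgebra b) M
      (((chevalleyAct b (DualLieAlgebra b) i) ^ n) y) =
      ((LieAlgebra.ad ℂ (Module.End ℂ M) (chevalleyAct b M i)) ^ n)
        (LieModule.toEnd ℂ (DualLieAlgebra b) M y) := by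
    intro n
    induction n with
    | zero => simp
    | succ n ih =>
      rw [pow_succ', Module.End.mul_apply, pow_succ', Module.End.mul_apply, ← ih,
        chevalleyAct_apply, LieHom.map_lie]
      rfl
  rw [mem_actKer, key, hn, LinearMap.zero_apply]

variable [Finite ι] [P.IsReduced]

/-- Otherwise take a weight vector in the radical, outside the kernel, of least absolute height.
Weight zero is excluded by positivity on the Cartan part. If the weight is `±γ`, each step toward
zero lands in the kernel, so `𝔰𝔩₂`-theory modulo the kernel makes `γ` pair nonpositively with all
simple roots, and such an element of the cone is zero. -/
theorem traceRadical_le [FiniteDimensional ℂ M] (hM : IsWeightModule b M) :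
    traceRadical b M ≤ actKer b M := by
  obtain ⟨x, -, hx⟩ := exists_height b
  by_contra hcon
  obtain ⟨y, hy, hyN⟩ := SetLike.not_le_iff_exists.1 hcon
  let p : ℕ → Prop := fun n => ∃ β, ∃ y ∈ dualWeightSpace b (DualLieAlgebra b) β,
    y ∈ traceRadical b M ∧ y ∉ actKer b M ∧ (P.toLinearMap x β).natAbs = n
  have hp : ∃ n, p n := by
    obtain ⟨s, f, hf, rfl⟩ := (isWeightModule_adjoint (b := b)).exists_sum y
    have h1 := mem_of_sum_mem_of_stable (b := b) (N := (traceRadical b M).toSubmodule)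
      (fun x v hv => (traceRadical b M).lie_mem hv) s f (fun ν _ => hf ν) hy
    by_contra! hno
    apply hyN
    refine sum_mem fun ν hν => ?_
    by_contra h
    exact hno _ ⟨ν, f ν, hf ν, h1 ν hν, h, rfl⟩
  classical
  obtain ⟨β, y, hyβ, hy, hyN, hn⟩ := Nat.find_spec hp
  have hmin : ∀ β', ∀ y' ∈ dualWeightSpace b (DualLieAlgebra b) β', y' ∈ traceRadical b M →
      (P.toLinearMap x β').natAbs < (P.toLinearMap x β).natAbs → y' ∈ actKer b M := by
    intro β' y' h1 h2 h3
    by_contra h4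
    exact Nat.find_min hp (hn ▸ h3) ⟨β', y', h1, h2, h4, rfl⟩
  have hy0 : y ≠ 0 := fun h => hyN (h ▸ zero_mem _)
  rcases weight_cases hyβ hy0 with ⟨-, hc⟩ | ⟨s, γ, hγ, hγ0, rfl⟩
  · exact hyN (mem_actKer_of_traceRadical_of_cartan hM hy hc)
  apply hγ0
  obtain ⟨n, hγn, hn0⟩ := height_pos b hx hγ
  have hn0' : n ≠ 0 := fun h => hγ0 (hn0 h)
  refine eq_zero_of_mem_corootCone b hγ fun i => ?_
  have hlow : ⁅e b (side b (!s) i), y⁆ ∈ actKer b M := by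
    refine hmin _ _ (lie_e_mem _ hyβ) ((traceRadical b M).lie_mem hy) ?_
    rw [wt_side, map_add, map_zsmul, map_zsmul, hγn, hx]
    cases s <;> simp [sgn] <;> omega
  by_contra! hpos
  obtain ⟨q, hq⟩ : ∃ q : ℕ, P.toLinearMap (P.root i) γ = ((q + 1 : ℕ) : ℤ) :=
    ⟨(P.toLinearMap (P.root i) γ - 1).toNat, by push_cast; omega⟩
  apply hyN
  have hadd : ∀ j, ∀ v ∈ actKer b M, chevalleyAct b (DualLieAlgebra b) j v ∈ actKer b M :=
    fun j v hv => (actKer b M).lie_mem hv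
  have hpow : ((chevalleyAct b (DualLieAlgebra b) (side b (!s) i)) ^ (q + 1)) y ∈ actKer b M := by
    rw [pow_succ, Module.End.mul_apply]
    exact chevalleyAct_pow_mem_lieSubmodule _ _ hlow q
  obtain ⟨t, ht⟩ := exists_ad_pow_mem_actKer hM (side b s i) y
  -- The operator that moves toward height zero plays the role of `e`; for `s = true` this is `f_i`,
  -- hence the symmetric action.
  cases s
  · refine (isSlTwoAction b i).mem_of_pow_e_mem (N := (actKer b M).toSubmodule) (hadd _) (hadd _)
      t (q + 1) y ?_ ht hpow
    rw [LieModule.toEnd_apply_apply, lie_H_of_mem hyβ, map_zsmul, hq]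
    simp [sgn]
  · refine (isSlTwoAction b i).symm.mem_of_pow_e_mem (N := (actKer b M).toSubmodule) (hadd _)
      (hadd _) t (q + 1) y ?_ ht hpow
    rw [LinearMap.neg_apply, LieModule.toEnd_apply_apply, lie_H_of_mem hyβ, map_zsmul, hq]
    simp only [sgn, if_true, one_smul, neg_smul]
    push_cast
    rfl

end DualLieAlgebra

end

/-! ### Dual bases for the trace form -/

noncomputable section

namespace DualLieAlgebra

variable {ι X Y : Type*} [AddCommGroup X] [AddCommGroup Y]
variable {P : RootDatum ι X Y} (b : P.Base)
variable (M : Type*) [AddCommGroup M] [Module ℂ M]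
  [LieRingModule (DualLieAlgebra b) M] [LieModule ℂ (DualLieAlgebra b) M]

/-- Elements of `𝔤^∨` of pure weight that induce a basis of the image of `𝔤^∨` in `End M`,
together with representatives of the dual basis with respect to the trace form. -/
structure DualBases where
  /-- The number of basis elements. -/
  n : ℕ
  /-- The weights. -/
  β : Fin n → Y
  /-- The basis elements. -/
  a : Fin n → DualLieAlgebra b
  /-- The dual basis elements. -/
  d : Fin n → DualLieAlgebra b
  a_mem (k : Fin n) : a k ∈ dualWeightSpace b (DualLieAlgebra b) (β k)
  d_mem (k : Fin n) : d k ∈ dualWeightSpace b (DualLieAlgebra b) (-β k)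
  type (k : Fin n) : (β k = 0 ∧ a k ∈ cartan b ∧ d k ∈ cartan b) ∨
    ∃ s, (∃ γ ∈ corootCone b Set.univ, γ ≠ 0 ∧ β k = sgn s • γ) ∧
      a k ∈ nilp b s ∧ d k ∈ nilp b (!s)
  form_a_d (j k : Fin n) :
    LieModule.traceForm ℂ (DualLieAlgebra b) M (a j) (d k) = if j = k then 1 else 0
  act_eq_a (y : DualLieAlgebra b) : LieModule.toEnd ℂ (DualLieAlgebra b) M y =
    ∑ k, LieModule.traceForm ℂ (DualLieAlgebra b) M y (d k) •
      LieModule.toEnd ℂ (DualLieAlgebra b) M (a k)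
  act_eq_d (y : DualLieAlgebra b) : LieModule.toEnd ℂ (DualLieAlgebra b) M y =
    ∑ k, LieModule.traceForm ℂ (DualLieAlgebra b) M y (a k) •
      LieModule.toEnd ℂ (DualLieAlgebra b) M (d k)

variable {b M}

theorem traceForm_congr {y y' : DualLieAlgebra b}
    (h : LieModule.toEnd ℂ (DualLieAlgebra b) M y = LieModule.toEnd ℂ (DualLieAlgebra b) M y')
    (z : DualLieAlgebra b) : LieModule.traceForm ℂ (DualLieAlgebra b) M y z =
      LieModule.traceForm ℂ (DualLieAlgebra b) M y' z := by
  rw [LieModule.traceForm_apply_apply, h, LieModule.traceForm_apply_apply]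

variable [Finite ι] [P.IsReduced]

/-- Elements of pure weight that induce a basis of the image of `𝔤^∨`. -/
theorem exists_weight_basis [FiniteDimensional ℂ M] :
    ∃ (n : ℕ) (β : Fin n → Y) (a : Fin n → DualLieAlgebra b),
      (∀ k, a k ∈ dualWeightSpace b (DualLieAlgebra b) (β k)) ∧
      (∀ k, (β k = 0 ∧ a k ∈ cartan b) ∨
        ∃ s, (∃ γ ∈ corootCone b Set.univ, γ ≠ 0 ∧ β k = sgn s • γ) ∧ a k ∈ nilp b s) ∧
      LinearIndependent ℂ (fun k => LieModule.toEnd ℂ (DualLieAlgebra b) M (a k)) ∧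
      ∀ y, ∃ c : Fin n → ℂ, LieModule.toEnd ℂ (DualLieAlgebra b) M y =
        LieModule.toEnd ℂ (DualLieAlgebra b) M (∑ k, c k • a k) := by
  set S : Set (DualLieAlgebra b) :=
    (cartan b : Set (DualLieAlgebra b)) ∪ ⋃ s, nilpWeightVectors b s with hS
  let ρ : DualLieAlgebra b →ₗ[ℂ] Module.End ℂ M := LieModule.toEnd ℂ (DualLieAlgebra b) M
  obtain ⟨T, hTS, hspan, hind⟩ := exists_linearIndependent ℂ (ρ '' S)
  have hfin : Finite T := hind.finite
  obtain ⟨n, ⟨ε⟩⟩ := Finite.exists_equiv_fin T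
  have hex : ∀ t : T, ∃ y ∈ S, ρ y = t := fun t => hTS t.2
  choose a haS haρ using hex
  have hβ : ∀ t : T, ∃ β, a t ∈ dualWeightSpace b (DualLieAlgebra b) β ∧
      ((β = 0 ∧ a t ∈ cartan b) ∨
        ∃ s, (∃ γ ∈ corootCone b Set.univ, γ ≠ 0 ∧ β = sgn s • γ) ∧ a t ∈ nilp b s) := by
    intro t
    rcases haS t with h | h
    · exact ⟨0, cartan_le_weightSpace h, Or.inl ⟨rfl, h⟩⟩
    · obtain ⟨s, hs, γ, hγ, hγ0, hw⟩ := Set.mem_iUnion.1 h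
      exact ⟨_, hw, Or.inr ⟨s, ⟨γ, hγ, hγ0, rfl⟩, hs⟩⟩
  choose β hβw hβc using hβ
  refine ⟨n, fun k => β (ε.symm k), fun k => a (ε.symm k), fun k => hβw _, fun k => hβc _, ?_, ?_⟩
  · have h1 : (fun k => LieModule.toEnd ℂ (DualLieAlgebra b) M (a (ε.symm k))) =
        (fun t : T => (t : Module.End ℂ M)) ∘ ε.symm := by
      funext k; exact haρ _
    rw [h1]
    exact hind.comp _ ε.symm.injective
  · intro y
    have hy : ρ y ∈ Submodule.span ℂ (Set.range fun k => ρ (a (ε.symm k))) := by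
      have h1 : Set.range (fun k => ρ (a (ε.symm k))) = T := by
        ext f
        constructor
        · rintro ⟨k, rfl⟩; dsimp only; rw [haρ]; exact (ε.symm k).2
        · intro hf; exact ⟨ε ⟨f, hf⟩, by simp [haρ]⟩
      rw [h1, hspan, ← Submodule.map_span, span_weightVectors]
      exact Submodule.mem_map_of_mem trivial
    obtain ⟨c, hc⟩ := (Submodule.mem_span_range_iff_exists_fun ℂ).1 hy
    refine ⟨c, ?_⟩
    change ρ y = ρ _
    rw [← hc, map_sum]
    simp only [map_smul]

/-- By nondegeneracy the Gram matrix of the `a k` is invertible, which yields the dual elements. -/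
theorem exists_dualBases [FiniteDimensional ℂ M] (hM : IsWeightModule b M) :
    Nonempty (DualBases b M) := by
  classical
  obtain ⟨n, β, a, haw, hac, hind, hsp⟩ := exists_weight_basis (b := b) (M := M)
  set T := LieModule.traceForm ℂ (DualLieAlgebra b) M with hT
  have hnd : ∀ y, (∀ k, T y (a k) = 0) → LieModule.toEnd ℂ (DualLieAlgebra b) M y = 0 := by
    intro y hy
    refine traceRadical_le hM ?_
    rw [mem_traceRadical]
    ext z
    obtain ⟨c, hc⟩ := hsp z
    rw [LieModule.traceForm_comm, traceForm_congr hc, LieModule.traceForm_comm, map_sum]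
    simp only [map_smul, ← hT, hy, smul_zero, Finset.sum_const_zero, LinearMap.zero_apply]
  have hcomb : ∀ c : Fin n → ℂ, LieModule.toEnd ℂ (DualLieAlgebra b) M (∑ k, c k • a k) = 0 →
      c = 0 := by
    intro c hc
    rw [map_sum] at hc
    simp only [map_smul] at hc
    funext k
    exact Fintype.linearIndependent_iff.1 hind c hc k
  let Φ : (Fin n → ℂ) →ₗ[ℂ] (Fin n → ℂ) :=
    { toFun := fun c j => T (∑ k, c k • a k) (a j)
      map_add' := fun c c' => by
        funext j
        simp [add_smul, Finset.sum_add_distrib]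
      map_smul' := fun r c => by
        funext j
        simp [mul_smul, ← Finset.smul_sum] }
  have hΦ : Function.Surjective Φ := by
    refine LinearMap.injective_iff_surjective.1 ?_
    rw [← LinearMap.ker_eq_bot, LinearMap.ker_eq_bot']
    intro c hc
    exact hcomb c (hnd _ fun k => congrFun hc k)
  choose c hc using fun k : Fin n => hΦ (Pi.single k 1)
  have hc' : ∀ k j, ∑ l, c k l * T (a l) (a j) = if j = k then 1 else 0 := by
    intro k j
    have h1 := congrFun (hc k) j
    simp only [Φ, LinearMap.coe_mk, AddHom.coe_mk, map_sum, map_smul, LinearMap.sum_apply,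
      LinearMap.smul_apply, smul_eq_mul, Pi.single_apply] at h1
    exact h1
  -- Keeping only the terms of weight `-β k` makes `d k` a weight vector. The dropped terms are
  -- orthogonal to each `a j` with `β j = β k`, and the kept ones to every other `a j`, where the
  -- required value is `0`.
  let d : Fin n → DualLieAlgebra b := fun k =>
    ∑ l ∈ Finset.univ.filter (fun l => β l = -β k), c k l • a l
  have hd : ∀ k j, T (d k) (a j) = if j = k then 1 else 0 := by
    intro k j
    simp only [d, map_sum, map_smul, LinearMap.sum_apply, LinearMap.smul_apply, smul_eq_mul]
    by_cases hjk : β j = β k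
    · rw [← hc' k j, Finset.sum_filter]
      refine Finset.sum_congr rfl fun l _ => ?_
      split_ifs with h
      · rfl
      · rw [traceForm_eq_zero_of_weight (haw l) (haw j), mul_zero]
        intro h0
        exact h (by rw [← hjk]; exact eq_neg_of_add_eq_zero_left h0)
    · rw [if_neg fun h => hjk (by rw [h])]
      refine Finset.sum_eq_zero fun l hl => ?_
      rw [Finset.mem_filter] at hl
      rw [traceForm_eq_zero_of_weight (haw l) (haw j), mul_zero]
      rw [hl.2]
      intro h0
      exact hjk (eq_of_sub_eq_zero (by rw [← h0]; abel))
  have hexp : ∀ y, LieModule.toEnd ℂ (DualLieAlgebra b) M y =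
      ∑ k, T y (d k) • LieModule.toEnd ℂ (DualLieAlgebra b) M (a k) := by
    intro y
    obtain ⟨c, hc⟩ := hsp y
    have h1 : ∀ k, T y (d k) = c k := by
      intro k
      rw [hT, traceForm_congr hc, LieModule.traceForm_comm, ← hT, map_sum]
      rw [Finset.sum_congr rfl fun j _ => (by rw [map_smul, hd, smul_eq_mul] :
        T (d k) (c j • a j) = c j * if j = k then 1 else 0)]
      simp
    rw [hc, map_sum]
    simp only [map_smul, h1]
  obtain ⟨x, -, hx⟩ := exists_height b
  refine ⟨⟨n, β, a, d, haw, ?_, ?_, ?_, hexp, ?_⟩⟩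
  · intro k
    refine Submodule.sum_mem _ fun l hl => Submodule.smul_mem _ _ ?_
    rw [← (Finset.mem_filter.1 hl).2]
    exact haw l
  · intro k
    -- The sign of the height of `β l` determines the side to which `a l` belongs.
    have hclass : ∀ l s, (∃ γ ∈ corootCone b Set.univ, γ ≠ 0 ∧ β l = sgn s • γ) →
        a l ∈ nilp b s := by
      rintro l s ⟨γ, hγ, hγ0, hl⟩
      obtain ⟨p, hp, hp0⟩ := height_pos b hx hγ
      rcases hac l with ⟨h0, -⟩ | ⟨s', ⟨γ', hγ', hγ0', hl'⟩, hmem⟩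
      · exact absurd (hl.symm.trans h0) (sgn_smul_ne_zero hγ0 s)
      · obtain ⟨p', hp', hp0'⟩ := height_pos b hx hγ'
        have h1 := congrArg (P.toLinearMap x) (hl.symm.trans hl')
        rw [map_zsmul, map_zsmul, hp, hp'] at h1
        have h2 : p ≠ 0 := fun h => hγ0 (hp0 h)
        have h3 : p' ≠ 0 := fun h => hγ0' (hp0' h)
        have : s = s' := by
          cases s <;> cases s' <;> simp [sgn] at h1 ⊢ <;> omega
        rw [this]; exact hmem
    rcases hac k with ⟨h0, hk⟩ | ⟨s, ⟨γ, hγ, hγ0, hk⟩, hmem⟩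
    · left
      refine ⟨h0, hk, Submodule.sum_mem _ fun l hl => Submodule.smul_mem _ _ ?_⟩
      have h1 := (Finset.mem_filter.1 hl).2
      rw [h0, neg_zero] at h1
      rcases hac l with ⟨-, hl⟩ | ⟨s, ⟨γ, hγ, hγ0, hl⟩, -⟩
      · exact hl
      · exact absurd (hl.symm.trans h1) (sgn_smul_ne_zero hγ0 s)
    · right
      refine ⟨s, ⟨γ, hγ, hγ0, hk⟩, hmem, ?_⟩
      refine sum_mem fun l hl => (nilp b (!s)).smul_mem _ (hclass l _ ⟨γ, hγ, hγ0, ?_⟩)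
      rw [(Finset.mem_filter.1 hl).2, hk]
      cases s <;> simp [sgn]
  · intro j k
    rw [LieModule.traceForm_comm]
    exact hd k j
  · intro y
    have h1 : LieModule.toEnd ℂ (DualLieAlgebra b) M (y - ∑ k, T y (a k) • d k) = 0 := by
      refine hnd _ fun j => ?_
      rw [map_sub, map_sum, LinearMap.sub_apply, LinearMap.sum_apply]
      simp only [map_smul, LinearMap.smul_apply, smul_eq_mul, hd]
      simp
    rw [map_sub, sub_eq_zero, map_sum] at h1
    simp only [map_smul] at h1
    exact h1

end DualLieAlgebra

end

/-! ### The Casimir operator -/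

noncomputable section

namespace DualLieAlgebra

variable {ι X Y : Type*} [AddCommGroup X] [AddCommGroup Y]
variable {P : RootDatum ι X Y} {b : P.Base}
variable {M : Type*} [AddCommGroup M] [Module ℂ M]
  [LieRingModule (DualLieAlgebra b) M] [LieModule ℂ (DualLieAlgebra b) M]

section CartanCoord

variable (b) in
open scoped Classical in
/-- A linear combination of Cartan generators that represents an element of the Cartan
subalgebra. -/
def cartanCoord (y : DualLieAlgebra b) : X →₀ ℂ :=
  if h : y ∈ cartan b then ((mem_cartan_iff b).1 h).choose else 0

theorem cartanComb_cartanCoord {y : DualLieAlgebra b} (hy : y ∈ cartan b) :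
    cartanComb b (cartanCoord b y) = y := by
  rw [cartanCoord, dif_pos hy]
  exact ((mem_cartan_iff b).1 hy).choose_spec

theorem lie_of_mem_cartan {y : DualLieAlgebra b} (hy : y ∈ cartan b) {μ : Y} {v : M}
    (hv : v ∈ dualWeightSpace b M μ) : ⁅y, v⁆ = cartanEval P μ (cartanCoord b y) • v := by
  rw [← lie_cartanComb hv, cartanComb_cartanCoord hy]

theorem cartanComb_mem (c : X →₀ ℂ) : cartanComb b c ∈ cartan b :=
  (mem_cartan_iff b).2 ⟨c, rfl⟩

end CartanCoord

theorem lie_mem_of_mem_nilp (N : LieSubmodule ℂ (DualLieAlgebra b) M) {v : M}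
    (hv : ∀ i, ⁅e b (.inl i), v⁆ ∈ N) {y : DualLieAlgebra b} (hy : y ∈ nilp b true) :
    ⁅y, v⁆ ∈ N := by
  induction hy using LieSubalgebra.lieSpan_induction with
  | mem y hy => obtain ⟨i, rfl⟩ := hy; exact hv i
  | zero => rw [zero_lie]; exact zero_mem _
  | smul c y _ hy => rw [smul_lie]; exact N.smul_mem c hy
  | add y z _ _ hy hz => rw [add_lie]; exact add_mem hy hz
  | lie y z _ _ hy hz => rw [lie_lie]; exact sub_mem (N.lie_mem hz) (N.lie_mem hy)

namespace DualBases

variable (D : DualBases b M)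

/-- The Casimir operator. -/
def casimir : Module.End ℂ M :=
  ∑ k, LieModule.toEnd ℂ (DualLieAlgebra b) M (D.a k) *
    LieModule.toEnd ℂ (DualLieAlgebra b) M (D.d k)

theorem casimir_apply (v : M) : D.casimir v = ∑ k, ⁅D.a k, ⁅D.d k, v⁆⁆ := by
  simp [casimir, LinearMap.sum_apply]

theorem lie_eq_sum_a (y : DualLieAlgebra b) (v : M) :
    ⁅y, v⁆ = ∑ k, LieModule.traceForm ℂ (DualLieAlgebra b) M y (D.d k) • ⁅D.a k, v⁆ := by
  have := LinearMap.congr_fun (D.act_eq_a y) v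
  simpa [LinearMap.sum_apply] using this

theorem lie_eq_sum_d (y : DualLieAlgebra b) (v : M) :
    ⁅y, v⁆ = ∑ k, LieModule.traceForm ℂ (DualLieAlgebra b) M y (D.a k) • ⁅D.d k, v⁆ := by
  have := LinearMap.congr_fun (D.act_eq_d y) v
  simpa [LinearMap.sum_apply] using this

theorem traceForm_eq_sum (y z : DualLieAlgebra b) :
    LieModule.traceForm ℂ (DualLieAlgebra b) M y z =
      ∑ k, LieModule.traceForm ℂ (DualLieAlgebra b) M y (D.d k) *
        LieModule.traceForm ℂ (DualLieAlgebra b) M (D.a k) z := by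
  rw [traceForm_congr (y' := ∑ k, LieModule.traceForm ℂ (DualLieAlgebra b) M y (D.d k) • D.a k)
    (by rw [D.act_eq_a y, map_sum]; simp only [map_smul])]
  simp [map_sum, LinearMap.sum_apply]

/-- Expand `[z, a_k]` in the `a_j` and `[z, d_k]` in the `d_j`: by invariance of the form, one
coefficient matrix is minus the transpose of the other. -/
theorem casimir_lie (z : DualLieAlgebra b) (v : M) : D.casimir ⁅z, v⁆ = ⁅z, D.casimir v⁆ := by
  rw [casimir_apply, casimir_apply, lie_sum, eq_comm, ← sub_eq_zero, ← Finset.sum_sub_distrib]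
  have h1 : ∀ k, ⁅z, ⁅D.a k, ⁅D.d k, v⁆⁆⁆ - ⁅D.a k, ⁅D.d k, ⁅z, v⁆⁆⁆ =
      ∑ j, LieModule.traceForm ℂ (DualLieAlgebra b) M ⁅z, D.a k⁆ (D.d j) • ⁅D.a j, ⁅D.d k, v⁆⁆ +
      ∑ j, LieModule.traceForm ℂ (DualLieAlgebra b) M ⁅z, D.d k⁆ (D.a j) • ⁅D.a k, ⁅D.d j, v⁆⁆ := by
    intro k
    have h2 : ⁅z, ⁅D.a k, ⁅D.d k, v⁆⁆⁆ - ⁅D.a k, ⁅D.d k, ⁅z, v⁆⁆⁆ =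
        ⁅⁅z, D.a k⁆, ⁅D.d k, v⁆⁆ + ⁅D.a k, ⁅⁅z, D.d k⁆, v⁆⁆ := by
      rw [lie_lie, lie_lie, lie_sub]; abel
    rw [h2, D.lie_eq_sum_a ⁅z, D.a k⁆, D.lie_eq_sum_d ⁅z, D.d k⁆, lie_sum]
    simp only [lie_smul]
  simp only [h1]
  rw [Finset.sum_add_distrib]
  conv_lhs => rw [add_comm, Finset.sum_comm]
  rw [← Finset.sum_add_distrib]
  refine Finset.sum_eq_zero fun k _ => ?_
  rw [← Finset.sum_add_distrib]
  refine Finset.sum_eq_zero fun j _ => ?_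
  rw [← add_smul]
  convert zero_smul ℂ _
  rw [← lie_skew, map_neg, LinearMap.neg_apply, LieModule.traceForm_apply_lie_apply,
    LieModule.traceForm_comm]
  simp

section Height

variable {x : X} (hx : ∀ i : b.support, P.toLinearMap x (P.coroot i) = 2)
include hx

/-- The height of `β k` alone tells the type: zero is the Cartan part, and its sign tells which of
`a k`, `d k` is in the positive part. -/
theorem classify (k : Fin D.n) :
    (∃ n : ℤ, P.toLinearMap x (D.β k) = 2 * n) ∧
    (P.toLinearMap x (D.β k) = 0 → D.β k = 0 ∧ D.a k ∈ cartan b ∧ D.d k ∈ cartan b) ∧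
    (0 < P.toLinearMap x (D.β k) → D.a k ∈ nilp b true) ∧
    (P.toLinearMap x (D.β k) < 0 → D.d k ∈ nilp b true) := by
  rcases D.type k with ⟨h0, ha, hd⟩ | ⟨s, ⟨γ, hγ, hγ0, hk⟩, ha, hd⟩
  · rw [h0, map_zero]
    exact ⟨⟨0, rfl⟩, fun _ => ⟨rfl, ha, hd⟩, fun h => absurd h (lt_irrefl _),
      fun h => absurd h (lt_irrefl _)⟩
  · obtain ⟨n, hn, hn0⟩ := height_pos b hx hγ
    have hn' : n ≠ 0 := fun h => hγ0 (hn0 h)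
    rw [hk, map_zsmul, hn]
    cases s
    · refine ⟨⟨-n, by simp [sgn]⟩, fun h => ?_, fun h => ?_, fun _ => hd⟩ <;>
        simp [sgn] at h <;> omega
    · refine ⟨⟨n, by simp [sgn]⟩, fun h => ?_, fun _ => ha, fun h => ?_⟩ <;>
        simp [sgn] at h <;> omega

end Height

variable (x : X)

/-- The eigenvalue of the Casimir operator on highest weight vectors; `x` is a height function. -/
def casimirEigenvalue (μ : Y) : ℂ :=
  ∑ k with P.toLinearMap x (D.β k) = 0,
    cartanEval P μ (cartanCoord b (D.a k)) * cartanEval P μ (cartanCoord b (D.d k)) +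
  ∑ k with 0 < P.toLinearMap x (D.β k), cartanEval P μ (cartanCoord b ⁅D.a k, D.d k⁆)

variable [Finite ι] [P.IsReduced]

theorem lie_a_d_mem_cartan (k : Fin D.n) : ⁅D.a k, D.d k⁆ ∈ cartan b := by
  refine mem_cartan_of_weight_zero ?_
  rw [← add_neg_cancel (D.β k)]
  exact lie_mem_weightSpace b (D.a_mem k) (D.d_mem k)

variable {x}

/-- At negative height `d k` already sends `v` into `N`; at height zero both factors act by scalars;
at positive height `a_k d_k = d_k a_k + [a_k, d_k]`, and modulo `N` only the Cartan element `[a_k,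
d_k]` survives. -/
theorem casimir_sub_smul_mem (hx : ∀ i : b.support, P.toLinearMap x (P.coroot i) = 2)
    (N : LieSubmodule ℂ (DualLieAlgebra b) M) {μ : Y} {v : M}
    (hv : v ∈ dualWeightSpace b M μ) (he : ∀ i, ⁅e b (.inl i), v⁆ ∈ N) :
    D.casimir v - D.casimirEigenvalue x μ • v ∈ N := by
  have h1 : D.casimirEigenvalue x μ • v = ∑ k,
      ((if P.toLinearMap x (D.β k) = 0 then
        cartanEval P μ (cartanCoord b (D.a k)) * cartanEval P μ (cartanCoord b (D.d k)) else 0) +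
      (if 0 < P.toLinearMap x (D.β k) then
        cartanEval P μ (cartanCoord b ⁅D.a k, D.d k⁆) else 0)) • v := by
    rw [casimirEigenvalue, Finset.sum_filter, Finset.sum_filter, ← Finset.sum_add_distrib,
      Finset.sum_smul]
  rw [casimir_apply, h1, ← Finset.sum_sub_distrib]
  refine sum_mem fun k _ => ?_
  obtain ⟨-, h0, hpos, hneg⟩ := D.classify hx k
  rcases lt_trichotomy (P.toLinearMap x (D.β k)) 0 with h | h | h
  · rw [if_neg h.ne, if_neg h.not_gt, add_zero, zero_smul, sub_zero]
    exact N.lie_mem (lie_mem_of_mem_nilp N he (hneg h))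
  · obtain ⟨-, ha, hd⟩ := h0 h
    rw [if_pos h, if_neg h.not_gt, add_zero, lie_of_mem_cartan hd hv, lie_smul,
      lie_of_mem_cartan ha hv, smul_smul, mul_comm, sub_self]
    exact zero_mem _
  · rw [if_neg h.ne', if_pos h, zero_add, ← lie_of_mem_cartan (D.lie_a_d_mem_cartan k) hv,
      lie_lie, sub_sub_cancel]
    exact N.lie_mem (lie_mem_of_mem_nilp N he (hpos h))

theorem casimir_eq_smul (hx : ∀ i : b.support, P.toLinearMap x (P.coroot i) = 2) {μ : Y} {v : M}
    (hv : v ∈ dualWeightSpace b M μ) (he : ∀ i, ⁅e b (.inl i), v⁆ = 0) :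
    D.casimir v = D.casimirEigenvalue x μ • v := by
  have := D.casimir_sub_smul_mem hx ⊥ hv (by simpa using he)
  simpa [sub_eq_zero] using this

end DualBases

end DualLieAlgebra

end

/-! ### Strict growth of the Casimir eigenvalue -/

noncomputable section

namespace DualLieAlgebra

variable {ι X Y : Type*} [AddCommGroup X] [AddCommGroup Y]
variable {P : RootDatum ι X Y} {b : P.Base}
variable {M : Type*} [AddCommGroup M] [Module ℂ M]
  [LieRingModule (DualLieAlgebra b) M] [LieModule ℂ (DualLieAlgebra b) M]

open scoped ComplexOrder

section SimpleForm

variable (b M) in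
/-- The value of the trace form at a pair of opposite Chevalley generators. -/
def simpleForm (i : b.support) : ℂ :=
  LieModule.traceForm ℂ (DualLieAlgebra b) M (e b (.inl i)) (e b (.inr i))

theorem e_mem_weightSpace (i : b.support ⊕ b.support) :
    e b i ∈ dualWeightSpace b (DualLieAlgebra b) (wt b i) := fun x => lie_H_e b x i

theorem traceForm_cartanComb_H (c : X →₀ ℂ) (i : b.support) :
    LieModule.traceForm ℂ (DualLieAlgebra b) M (cartanComb b c) (H b (P.root i)) =
      cartanEval P (P.coroot i) c * simpleForm b M i := by
  rw [← lie_E_F_same, ← LieModule.traceForm_apply_lie_apply,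
    lie_cartanComb (e_mem_weightSpace (.inl i)), map_smul, LinearMap.smul_apply, wt_inl,
    smul_eq_mul, simpleForm]

theorem cartanComb_single (x : X) (r : ℂ) : cartanComb b (Finsupp.single x r) = r • H b x := by
  simp [cartanComb]

theorem cartanEval_single (μ : Y) (x : X) (r : ℂ) :
    cartanEval P μ (Finsupp.single x r) = r * P.toLinearMap x μ := by
  simp [cartanEval]

theorem traceForm_H_H (i : b.support) :
    LieModule.traceForm ℂ (DualLieAlgebra b) M (H b (P.root i)) (H b (P.root i)) =
      2 * simpleForm b M i := by
  have := traceForm_cartanComb_H (b := b) (M := M) (Finsupp.single (P.root i) 1) i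
  rw [cartanComb_single, cartanEval_single, one_smul, RootPairing.root_coroot_two] at this
  rw [this]; push_cast; ring

/-- `2 T(e_i, f_i) = T(h_i, h_i)` is a sum of squares of integers. If it vanished, `h_i` would act
by zero, and so would `e_i`. -/
theorem simpleForm_pos [FiniteDimensional ℂ M] (hM : IsWeightModule b M) {i : b.support}
    (hi : i ∈ active b M) : 0 < simpleForm b M i := by
  obtain ⟨n, m, ν, hν⟩ := hM.exists_basis
  have h1 := traceForm_cartanComb m ν hν (Finsupp.single (P.root i) 1)
    (Finsupp.single (P.root i) 1)
  simp only [cartanComb_single, cartanEval_single, one_smul, one_mul, traceForm_H_H] at h1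
  have h2 : 2 * simpleForm b M i =
      ((∑ j, (P.toLinearMap (P.root i) (ν j)) * (P.toLinearMap (P.root i) (ν j)) : ℤ) : ℂ) := by
    rw [h1]; push_cast; rfl
  have h3 : 0 < ∑ j, (P.toLinearMap (P.root i) (ν j)) * (P.toLinearMap (P.root i) (ν j)) := by
    refine lt_of_le_of_ne (Finset.sum_nonneg fun j _ => mul_self_nonneg _) fun h0 => ?_
    rw [eq_comm, Finset.sum_eq_zero_iff_of_nonneg fun j _ => mul_self_nonneg _] at h0
    have hact := cartanComb_act_eq_zero m ν hν (Finsupp.single (P.root i) 1) (fun j => by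
      rw [cartanEval_single, mul_self_eq_zero.1 (h0 j (Finset.mem_univ j))]; simp)
    rw [cartanComb_single, one_smul] at hact
    have hz : ∀ w : M, ⁅H b (P.root i), w⁆ = 0 := fun w => by
      rw [← LieModule.toEnd_apply_apply ℂ, hact, LinearMap.zero_apply]
    obtain ⟨v, hv⟩ := hi
    apply hv
    have h4 := (isSlTwoAction b (M := M) i).h_e v
    simp only [LieModule.toEnd_apply_apply, chevalleyAct_apply, hz, lie_zero, zero_add] at h4
    simpa using h4.symm
  have h4 : simpleForm b M i =
      (((∑ j, (P.toLinearMap (P.root i) (ν j)) * (P.toLinearMap (P.root i) (ν j)) : ℤ) : ℝ) / 2 :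
        ℝ) := by
    push_cast at h2 ⊢
    rw [← h2]; ring
  rw [h4]
  exact_mod_cast div_pos (by exact_mod_cast h3 : (0:ℝ) <
    ((∑ j, (P.toLinearMap (P.root i) (ν j)) * (P.toLinearMap (P.root i) (ν j)) : ℤ) : ℝ))
    zero_lt_two

end SimpleForm

namespace DualBases

variable (D : DualBases b M)

theorem traceForm_lie_lie (y z w u : DualLieAlgebra b) :
    LieModule.traceForm ℂ (DualLieAlgebra b) M ⁅y, ⁅z, w⁆⁆ u =
      ∑ j, LieModule.traceForm ℂ (DualLieAlgebra b) M ⁅z, w⁆ (D.d j) *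
        LieModule.traceForm ℂ (DualLieAlgebra b) M ⁅y, D.a j⁆ u := by
  have h : ∀ w, LieModule.traceForm ℂ (DualLieAlgebra b) M ⁅y, w⁆ u =
      LieModule.traceForm ℂ (DualLieAlgebra b) M w ⁅u, y⁆ := fun w => by
    rw [← lie_skew, map_neg, LinearMap.neg_apply, LieModule.traceForm_apply_lie_apply, ← map_neg,
      lie_skew]
  rw [h, D.traceForm_eq_sum]
  simp only [h]

theorem height_of_traceForm_ne_zero {x : X}
    (hx : ∀ i : b.support, P.toLinearMap x (P.coroot i) = 2) (s : Bool) (i : b.support)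
    {j k : Fin D.n}
    (h : LieModule.traceForm ℂ (DualLieAlgebra b) M ⁅e b (side b s i), D.a j⁆ (D.d k) ≠ 0) :
    P.toLinearMap x (D.β k) = P.toLinearMap x (D.β j) + 2 * sgn s := by
  by_contra hne
  refine h (traceForm_eq_zero_of_weight
    (lie_mem_weightSpace b (e_mem_weightSpace _) (D.a_mem j)) (D.d_mem k) fun h0 => hne ?_)
  have := congrArg (P.toLinearMap x) h0
  rw [wt_side, map_add, map_add, map_neg, map_zsmul, hx, map_zero, smul_eq_mul] at this
  linarith

theorem sum_height_zero (x : X) (y : DualLieAlgebra b) {z : DualLieAlgebra b}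
    (hz : z ∈ cartan b) :
    ∑ k with P.toLinearMap x (D.β k) = 0, LieModule.traceForm ℂ (DualLieAlgebra b) M y (D.d k) *
        LieModule.traceForm ℂ (DualLieAlgebra b) M (D.a k) z =
      LieModule.traceForm ℂ (DualLieAlgebra b) M y z := by
  rw [D.traceForm_eq_sum y z, Finset.sum_filter]
  refine Finset.sum_congr rfl fun k _ => ?_
  split_ifs with h
  · rfl
  · rw [traceForm_eq_zero_of_weight (D.a_mem k) (cartan_le_weightSpace hz), mul_zero]
    intro h0
    rw [add_zero] at h0
    rw [h0, map_zero] at h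
    exact h rfl

/-- The sum of the positive roots of the image of `𝔤^∨` in `End M` pairs to `2` with every simple
root that acts nontrivially. -/
theorem sum_height_pos {x : X}
    (hx : ∀ i : b.support, P.toLinearMap x (P.coroot i) = 2) {i : b.support}
    (hi : simpleForm b M i ≠ 0) :
    ∑ k with 0 < P.toLinearMap x (D.β k), (P.toLinearMap (P.root i) (D.β k) : ℂ) = 2 := by
  set T := LieModule.traceForm ℂ (DualLieAlgebra b) M with hT
  set ht : Fin D.n → ℤ := fun k => P.toLinearMap x (D.β k) with hht
  -- `⟨α_i, β k⟩` is the diagonal coefficient of `[e_i, f_i]` at `a k`, a row sum minus a column sum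
  -- of `Z`. As `Z k j` vanishes unless the height drops by `2` from `k` to `j`, the sum over
  -- positive heights telescopes to its boundary at height zero.
  set Z : Fin D.n → Fin D.n → ℂ := fun k j =>
    T ⁅e b (.inr i), D.a k⁆ (D.d j) * T ⁅e b (.inl i), D.a j⁆ (D.d k) with hZ
  have hZ0 : ∀ k j, ht j ≠ ht k - 2 → Z k j = 0 := by
    intro k j hkj
    by_contra h0
    apply hkj
    have := D.height_of_traceForm_ne_zero hx false i (left_ne_zero_of_mul h0)
    simp only [sgn] at this
    rw [hht]; dsimp only; rw [this]; simp; ring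
  have h1 : ∀ k, (P.toLinearMap (P.root i) (D.β k) : ℂ) = ∑ j, Z k j - ∑ j, Z j k := by
    intro k
    have h2 : T ⁅H b (P.root i), D.a k⁆ (D.d k) = (P.toLinearMap (P.root i) (D.β k) : ℂ) := by
      rw [lie_H_of_mem (D.a_mem k), map_smul, LinearMap.smul_apply, hT, D.form_a_d]
      simp
    rw [← h2, ← lie_E_F_same, lie_lie, map_sub, LinearMap.sub_apply, D.traceForm_lie_lie,
      D.traceForm_lie_lie]
    simp only [hZ, hT, mul_comm]
  have h3 : ∑ k with 0 < ht k, (P.toLinearMap (P.root i) (D.β k) : ℂ) =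
      ∑ j with ht j = 0, ∑ k, Z k j := by
    simp only [h1]
    rw [Finset.sum_sub_distrib]
    have hs : ∀ f : Fin D.n → ℂ, ∑ j, f j = ∑ j with 0 < ht j, f j + ∑ j with ¬ 0 < ht j, f j :=
      fun f => (Finset.sum_filter_add_sum_filter_not _ _ _).symm
    have e1 : ∑ k with 0 < ht k, ∑ j, Z k j = ∑ k with 0 < ht k, ∑ j with 0 < ht j, Z k j +
        ∑ k with 0 < ht k, ∑ j with ¬ 0 < ht j, Z k j := by
      rw [← Finset.sum_add_distrib]; exact Finset.sum_congr rfl fun k _ => hs _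
    have e2 : ∑ k with 0 < ht k, ∑ j, Z j k = ∑ k with 0 < ht k, ∑ j with 0 < ht j, Z j k := by
      refine Finset.sum_congr rfl fun k hk => ?_
      rw [hs, add_eq_left]
      refine Finset.sum_eq_zero fun j hj => hZ0 _ _ ?_
      have := (Finset.mem_filter.1 hk).2
      have := (Finset.mem_filter.1 hj).2
      omega
    rw [e1, e2, Finset.sum_comm (f := fun k j => Z j k), add_sub_cancel_left, Finset.sum_comm]
    rw [Finset.sum_filter, Finset.sum_filter]
    refine Finset.sum_congr rfl fun j _ => ?_
    by_cases hj : ht j = 0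
    · rw [if_pos (by omega), if_pos hj, Finset.sum_filter]
      refine Finset.sum_congr rfl fun k _ => ?_
      split_ifs with hk
      · rfl
      · exact (hZ0 _ _ (by omega)).symm
    · rw [if_neg hj]
      split_ifs with h
      · rfl
      · refine Finset.sum_eq_zero fun k hk => hZ0 _ _ ?_
        have hk' := (Finset.mem_filter.1 hk).2
        obtain ⟨n, hn⟩ := (D.classify hx k).1
        have hn' : ht k = 2 * n := hn
        omega
  rw [h3]
  -- For `a j` in the Cartan part, `[f_i, [e_i, a_j]]` is a multiple of `h_i`. The boundary terms
  -- therefore add up to `T(h_i, h_i) / T(e_i, f_i) = 2`.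
  have h4 : ∀ j, ht j = 0 → ∑ k, Z k j = (simpleForm b M i)⁻¹ *
      (T (H b (P.root i)) (D.d j) * T (D.a j) (H b (P.root i))) := by
    intro j hj
    obtain ⟨h0, ha, hd⟩ := (D.classify hx j).2.1 hj
    have h5 : ∑ k, Z k j = T ⁅e b (.inr i), ⁅e b (.inl i), D.a j⁆⁆ (D.d j) := by
      rw [hT, D.traceForm_lie_lie]
      simp only [hZ, hT, mul_comm]
    have h6 := traceForm_cartanComb_H (b := b) (M := M) (cartanCoord b (D.a j)) i
    rw [cartanComb_cartanCoord ha] at h6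
    have h7 : ⁅e b (.inr i), ⁅e b (.inl i), D.a j⁆⁆ =
        cartanEval P (P.coroot i) (cartanCoord b (D.a j)) • H b (P.root i) := by
      rw [← lie_skew (e b (.inl i)), lie_of_mem_cartan ha (e_mem_weightSpace (.inl i)), wt_inl,
        lie_neg, lie_smul, ← smul_neg, lie_skew, lie_E_F_same]
    rw [h5, h7, map_smul, LinearMap.smul_apply, smul_eq_mul, hT, h6]
    field_simp
  rw [Finset.sum_congr rfl fun j hj => h4 j (Finset.mem_filter.1 hj).2, ← Finset.mul_sum, hT,
    D.sum_height_zero x _ (Submodule.subset_span ⟨_, rfl⟩),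
    traceForm_H_H]
  field_simp

variable [FiniteDimensional ℂ M]

/-- The elements of the Cartan subalgebra dual to the elements of the coroot cone. -/
theorem exists_dual_of_mem_corootCone (hM : IsWeightModule b M) {x : X}
    (hx : ∀ i : b.support, P.toLinearMap x (P.coroot i) = 2) {γ : Y}
    (hγ : γ ∈ corootCone b (active b M)) :
    ∃ c : X →₀ ℂ, (∀ c', cartanEval P γ c' =
        LieModule.traceForm ℂ (DualLieAlgebra b) M (cartanComb b c) (cartanComb b c')) ∧
      (∀ ν, starRingEnd ℂ (cartanEval P ν c) = cartanEval P ν c) ∧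
      (∀ μ, (∀ i : b.support, 0 ≤ P.toLinearMap (P.root i) μ) → 0 ≤ cartanEval P μ c) ∧
      0 ≤ ∑ k with 0 < P.toLinearMap x (D.β k), cartanEval P (D.β k) c ∧
      (γ ≠ 0 → 0 < ∑ k with 0 < P.toLinearMap x (D.β k), cartanEval P (D.β k) c) := by
  induction hγ using AddSubmonoid.closure_induction with
  | mem γ hγ =>
    obtain ⟨i, hi, rfl⟩ := hγ
    have hpos := simpleForm_pos hM hi
    have hsum : 0 < ∑ k with 0 < P.toLinearMap x (D.β k),
        cartanEval P (D.β k) (Finsupp.single (P.root i) (simpleForm b M i)⁻¹) := by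
      simp only [cartanEval_single]
      rw [← Finset.mul_sum, D.sum_height_pos hx hpos.ne']
      exact mul_pos (inv_pos.2 hpos) two_pos
    -- For a simple coroot the dual element is `h_i / T(e_i, f_i)`. The properties are additive in
    -- `γ`; the weak inequality is carried along because one of two summands may be zero.
    refine ⟨Finsupp.single (P.root i) (simpleForm b M i)⁻¹, fun c' => ?_, fun ν => ?_,
      fun μ hμ => ?_, hsum.le, fun _ => hsum⟩
    · rw [LieModule.traceForm_comm, cartanComb_single, map_smul, traceForm_cartanComb_H,
        smul_eq_mul]
      field_simp [hpos.ne']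
    · rw [cartanEval_single, map_mul, map_inv₀, Complex.conj_eq_iff_im.2 hpos.2.symm]
      simp
    · rw [cartanEval_single]
      exact mul_nonneg (inv_pos.2 hpos).le (by exact_mod_cast hμ i)
  | zero =>
    refine ⟨0, fun c' => ?_, by simp, by simp, by simp, fun h => absurd rfl h⟩
    rw [map_zero, map_zero, LinearMap.zero_apply]
    have : cartanEval P (0 : Y) c' + cartanEval P (0 : Y) c' = cartanEval P (0 : Y) c' := by
      rw [← cartanEval_add, add_zero]
    simpa using this
  | add γ γ' _ _ h h' =>
    obtain ⟨c, h1, h2, h3, h4, h5⟩ := h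
    obtain ⟨c', h1', h2', h3', h4', h5'⟩ := h'
    refine ⟨c + c', fun u => ?_, fun ν => ?_, fun μ hμ => ?_, ?_, fun hne => ?_⟩
    · rw [cartanEval_add, h1, h1', map_add, map_add, LinearMap.add_apply]
    · rw [map_add, map_add, h2, h2']
    · rw [map_add]; exact add_nonneg (h3 μ hμ) (h3' μ hμ)
    · simp only [map_add, Finset.sum_add_distrib]; exact add_nonneg h4 h4'
    · simp only [map_add, Finset.sum_add_distrib]
      by_cases hγ : γ = 0
      · exact add_pos_of_nonneg_of_pos h4 (h5' fun h => hne (by rw [hγ, h, add_zero]))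
      · exact add_pos_of_pos_of_nonneg (h5 hγ) h4'

/-- For `t` dual to `γ` under the trace form, the eigenvalues differ by `2⟨μ, t⟩ + T(t, t)` plus the
sum of the `⟨β k, t⟩` over positive `β k`. The first term is nonnegative by dominance, the second
because `t` has real eigenvalues, and the last is positive. -/
theorem casimirEigenvalue_ne [Finite ι] [P.IsReduced] (hM : IsWeightModule b M) {x : X}
    (hx : ∀ i : b.support, P.toLinearMap x (P.coroot i) = 2) {γ μ : Y}
    (hγ : γ ∈ corootCone b (active b M)) (hγ0 : γ ≠ 0)
    (hμ : ∀ i : b.support, 0 ≤ P.toLinearMap (P.root i) μ) {v : M}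
    (hv : v ∈ dualWeightSpace b M μ) (hv0 : v ≠ 0) :
    D.casimirEigenvalue x (μ + γ) ≠ D.casimirEigenvalue x μ := by
  obtain ⟨c, hc, hreal, hdom, -, hpos⟩ := D.exists_dual_of_mem_corootCone hM hx hγ
  set T := LieModule.traceForm ℂ (DualLieAlgebra b) M with hT
  set t := cartanComb b c with ht
  have htc : t ∈ cartan b := cartanComb_mem c
  have hev : ∀ y ∈ cartan b, cartanEval P (μ + γ) (cartanCoord b y) =
      cartanEval P μ (cartanCoord b y) + T t y := by
    intro y hy
    rw [cartanEval_add, hc, cartanComb_cartanCoord hy]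
  have hform : ∀ k, P.toLinearMap x (D.β k) ≠ 0 → T t (D.d k) = 0 ∧ T t (D.a k) = 0 := by
    intro k hk
    constructor
    · refine traceForm_eq_zero_of_weight (cartan_le_weightSpace htc) (D.d_mem k) fun h => hk ?_
      rw [zero_add, neg_eq_zero] at h
      rw [h, map_zero]
    · refine traceForm_eq_zero_of_weight (cartan_le_weightSpace htc) (D.a_mem k) fun h => hk ?_
      rw [zero_add] at h
      rw [h, map_zero]
  -- Both sides are the scalar by which `t` acts on the nonzero vector `v`, once `t` is expanded in
  -- the `a k`.
  have hsa : ∑ k with P.toLinearMap x (D.β k) = 0,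
      T t (D.d k) * cartanEval P μ (cartanCoord b (D.a k)) = cartanEval P μ c := by
    apply smul_left_injective ℂ hv0
    dsimp only
    rw [← lie_cartanComb hv, ← ht, D.lie_eq_sum_a, Finset.sum_filter, Finset.sum_smul]
    refine Finset.sum_congr rfl fun k _ => ?_
    split_ifs with h
    · rw [mul_smul, lie_of_mem_cartan ((D.classify hx k).2.1 h).2.1 hv]
    · rw [← hT, (hform k h).1, zero_smul, zero_smul]
  have hsd : ∑ k with P.toLinearMap x (D.β k) = 0,
      T t (D.a k) * cartanEval P μ (cartanCoord b (D.d k)) = cartanEval P μ c := by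
    apply smul_left_injective ℂ hv0
    dsimp only
    rw [← lie_cartanComb hv, ← ht, D.lie_eq_sum_d, Finset.sum_filter, Finset.sum_smul]
    refine Finset.sum_congr rfl fun k _ => ?_
    split_ifs with h
    · rw [mul_smul, lie_of_mem_cartan ((D.classify hx k).2.1 h).2.2 hv]
    · rw [← hT, (hform k h).2, zero_smul, zero_smul]
  have hst : ∑ k with P.toLinearMap x (D.β k) = 0, T t (D.d k) * T t (D.a k) = T t t := by
    rw [hT, ← D.sum_height_zero x t htc]
    exact Finset.sum_congr rfl fun k _ => by rw [LieModule.traceForm_comm ℂ _ M (D.a k)]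
  have hplus : ∀ k, T t ⁅D.a k, D.d k⁆ = cartanEval P (D.β k) c := by
    intro k
    rw [hT, ← LieModule.traceForm_apply_lie_apply, lie_cartanComb (D.a_mem k), map_smul,
      LinearMap.smul_apply, D.form_a_d, if_pos rfl, smul_eq_mul, mul_one]
  have hdiff : D.casimirEigenvalue x (μ + γ) - D.casimirEigenvalue x μ =
      2 * cartanEval P μ c + T t t +
        ∑ k with 0 < P.toLinearMap x (D.β k), cartanEval P (D.β k) c := by
    have e1 : ∑ k with P.toLinearMap x (D.β k) = 0,
        cartanEval P (μ + γ) (cartanCoord b (D.a k)) *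
          cartanEval P (μ + γ) (cartanCoord b (D.d k)) =
        ∑ k with P.toLinearMap x (D.β k) = 0,
          cartanEval P μ (cartanCoord b (D.a k)) * cartanEval P μ (cartanCoord b (D.d k)) +
        (2 * cartanEval P μ c + T t t) := by
      rw [two_mul]
      nth_rewrite 1 [← hsa]
      rw [← hsd, ← hst, ← Finset.sum_add_distrib, ← Finset.sum_add_distrib,
        ← Finset.sum_add_distrib]
      refine Finset.sum_congr rfl fun k hk => ?_
      obtain ⟨-, ha, hd⟩ := (D.classify hx k).2.1 (Finset.mem_filter.1 hk).2
      rw [hev _ ha, hev _ hd]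
      ring
    have e2 : ∑ k with 0 < P.toLinearMap x (D.β k),
        cartanEval P (μ + γ) (cartanCoord b ⁅D.a k, D.d k⁆) =
        ∑ k with 0 < P.toLinearMap x (D.β k), cartanEval P μ (cartanCoord b ⁅D.a k, D.d k⁆) +
        ∑ k with 0 < P.toLinearMap x (D.β k), cartanEval P (D.β k) c := by
      rw [← Finset.sum_add_distrib]
      refine Finset.sum_congr rfl fun k _ => ?_
      rw [hev _ (D.lie_a_d_mem_cartan k), hplus]
    rw [casimirEigenvalue, casimirEigenvalue, e1, e2]
    ring
  have htt : 0 ≤ T t t := by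
    obtain ⟨n, m, ν, hν⟩ := hM.exists_basis
    rw [hT, ht, traceForm_cartanComb m ν hν]
    refine Finset.sum_nonneg fun j _ => ?_
    nth_rewrite 1 [← hreal]
    exact star_mul_self_nonneg _
  have hpos' : 0 < D.casimirEigenvalue x (μ + γ) - D.casimirEigenvalue x μ := by
    rw [hdiff]
    exact add_pos_of_nonneg_of_pos (add_nonneg (mul_nonneg zero_le_two (hdom μ hμ)) htt)
      (hpos hγ0)
  exact sub_ne_zero.1 hpos'.ne'

end DualBases

end DualLieAlgebra

end

/-! ### Generation by highest weight vectors -/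

noncomputable section

namespace DualLieAlgebra

variable {ι X Y : Type*} [AddCommGroup X] [AddCommGroup Y]
variable {P : RootDatum ι X Y} (b : P.Base)
variable {M : Type*} [AddCommGroup M] [Module ℂ M]
  [LieRingModule (DualLieAlgebra b) M] [LieModule ℂ (DualLieAlgebra b) M]

/-- `v` has weight `μ` and is annihilated by all `e_i`, `i ∈ I`. -/
structure IsHighestWeightVector (μ : Y) (v : M) : Prop where
  mem : v ∈ dualWeightSpace b M μ
  lie_eq_zero (i : b.support) : ⁅e b (.inl i), v⁆ = 0

variable {b}

theorem IsHighestWeightVector.coe {N : LieSubmodule ℂ (DualLieAlgebra b) M} {μ : Y} {v : N} :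
    IsHighestWeightVector b μ v ↔ IsHighestWeightVector b μ (v : M) :=
  ⟨fun h => ⟨(mem_weightSpace_coe N).1 h.mem, fun i => by
      have := congrArg Subtype.val (h.lie_eq_zero i); simpa using this⟩,
    fun h => ⟨(mem_weightSpace_coe N).2 h.mem, fun i => Subtype.ext (by
      simpa using h.lie_eq_zero i)⟩⟩

namespace DualBases

variable (D : DualBases b M)

theorem casimir_mem (N : LieSubmodule ℂ (DualLieAlgebra b) M) {v : M} (hv : v ∈ N) :
    D.casimir v ∈ N := by
  rw [casimir_apply]
  exact sum_mem fun k _ => N.lie_mem (N.lie_mem hv)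

/-- The generalized eigenspaces of the Casimir operator are submodules. -/
def casimirGenEigenspace (κ : ℂ) : LieSubmodule ℂ (DualLieAlgebra b) M :=
  { D.casimir.maxGenEigenspace κ with
    lie_mem := fun {y v} hv => by
      refine Module.End.mapsTo_maxGenEigenspace_of_comm
        (g := LieModule.toEnd ℂ (DualLieAlgebra b) M y) ?_ κ hv
      ext w
      exact D.casimir_lie y w }

theorem mem_casimirGenEigenspace {κ : ℂ} {v : M} :
    v ∈ D.casimirGenEigenspace κ ↔ ∃ k : ℕ, ((D.casimir - κ • (1 : Module.End ℂ M)) ^ k) v = 0 :=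
  Module.End.mem_maxGenEigenspace _ _ _

/-- Modulo `N`, `v` has eigenvalue `κ'` and is killed by the `m`-th power of `casimir - κ`, so `(κ'
- κ) ^ m • v` lies in `N`. -/
theorem eq_of_mem_casimirGenEigenspace (N : LieSubmodule ℂ (DualLieAlgebra b) M) {κ κ' : ℂ}
    {v : M} (hv : v ∈ D.casimirGenEigenspace κ) (hvN : v ∉ N)
    (h : D.casimir v - κ' • v ∈ N) : κ' = κ := by
  obtain ⟨m, hm⟩ := D.mem_casimirGenEigenspace.1 hv
  set T := D.casimir - κ • (1 : Module.End ℂ M) with hT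
  have hTN : ∀ w ∈ N, T w ∈ N := fun w hw => by
    rw [hT, LinearMap.sub_apply, LinearMap.smul_apply, Module.End.one_apply]
    exact sub_mem (D.casimir_mem N hw) (N.smul_mem _ hw)
  have key : ∀ m : ℕ, (T ^ m) v - ((κ' - κ) ^ m) • v ∈ N := by
    intro m
    induction m with
    | zero => simp
    | succ m ih =>
      have h1 := hTN _ ih
      have h2 : T v - (κ' - κ) • v ∈ N := by
        convert h using 1
        rw [hT, LinearMap.sub_apply, LinearMap.smul_apply, Module.End.one_apply]
        module
      have h3 := add_mem h1 (N.smul_mem ((κ' - κ) ^ m) h2)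
      convert h3 using 1
      rw [map_sub, map_smul, pow_succ', Module.End.mul_apply, pow_succ]
      module
  have h1 := key m
  rw [hm, zero_sub] at h1
  by_contra hne
  refine hvN (((N.toSubmodule).smul_mem_iff (pow_ne_zero m (sub_ne_zero.2 hne))).1 ?_)
  have := neg_mem h1
  rwa [neg_neg] at this

end DualBases

theorem IsLocallyFinite.exists_finiteDimensional (hM : IsLocallyFinite b M) (t : Finset M) :
    ∃ N : LieSubmodule ℂ (DualLieAlgebra b) M, (t : Set M) ⊆ N ∧ FiniteDimensional ℂ N := by
  classical
  induction t using Finset.induction_on with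
  | empty => exact ⟨⊥, by simp, (inferInstance : FiniteDimensional ℂ (⊥ : Submodule ℂ M))⟩
  | insert v t _ ih =>
    obtain ⟨N, hN, h1⟩ := ih
    obtain ⟨N', hN', h2⟩ := hM.finite v
    refine ⟨N ⊔ N', ?_, ?_⟩
    · rw [Finset.coe_insert]
      exact Set.insert_subset ((le_sup_right : N' ≤ N ⊔ N') hN')
        (hN.trans (le_sup_left : N ≤ N ⊔ N'))
    · change FiniteDimensional ℂ ((N ⊔ N' : LieSubmodule ℂ (DualLieAlgebra b) M).toSubmodule)
      rw [LieSubmodule.sup_toSubmodule]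
      have h1' : FiniteDimensional ℂ N.toSubmodule := h1
      have h2' : FiniteDimensional ℂ N'.toSubmodule := h2
      exact Submodule.finiteDimensional_sup _ _

omit [LieModule ℂ (DualLieAlgebra b) M] in
theorem exists_finset_mem_lieSpan {S : Set M} {v : M}
    (hv : v ∈ LieSubmodule.lieSpan ℂ (DualLieAlgebra b) S) :
    ∃ t : Finset M, (t : Set M) ⊆ S ∧
      v ∈ LieSubmodule.lieSpan ℂ (DualLieAlgebra b) (t : Set M) := by
  classical
  induction hv using LieSubmodule.lieSpan_induction with
  | mem v hv => exact ⟨{v}, by simpa using hv, LieSubmodule.subset_lieSpan (by simp)⟩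
  | zero => exact ⟨∅, by simp, zero_mem _⟩
  | add v w _ _ h h' =>
    obtain ⟨t, ht, h⟩ := h
    obtain ⟨t', ht', h'⟩ := h'
    refine ⟨t ∪ t', by simp [ht, ht'], add_mem ?_ ?_⟩
    · exact LieSubmodule.lieSpan_mono (by simp) h
    · exact LieSubmodule.lieSpan_mono (by simp) h'
  | smul c v _ h =>
    obtain ⟨t, ht, h⟩ := h
    exact ⟨t, ht, Submodule.smul_mem _ c h⟩
  | lie y v _ h =>
    obtain ⟨t, ht, h⟩ := h
    exact ⟨t, ht, LieSubmodule.lie_mem _ h⟩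

variable [Finite ι] [P.IsReduced]

section FiniteDimensional

variable [FiniteDimensional ℂ M]

/-- A submodule of a finite-dimensional module that contains all highest weight vectors is
everything. -/
theorem IsWeightModule.eq_top_of_highestWeightVectors (hM : IsWeightModule b M)
    (N : LieSubmodule ℂ (DualLieAlgebra b) M)
    (hN : ∀ μ, ∀ v : M, IsHighestWeightVector b μ v → v ∈ N) : N = ⊤ := by
  obtain ⟨D⟩ := exists_dualBases hM
  obtain ⟨x, -, hx⟩ := exists_height b
  have hM' := hM.isLocallyFinite b
  by_contra hne
  -- A proper `N` misses some generalized Casimir eigenspace `G`. The vectors `w` and `z` found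
  -- below stay in `G`, so both weights give the eigenvalue `κ`.
  obtain ⟨κ, hκ⟩ : ∃ κ, ¬ D.casimirGenEigenspace κ ≤ N := by
    by_contra! hle
    apply hne
    rw [← LieSubmodule.toSubmodule_inj, LieSubmodule.top_toSubmodule, _root_.eq_top_iff,
      ← Module.End.iSup_maxGenEigenspace_eq_top D.casimir]
    exact iSup_le fun κ v hv => hle κ hv
  set G := D.casimirGenEigenspace κ with hG
  obtain ⟨v, hvG, hvN⟩ := SetLike.not_le_iff_exists.1 hκ
  obtain ⟨μ, u, huμ, huG, huN⟩ : ∃ μ, ∃ u ∈ dualWeightSpace b M μ, u ∈ G ∧ u ∉ N := by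
    obtain ⟨s, f, hf, rfl⟩ := hM.exists_sum v
    have h1 := mem_of_sum_mem_of_stable (b := b) (N := G.toSubmodule)
      (fun x v hv => G.lie_mem hv) s f (fun ν _ => hf ν) hvG
    by_contra! hno
    exact hvN (sum_mem fun ν hν => hno ν _ (hf ν) (h1 ν hν))
  obtain ⟨γ, -, w, hwu, hwN, hw, he⟩ := hM'.exists_primitive N huμ huN
  have hwG : w ∈ G := (LieSubmodule.lieSpan_le.2 (Set.singleton_subset_iff.2 huG)) hwu
  set l := μ + γ with hl
  have hdom : ∀ i : b.support, 0 ≤ P.toLinearMap (P.root i) l := fun i =>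
    hM'.pairing_nonneg N hw hwN i (he i)
  have hκl := D.eq_of_mem_casimirGenEigenspace N hwG hwN (D.casimir_sub_smul_mem hx N hw he)
  refine hwN (hN l w ⟨hw, fun i => ?_⟩)
  -- If `w` were highest only modulo `N`, then `e_i w` would generate a true highest weight vector
  -- `z`, of weight strictly above the dominant weight `l` and with the same Casimir eigenvalue.
  by_contra hi
  obtain ⟨γ', hγ', z, hzi, hz0, hz, hze⟩ := hM'.exists_primitive ⊥ (lie_e_mem (.inl i) hw)
    (by simpa using hi)
  have hzG : z ∈ G :=
    (LieSubmodule.lieSpan_le.2 (Set.singleton_subset_iff.2 (G.lie_mem hwG))) hzi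
  have hκz := D.eq_of_mem_casimirGenEigenspace ⊥ hzG hz0 (D.casimir_sub_smul_mem hx ⊥ hz hze)
  rw [wt_inl, add_assoc] at hκz
  refine D.casimirEigenvalue_ne hM hx (γ := P.coroot i + γ')
    (add_mem (coroot_mem_corootCone b ⟨w, hi⟩) hγ') (fun h0 => ?_) hdom hw
    (fun h => hwN (h ▸ zero_mem _)) (hκz.trans hκl.symm)
  obtain ⟨n, hn, -⟩ := height_pos b hx hγ'
  have := congrArg (P.toLinearMap x) h0
  rw [map_add, hx, hn, map_zero] at this
  omega

/-- The highest weight vectors of the submodule generated by a set of highest weight vectors lie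
in the linear span of this set. -/
theorem IsWeightModule.mem_span_of_mem_lieSpan (hM : IsWeightModule b M) {S : Set M}
    (hS : ∀ s ∈ S, ∃ μ, IsHighestWeightVector b μ s) {μ : Y} {v : M}
    (hv : IsHighestWeightVector b μ v) (hvS : v ∈ LieSubmodule.lieSpan ℂ (DualLieAlgebra b) S) :
    v ∈ Submodule.span ℂ S := by
  obtain ⟨D⟩ := exists_dualBases hM
  obtain ⟨x, -, hx⟩ := exists_height b
  have hM' := hM.isLocallyFinite b
  by_cases hv0 : v = 0
  · rw [hv0]; exact zero_mem _
  have hdom : ∀ i : b.support, 0 ≤ P.toLinearMap (P.root i) μ := fun i =>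
    hM'.pairing_nonneg ⊥ hv.mem (by simpa using hv0) i (by simpa using hv.lie_eq_zero i)
  set G : Set M := {w | ∃ s ∈ S, w ∈ LieSubmodule.lieSpan ℂ (DualLieAlgebra b) {s} ∧
    ∃ ν, w ∈ dualWeightSpace b M ν} with hG
  have hle : (LieSubmodule.lieSpan ℂ (DualLieAlgebra b) S).toSubmodule ≤ Submodule.span ℂ G := by
    have h1 : LieSubmodule.lieSpan ℂ (DualLieAlgebra b) S ≤
        ⨆ s : S, LieSubmodule.lieSpan ℂ (DualLieAlgebra b) {(s : M)} :=
      LieSubmodule.lieSpan_le.2 fun s hs => by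
        exact (le_iSup (fun s : S => LieSubmodule.lieSpan ℂ (DualLieAlgebra b) {(s : M)}) ⟨s, hs⟩)
          (LieSubmodule.subset_lieSpan rfl)
    refine (LieSubmodule.toSubmodule_le_toSubmodule _ _ |>.2 h1).trans ?_
    rw [LieSubmodule.iSup_toSubmodule]
    refine iSup_le fun s w hw => ?_
    obtain ⟨t, f, hf, rfl⟩ := hM.exists_sum w
    have h2 := mem_of_sum_mem_of_stable (b := b)
      (N := (LieSubmodule.lieSpan ℂ (DualLieAlgebra b) {(s : M)}).toSubmodule)
      (fun x v hv => LieSubmodule.lie_mem _ hv) t f (fun ν _ => hf ν) hw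
    exact sum_mem fun ν hν => Submodule.subset_span ⟨s, s.2, h2 ν hν, ν, hf ν⟩
  have hvG := mem_span_inter_weightSpace (b := b) (fun w hw => hw.choose_spec.2.2) hv.mem
    (hle hvS)
  have hcas : ∀ {ν : Y} {w : M}, IsHighestWeightVector b ν w →
      w ∈ D.casimir.eigenspace (D.casimirEigenvalue x ν) := fun hw =>
    Module.End.mem_eigenspace_iff.2 (D.casimir_eq_smul hx hw.mem hw.lie_eq_zero)
  set E := D.casimir.eigenspace (D.casimirEigenvalue x μ) with hE
  set E' := ⨆ κ, ⨆ (_ : κ ≠ D.casimirEigenvalue x μ), D.casimir.eigenspace κ with hE'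
  -- A vector of weight `μ` in the submodule generated by `s` is a multiple of `s`, unless `s` has a
  -- strictly higher weight. In that case it lies in the Casimir eigenspace of `s`, whose eigenvalue
  -- differs from that at `μ`.
  have hsub : Submodule.span ℂ (G ∩ (dualWeightSpace b M μ : Set M)) ≤
      (Submodule.span ℂ S ⊓ E) ⊔ E' := by
    refine Submodule.span_le.2 ?_
    rintro w ⟨⟨s, hs, hws, -⟩, hwμ⟩
    by_cases hw0 : w = 0
    · rw [hw0]; exact zero_mem _
    obtain ⟨l, hl⟩ := hS s hs
    rcases mem_lieSpan_primitive hl.mem hl.lie_eq_zero hws hwμ hw0 with ⟨c, rfl⟩ | ⟨γ, hγ, hγ0, h⟩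
    · have hs0 : s ≠ 0 := fun h => hw0 (by rw [h, smul_zero])
      have hlμ := weight_unique_of_ne_zero hw0 (Submodule.smul_mem _ c hl.mem) hwμ
      exact Submodule.mem_sup_left (Submodule.smul_mem _ c
        ⟨Submodule.subset_span hs, by rw [hE, ← hlμ]; exact hcas hl⟩)
    · refine Submodule.mem_sup_right ?_
      have hne : D.casimirEigenvalue x l ≠ D.casimirEigenvalue x μ := by
        rw [h]; exact D.casimirEigenvalue_ne hM hx hγ hγ0 hdom hwμ hw0
      have h1 : w ∈ D.casimir.eigenspace (D.casimirEigenvalue x l) := by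
        let F : LieSubmodule ℂ (DualLieAlgebra b) M :=
          { D.casimir.eigenspace (D.casimirEigenvalue x l) with
            lie_mem := fun {y u} hu => by
              refine Module.End.mem_eigenspace_iff.2 ?_
              rw [D.casimir_lie, Module.End.mem_eigenspace_iff.1 hu, lie_smul] }
        have h2 : LieSubmodule.lieSpan ℂ (DualLieAlgebra b) {s} ≤ F :=
          LieSubmodule.lieSpan_le.2 (Set.singleton_subset_iff.2 (hcas hl))
        exact h2 hws
      exact (le_iSup₂_of_le (f := fun κ (_ : κ ≠ D.casimirEigenvalue x μ) =>
        D.casimir.eigenspace κ) _ hne le_rfl :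
          D.casimir.eigenspace (D.casimirEigenvalue x l) ≤ _) h1
  obtain ⟨u, hu, z, hz, rfl⟩ := Submodule.mem_sup.1 (hsub hvG)
  have hzE : z ∈ E := by
    have := Submodule.sub_mem _ (hcas hv) hu.2
    rwa [add_sub_cancel_left] at this
  have hz0 := (Submodule.disjoint_def.1
    (D.casimir.eigenspaces_iSupIndep (D.casimirEigenvalue x μ))) z hzE hz
  rw [hz0, add_zero]
  exact hu.1

end FiniteDimensional

theorem IsLocallyFinite.eq_top_of_highestWeightVectors (hM : IsLocallyFinite b M)
    (N : LieSubmodule ℂ (DualLieAlgebra b) M)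
    (hN : ∀ μ, ∀ v : M, IsHighestWeightVector b μ v → v ∈ N) : N = ⊤ := by
  rw [eq_top_iff]
  rintro v -
  obtain ⟨N', hv, _⟩ := hM.finite v
  have h1 := (hM.weight.lieSubmodule N').eq_top_of_highestWeightVectors (N.comap N'.incl)
    fun μ w hw => hN μ w (IsHighestWeightVector.coe.1 hw)
  have h2 : (⟨v, hv⟩ : N') ∈ N.comap N'.incl := by rw [h1]; trivial
  exact h2

/-- Only finitely many generators are involved, and they lie in a finite-dimensional submodule. -/
theorem IsLocallyFinite.mem_span_of_mem_lieSpan (hM : IsLocallyFinite b M) {S : Set M}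
    (hS : ∀ s ∈ S, ∃ μ, IsHighestWeightVector b μ s) {μ : Y} {v : M}
    (hv : IsHighestWeightVector b μ v) (hvS : v ∈ LieSubmodule.lieSpan ℂ (DualLieAlgebra b) S) :
    v ∈ Submodule.span ℂ S := by
  obtain ⟨t, htS, hvt⟩ := exists_finset_mem_lieSpan hvS
  obtain ⟨N, htN, _⟩ := hM.exists_finiteDimensional t
  have hvN : v ∈ N := (LieSubmodule.lieSpan_le.2 htN) hvt
  have himg : (fun s : N => (s : M)) '' ((fun s : N => (s : M)) ⁻¹' t) = t := by
    rw [Set.image_preimage_eq_inter_range]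
    refine Set.inter_eq_left.2 fun s hs => ⟨⟨s, htN hs⟩, rfl⟩
  have h1 := (hM.weight.lieSubmodule N).mem_span_of_mem_lieSpan
    (S := (fun s : N => (s : M)) ⁻¹' t) (fun s hs => by
      obtain ⟨l, hl⟩ := hS s (htS hs)
      exact ⟨l, IsHighestWeightVector.coe.2 hl⟩) (v := ⟨v, hvN⟩)
    (IsHighestWeightVector.coe.2 hv) (by
      have h2 : LieSubmodule.lieSpan ℂ (DualLieAlgebra b) (t : Set M) ≤
          (LieSubmodule.lieSpan ℂ (DualLieAlgebra b) ((fun s : N => (s : M)) ⁻¹' t)).map N.incl :=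
        LieSubmodule.lieSpan_le.2 fun s hs => LieSubmodule.mem_map _ |>.2
          ⟨⟨s, htN hs⟩, LieSubmodule.subset_lieSpan hs, rfl⟩
      obtain ⟨w, hw, hwv⟩ := (LieSubmodule.mem_map _).1 (h2 hvt)
      have : w = ⟨v, hvN⟩ := Subtype.ext hwv
      rwa [← this])
  have h2 := Submodule.mem_map_of_mem (f := N.toSubmodule.subtype) h1
  rw [Submodule.map_span] at h2
  refine Submodule.span_mono htS ?_
  rw [← himg]
  exact h2

end DualLieAlgebra

end

/-! ### Products of modules, and automorphisms built from their graphs -/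

noncomputable section

section Prod

variable {R L M N : Type*} [CommRing R] [LieRing L] [LieAlgebra R L]
variable [AddCommGroup M] [Module R M] [LieRingModule L M] [LieModule R L M]
variable [AddCommGroup N] [Module R N] [LieRingModule L N] [LieModule R L N]

/-- The componentwise action on a product. -/
instance Prod.instLieRingModuleComponentwise : LieRingModule L (M × N) where
  bracket y v := (⁅y, v.1⁆, ⁅y, v.2⁆)
  add_lie _ _ _ := Prod.ext (add_lie _ _ _) (add_lie _ _ _)
  lie_add _ _ _ := Prod.ext (lie_add _ _ _) (lie_add _ _ _)
  leibniz_lie _ _ _ := Prod.ext (leibniz_lie _ _ _) (leibniz_lie _ _ _)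

instance Prod.instLieModuleComponentwise : LieModule R L (M × N) where
  smul_lie _ _ _ := Prod.ext (smul_lie _ _ _) (smul_lie _ _ _)
  lie_smul _ _ _ := Prod.ext (lie_smul _ _ _) (lie_smul _ _ _)

variable (R L M N) in
/-- The first projection as a morphism of Lie modules. -/
def LieModuleHom.prodFst : (M × N) →ₗ⁅R, L⁆ M := { LinearMap.fst R M N with map_lie' := rfl }

variable (R L M N) in
/-- The second projection as a morphism of Lie modules. -/
def LieModuleHom.prodSnd : (M × N) →ₗ⁅R, L⁆ N := { LinearMap.snd R M N with map_lie' := rfl }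

end Prod

namespace DualLieAlgebra

variable {ι X Y : Type*} [AddCommGroup X] [AddCommGroup Y]
variable {P : RootDatum ι X Y} {b : P.Base}
variable {M N : Type*} [AddCommGroup M] [Module ℂ M]
  [LieRingModule (DualLieAlgebra b) M] [LieModule ℂ (DualLieAlgebra b) M]
  [AddCommGroup N] [Module ℂ N]
  [LieRingModule (DualLieAlgebra b) N] [LieModule ℂ (DualLieAlgebra b) N]

theorem mem_weightSpace_prod {μ : Y} {v : M × N} : v ∈ dualWeightSpace b (M × N) μ ↔
    v.1 ∈ dualWeightSpace b M μ ∧ v.2 ∈ dualWeightSpace b N μ := by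
  constructor
  · intro h
    exact ⟨fun x => congrArg Prod.fst (h x), fun x => congrArg Prod.snd (h x)⟩
  · rintro ⟨h1, h2⟩ x
    exact Prod.ext (h1 x) (h2 x)

theorem IsWeightModule.prod (hM : IsWeightModule b M) (hN : IsWeightModule b N) :
    IsWeightModule b (M × N) := by
  rw [IsWeightModule, eq_top_iff]
  rintro ⟨v, w⟩ -
  obtain ⟨s, f, hf, rfl⟩ := hM.exists_sum v
  obtain ⟨s', f', hf', rfl⟩ := hN.exists_sum w
  have h : (∑ ν ∈ s, f ν, ∑ ν ∈ s', f' ν) =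
      ∑ ν ∈ s, ((f ν, 0) : M × N) + ∑ ν ∈ s', ((0, f' ν) : M × N) := by
    ext <;> simp [Prod.fst_sum, Prod.snd_sum]
  rw [h]
  refine add_mem (sum_mem fun ν _ => ?_) (sum_mem fun ν _ => ?_)
  · exact Submodule.mem_iSup_of_mem ν (mem_weightSpace_prod.2 ⟨hf ν, zero_mem _⟩)
  · exact Submodule.mem_iSup_of_mem ν (mem_weightSpace_prod.2 ⟨zero_mem _, hf' ν⟩)

theorem IsLocallyFinite.prod (hM : IsLocallyFinite b M) (hN : IsLocallyFinite b N) :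
    IsLocallyFinite b (M × N) where
  weight := hM.weight.prod hN.weight
  finite v := by
    obtain ⟨S, hS, _⟩ := hM.finite v.1
    obtain ⟨S', hS', _⟩ := hN.finite v.2
    let W : LieSubmodule ℂ (DualLieAlgebra b) (M × N) :=
      { S.toSubmodule.prod S'.toSubmodule with
        lie_mem := fun {y u} hu => ⟨S.lie_mem hu.1, S'.lie_mem hu.2⟩ }
    refine ⟨W, ⟨hS, hS'⟩, ?_⟩
    have h1 : S.toSubmodule.FG := Module.Finite.iff_fg.1 ‹FiniteDimensional ℂ S›
    have h2 : S'.toSubmodule.FG := Module.Finite.iff_fg.1 ‹FiniteDimensional ℂ S'›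
    exact Module.Finite.iff_fg.2 (h1.prod h2)

variable [Finite ι] [P.IsReduced]

theorem IsLocallyFinite.exists_highestWeightVector (hM : IsLocallyFinite b M)
    {S : LieSubmodule ℂ (DualLieAlgebra b) M} {v : M} (hv : v ∈ S) (hv0 : v ≠ 0) :
    ∃ μ, ∃ w ∈ S, w ≠ 0 ∧ IsHighestWeightVector b μ w := by
  obtain ⟨s, f, hf, rfl⟩ := hM.weight.exists_sum v
  have h1 := mem_of_sum_mem_of_stable (b := b) (N := S.toSubmodule)
    (fun x v hv => S.lie_mem hv) s f (fun ν _ => hf ν) hv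
  obtain ⟨ν, hν, hne⟩ := Finset.exists_ne_zero_of_sum_ne_zero hv0
  obtain ⟨γ, -, w, hw, hw0, hwt, he⟩ := hM.exists_primitive ⊥ (hf ν) (by simpa using hne)
  exact ⟨_, w, (LieSubmodule.lieSpan_le.2 (Set.singleton_subset_iff.2 (h1 ν hν))) hw,
    by simpa using hw0, hwt, fun i => by simpa using he i⟩

/-- A morphism of locally finite modules that maps a family of highest weight vectors to a basis
of the space of highest weight vectors restricts to an isomorphism on the submodule generated by
this family. -/
theorem IsLocallyFinite.bijective_of_basis (hM : IsLocallyFinite b M) (hN : IsLocallyFinite b N)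
    (p : M →ₗ⁅ℂ, DualLieAlgebra b⁆ N) {κ : Type*} (s : κ → M)
    (hs : ∀ k, ∃ μ, IsHighestWeightVector b μ (s k))
    (hind : LinearIndependent ℂ fun k => p (s k))
    (hspan : ∀ μ, ∀ v : N, IsHighestWeightVector b μ v →
      v ∈ Submodule.span ℂ (Set.range fun k => p (s k))) :
    Function.Bijective fun v : LieSubmodule.lieSpan ℂ (DualLieAlgebra b) (Set.range s) =>
      p (v : M) := by
  constructor
  · have hker : ∀ v ∈ LieSubmodule.lieSpan ℂ (DualLieAlgebra b) (Set.range s), p v = 0 →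
        v = 0 := by
      intro v hv hpv
      by_contra hv0
      obtain ⟨μ, w, hw, hw0, hwμ⟩ := hM.exists_highestWeightVector
        (S := LieSubmodule.lieSpan ℂ (DualLieAlgebra b) (Set.range s) ⊓ p.ker)
        ⟨hv, hpv⟩ hv0
      have h1 := hM.mem_span_of_mem_lieSpan (by rintro _ ⟨k, rfl⟩; exact hs k) hwμ hw.1
      obtain ⟨c, rfl⟩ := Finsupp.mem_span_range_iff_exists_finsupp.1 h1
      have h2 : p (c.sum fun i a => a • s i) = 0 := hw.2
      have h3 : Finsupp.linearCombination ℂ (fun k => p (s k)) c = 0 := by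
        rw [Finsupp.linearCombination_apply, ← h2, Finsupp.sum, Finsupp.sum, map_sum]
        simp only [map_smul]
      have h4 := linearIndependent_iff.1 hind c h3
      rw [h4] at hw0
      simp at hw0
    intro v w hvw
    have h := hker (v - w) (sub_mem v.2 w.2) (by rw [map_sub]; exact sub_eq_zero.2 hvw)
    exact Subtype.ext (sub_eq_zero.1 h)
  · have h1 := hN.eq_top_of_highestWeightVectors
      ((LieSubmodule.lieSpan ℂ (DualLieAlgebra b) (Set.range s)).map p) fun μ v hv => by
        refine (Submodule.span_le.2 ?_ : _ ≤
          ((LieSubmodule.lieSpan ℂ (DualLieAlgebra b) (Set.range s)).map p).toSubmodule)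
          (hspan μ v hv)
        rintro _ ⟨k, rfl⟩
        exact (LieSubmodule.mem_map _).2 ⟨s k, LieSubmodule.subset_lieSpan ⟨k, rfl⟩, rfl⟩
    intro v
    have h2 : v ∈ (LieSubmodule.lieSpan ℂ (DualLieAlgebra b) (Set.range s)).map p := by
      rw [h1]; trivial
    obtain ⟨w, hw, rfl⟩ := (LieSubmodule.mem_map _).1 h2
    exact ⟨⟨w, hw⟩, rfl⟩

/-- A weight-preserving bijection between bases of the space of highest weight vectors extends to
an automorphism. -/
theorem IsLocallyFinite.exists_equiv (hM : IsLocallyFinite b M) {κ : Type*} (s s' : κ → M)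
    (hs : ∀ k, ∃ μ, IsHighestWeightVector b μ (s k) ∧ IsHighestWeightVector b μ (s' k))
    (hind : LinearIndependent ℂ s) (hind' : LinearIndependent ℂ s')
    (hspan : ∀ μ, ∀ v : M, IsHighestWeightVector b μ v → v ∈ Submodule.span ℂ (Set.range s))
    (hspan' : ∀ μ, ∀ v : M, IsHighestWeightVector b μ v → v ∈ Submodule.span ℂ (Set.range s')) :
    ∃ g : M ≃ₗ[ℂ] M, (∀ (y : DualLieAlgebra b) (v : M), g ⁅y, v⁆ = ⁅y, g v⁆) ∧
      ∀ k, g (s k) = s' k := by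
  -- The submodule generated by these pairs is the graph of the automorphism: both projections are
  -- bijective on it.
  set t : κ → M × M := fun k => (s k, s' k) with ht
  have hts : ∀ k, ∃ μ, IsHighestWeightVector b μ (t k) := fun k => by
    obtain ⟨μ, h1, h2⟩ := hs k
    exact ⟨μ, mem_weightSpace_prod.2 ⟨h1.mem, h2.mem⟩, fun i =>
      Prod.ext (h1.lie_eq_zero i) (h2.lie_eq_zero i)⟩
  set W := LieSubmodule.lieSpan ℂ (DualLieAlgebra b) (Set.range t) with hW
  have b1 := (hM.prod hM).bijective_of_basis hM
    (LieModuleHom.prodFst ℂ (DualLieAlgebra b) M M) t hts hind hspan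
  have b2 := (hM.prod hM).bijective_of_basis hM
    (LieModuleHom.prodSnd ℂ (DualLieAlgebra b) M M) t hts hind' hspan'
  let g1 : W ≃ₗ[ℂ] M := LinearEquiv.ofBijective
    ((LinearMap.fst ℂ M M).comp W.toSubmodule.subtype) b1
  let g2 : W ≃ₗ[ℂ] M := LinearEquiv.ofBijective
    ((LinearMap.snd ℂ M M).comp W.toSubmodule.subtype) b2
  have hg1 : ∀ w : W, g1 w = (w : M × M).1 := fun _ => rfl
  have hg2 : ∀ w : W, g2 w = (w : M × M).2 := fun _ => rfl
  have hg : ∀ w : W, (g1.symm.trans g2) (w : M × M).1 = (w : M × M).2 := fun w => by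
    rw [LinearEquiv.trans_apply, ← hg1, LinearEquiv.symm_apply_apply, hg2]
  refine ⟨g1.symm.trans g2, fun y v => ?_, fun k => ?_⟩
  · obtain ⟨w, rfl⟩ := g1.surjective v
    rw [hg1, hg]
    exact hg ⁅y, w⁆
  · exact hg ⟨t k, LieSubmodule.subset_lieSpan ⟨k, rfl⟩⟩

end DualLieAlgebra

end

/-! ### Bases that are perfect for one operator -/

noncomputable section

section PerfectOperator

variable {V : Type*} [AddCommGroup V] [Module ℂ V]

theorem Module.Basis.repr_map_apply {κ : Type*} (B : Module.Basis κ ℂ V) (T : Module.End ℂ V)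
    (v : V) (k : κ) :
    B.repr (T v) k = ∑ j ∈ (B.repr v).support, B.repr v j * B.repr (T (B j)) k := by
  conv_lhs => rw [← B.linearCombination_repr v, Finsupp.linearCombination_apply, Finsupp.sum]
  simp only [map_sum, map_smul, Finsupp.coe_finsetSum, Finset.sum_apply, Finsupp.smul_apply,
    smul_eq_mul]

theorem mem_partialNPow_succ {κ : Type*} {f : κ ≃. κ} {k k'' : κ} (n : ℕ) :
    k'' ∈ partialNPow f (n + 1) k ↔ ∃ k', k' ∈ f k ∧ k'' ∈ partialNPow f n k' := by
  induction n generalizing k'' with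
  | zero => simp [partialNPow]
  | succ n ih =>
    rw [partialNPow, PEquiv.mem_trans]
    simp only [ih]
    constructor
    · rintro ⟨l, ⟨k', h1, h2⟩, h3⟩
      exact ⟨k', h1, (PEquiv.mem_trans _ _ _ _).2 ⟨l, h2, h3⟩⟩
    · rintro ⟨k', h1, h2⟩
      obtain ⟨l, h2, h3⟩ := (PEquiv.mem_trans _ _ _ _).1 h2
      exact ⟨l, ⟨k', h1, h2⟩, h3⟩

/-- The domains of the powers of a partial bijection that lowers a rank function by one and is
defined at the elements of positive rank. -/
theorem partialNPow_isSome_iff {κ : Type*} {f : κ ≃. κ} {r : κ → ℕ}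
    (h1 : ∀ k, (f k).isSome ↔ 0 < r k) (h2 : ∀ k k', k' ∈ f k → r k = r k' + 1) (n : ℕ) (k : κ) :
    (partialNPow f n k).isSome ↔ n ≤ r k := by
  induction n generalizing k with
  | zero => simp [partialNPow]
  | succ n ih =>
    rw [Option.isSome_iff_exists]
    constructor
    · rintro ⟨k'', hk''⟩
      obtain ⟨k', hk', h⟩ := (mem_partialNPow_succ n).1 hk''
      have := (ih k').1 (Option.isSome_iff_exists.2 ⟨k'', h⟩)
      have := h2 k k' hk'
      omega
    · intro h
      obtain ⟨k', hk'⟩ := Option.isSome_iff_exists.1 ((h1 k).2 (by omega))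
      have := h2 k k' hk'
      obtain ⟨k'', h⟩ := Option.isSome_iff_exists.1 ((ih k').2 (by omega))
      exact ⟨k'', (mem_partialNPow_succ n).2 ⟨k', hk', h⟩⟩

/-- The smallest `n` with `T ^ (n + 1) v = 0`. -/
def nilIndex (T : Module.End ℂ V) (v : V) : ℕ := sInf {n : ℕ | (T ^ (n + 1)) v = 0}

/-- A basis that is perfect with respect to a locally nilpotent operator. -/
structure IsPerfectFor {κ : Type*} (T : Module.End ℂ V) (B : Module.Basis κ ℂ V) (f : κ ≃. κ) :
    Prop where
  nilpotent (v : V) : ∃ n, (T ^ n) v = 0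
  isSome_iff (k : κ) : (f k).isSome ↔ T (B k) ≠ 0
  spec (k k' : κ) (h : k' ∈ f k) : ∃ c : ℂ, c ≠ 0 ∧
    T (B k) - c • B k' ∈ LinearMap.ker (T ^ (nilIndex T (B k) - 1))

namespace IsPerfectFor

variable {κ : Type*} {T : Module.End ℂ V} {B : Module.Basis κ ℂ V} {f : κ ≃. κ}
variable (A : IsPerfectFor T B f)
include A

theorem pow_eq_zero_iff {v : V} (hv : v ≠ 0) (n : ℕ) : (T ^ n) v = 0 ↔ nilIndex T v < n := by
  constructor
  · intro h
    rcases n with _ | n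
    · exact absurd (by simpa using h) hv
    · exact Nat.lt_succ_of_le (Nat.sInf_le h)
  · intro h
    have hne : {n : ℕ | (T ^ (n + 1)) v = 0}.Nonempty := by
      obtain ⟨n, hn⟩ := A.nilpotent v
      exact ⟨n, by rw [Set.mem_ofPred_eq, pow_succ', Module.End.mul_apply, hn, map_zero]⟩
    exact Module.End.pow_map_zero_of_le h (Nat.sInf_mem hne)

theorem basis_pow_eq_zero_iff (k : κ) (n : ℕ) : (T ^ n) (B k) = 0 ↔ nilIndex T (B k) < n :=
  A.pow_eq_zero_iff (B.ne_zero k) n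

theorem isSome_iff_pos (k : κ) : (f k).isSome ↔ 0 < nilIndex T (B k) := by
  rw [A.isSome_iff, Ne, ← pow_one T, A.basis_pow_eq_zero_iff, pow_one]
  omega

/-- The error term dies under the power of `T` one below the index of `B k`, so `T ^ (l + 1) (B k)`
is exactly a multiple of `T ^ l (B k')`, where `l + 1` is that index. -/
theorem nilIndex_op {k k' : κ} (h : k' ∈ f k) :
    nilIndex T (B k) = nilIndex T (B k') + 1 ∧
      ∃ c : ℂ, c ≠ 0 ∧ (T ^ (nilIndex T (B k))) (B k) = c • (T ^ (nilIndex T (B k'))) (B k') := by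
  obtain ⟨c, hc, hmem⟩ := A.spec k k' h
  -- Where `f` is defined the index is positive, so the subtraction of `1` in the error term is not
  -- truncated.
  have hpos := (A.isSome_iff_pos k).1 (Option.isSome_iff_exists.2 ⟨k', h⟩)
  obtain ⟨l, hl⟩ : ∃ l, nilIndex T (B k) = l + 1 := ⟨nilIndex T (B k) - 1, by omega⟩
  rw [hl, Nat.add_sub_cancel, LinearMap.mem_ker, map_sub, map_smul, sub_eq_zero] at hmem
  have h1 : (T ^ (l + 1)) (B k) = c • (T ^ l) (B k') := by
    rw [pow_succ, Module.End.mul_apply, hmem]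
  have h2 : (T ^ (l + 1 + 1)) (B k) = c • (T ^ (l + 1)) (B k') := by
    rw [pow_succ', Module.End.mul_apply, h1, map_smul, pow_succ', Module.End.mul_apply]
  have h3 : ¬ nilIndex T (B k') < l := by
    rw [← A.basis_pow_eq_zero_iff]
    intro h0
    rw [h0, smul_zero, A.basis_pow_eq_zero_iff] at h1
    omega
  have h4 : nilIndex T (B k') < l + 1 := by
    rw [(A.basis_pow_eq_zero_iff k _).2 (by omega), eq_comm, smul_eq_zero] at h2
    exact (A.basis_pow_eq_zero_iff k' _).1 (h2.resolve_left hc)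
  have h5 : nilIndex T (B k') = l := by omega
  exact ⟨by omega, c, hc, by rw [hl, h1, h5]⟩

/-- Iterating `nilIndex_op`, the error terms disappear at the top power and a single basis vector
remains. -/
theorem exists_top (k : κ) : ∃ k', k' ∈ partialNPow f (nilIndex T (B k)) k ∧
    ∃ c : ℂ, c ≠ 0 ∧ (T ^ (nilIndex T (B k))) (B k) = c • B k' := by
  obtain ⟨n, hn⟩ : ∃ n, nilIndex T (B k) = n := ⟨_, rfl⟩
  induction n generalizing k with
  | zero => rw [hn]; exact ⟨k, by simp [partialNPow], 1, one_ne_zero, by simp⟩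
  | succ n ih =>
    obtain ⟨k', h1⟩ := Option.isSome_iff_exists.1 ((A.isSome_iff_pos k).2 (by omega))
    obtain ⟨h2, c, hc, h3⟩ := A.nilIndex_op h1
    obtain ⟨k'', h4, c', hc', h5⟩ := ih k' (by omega)
    refine ⟨k'', ?_, c * c', mul_ne_zero hc hc', by rw [h3, h5, smul_smul]⟩
    rw [h2]
    exact (mem_partialNPow_succ _).2 ⟨k', h1, h4⟩

/-- The kernels of the powers of the operator are spanned by basis vectors. -/
theorem nilIndex_lt_of_mem_support {v : V} {n : ℕ} (hv : (T ^ n) v = 0) {k : κ}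
    (hk : B.repr v k ≠ 0) : nilIndex T (B k) < n := by
  classical
  set s := (B.repr v).support with hs
  have hks : k ∈ s := Finsupp.mem_support_iff.2 hk
  -- For the maximal index `m` in the support, `T ^ m v` is a combination of the `B (top j)` with
  -- `j` of index `m`. There `top` is the `m`-th power of a partial bijection, so these vectors are
  -- distinct and `T ^ m v = 0` forces their coefficients to vanish.
  obtain ⟨l, hl, hmax⟩ := s.exists_max_image (fun k => nilIndex T (B k)) ⟨k, hks⟩
  set m := nilIndex T (B l) with hm
  by_contra hcon
  have hnm : n ≤ m := by have := hmax k hks; omega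
  choose top htop c hc hcB using A.exists_top
  have hTm : (T ^ m) v = 0 := Module.End.pow_map_zero_of_le hnm hv
  have hsum : ∑ j ∈ s.filter (fun j => nilIndex T (B j) = m),
      (B.repr v j * c j) • B (top j) = 0 := by
    rw [← hTm]
    conv_rhs => rw [← B.linearCombination_repr v, Finsupp.linearCombination_apply, Finsupp.sum,
      map_sum]
    rw [Finset.sum_filter]
    refine Finset.sum_congr rfl fun j hj => ?_
    rw [map_smul]
    split_ifs with h
    · rw [← smul_smul, ← hcB, h]
    · rw [(A.basis_pow_eq_zero_iff j m).2 (lt_of_le_of_ne (hmax j hj) h), smul_zero]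
  have hinj : Set.InjOn top (s.filter (fun j => nilIndex T (B j) = m)) := by
    intro i hi j hj hij
    have h1 := htop i
    have h2 := htop j
    rw [(Finset.mem_filter.1 hi).2, hij] at h1
    rw [(Finset.mem_filter.1 hj).2] at h2
    exact (partialNPow f m).inj h1 h2
  have hind : LinearIndepOn ℂ (fun j => B (top j))
      (s.filter (fun j => nilIndex T (B j) = m) : Finset κ) :=
    (B.linearIndependent.linearIndepOn _).comp_of_image hinj |>.mono (Set.Subset.refl _)
  have h0 := (linearIndepOn_finset_iff.1 hind) (fun j => B.repr v j * c j) hsum l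
    (Finset.mem_filter.2 ⟨hl, rfl⟩)
  exact (Finsupp.mem_support_iff.1 hl) ((mul_eq_zero.1 h0).resolve_right (hc l))

theorem repr_eq_zero_of_pow_eq_zero {v : V} {n : ℕ} (hv : (T ^ n) v = 0) {k : κ}
    (hk : n ≤ nilIndex T (B k)) : B.repr v k = 0 := by
  by_contra h
  have := A.nilIndex_lt_of_mem_support hv h
  omega

/-- The error term is killed by `T` to the power `nilIndex T (B k')`, so it does not involve `B k'`.
-/
theorem repr_op_ne_zero {k k' : κ} (h : k' ∈ f k) : B.repr (T (B k)) k' ≠ 0 := by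
  obtain ⟨c, hc, hmem⟩ := A.spec k k' h
  have h1 := A.repr_eq_zero_of_pow_eq_zero (k := k') hmem (by rw [(A.nilIndex_op h).1]; omega)
  rw [map_sub, map_smul, B.repr_self, Finsupp.sub_apply, Finsupp.smul_apply,
    Finsupp.single_eq_same, smul_eq_mul, mul_one, sub_eq_zero] at h1
  rwa [h1]

/-- The error term involves only basis vectors of index below `nilIndex T (B k) - 1`, so `k'` can
occur only as the main term. -/
theorem mem_op_of_repr_ne_zero {k k' : κ} (hle : nilIndex T (B k) ≤ nilIndex T (B k') + 1)
    (h : B.repr (T (B k)) k' ≠ 0) : k' ∈ f k := by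
  have h0 : T (B k) ≠ 0 := fun h0 => h (by rw [h0, map_zero, Finsupp.zero_apply])
  obtain ⟨l, hl⟩ := Option.isSome_iff_exists.1 ((A.isSome_iff k).2 h0)
  obtain ⟨c, hc, hmem⟩ := A.spec k l hl
  have h1 := A.repr_eq_zero_of_pow_eq_zero (k := k') hmem (by omega)
  rw [map_sub, map_smul, B.repr_self, Finsupp.sub_apply, Finsupp.smul_apply, sub_eq_zero] at h1
  rw [h1, smul_eq_mul] at h
  by_cases hlk : l = k'
  · rwa [← hlk]
  · rw [Finsupp.single_eq_of_ne (Ne.symm hlk), mul_zero] at h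
    exact absurd rfl h

/-- The bound `+ 2` restricts the support of `v` to indices at most one above that of `k`, the range
in which `mem_op_of_repr_ne_zero` applies. -/
theorem exists_mem_op {v : V} {k : κ} (hv : (T ^ (nilIndex T (B k) + 2)) v = 0)
    (h : B.repr (T v) k ≠ 0) : ∃ j, k ∈ f j := by
  rw [B.repr_map_apply] at h
  obtain ⟨j, hj, hne⟩ := Finset.exists_ne_zero_of_sum_ne_zero h
  have := A.nilIndex_lt_of_mem_support hv (Finsupp.mem_support_iff.1 hj)
  exact ⟨j, A.mem_op_of_repr_ne_zero (by omega) (right_ne_zero_of_mul hne)⟩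

theorem repr_apply {v : V} {j k : κ} (hv : (T ^ (nilIndex T (B k) + 2)) v = 0) (hk : k ∈ f j) :
    B.repr (T v) k = B.repr v j * B.repr (T (B j)) k := by
  rw [B.repr_map_apply]
  refine Finset.sum_eq_single j (fun i hi hij => ?_) fun hj => ?_
  · by_contra hne
    have := A.nilIndex_lt_of_mem_support hv (Finsupp.mem_support_iff.1 hi)
    exact hij (f.inj (A.mem_op_of_repr_ne_zero (by omega) (right_ne_zero_of_mul hne)) hk)
  · rw [Finsupp.notMem_support_iff.1 hj, zero_mul]

/-- The coefficients of the powers of `ẽ` along an automorphism that commutes with the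
operator. -/
theorem repr_comm {κ' : Type*} {B' : Module.Basis κ' ℂ V} {f' : κ' ≃. κ'}
    (A' : IsPerfectFor T B' f') {g : V →ₗ[ℂ] V} (hg : ∀ v, g (T v) = T (g v)) {j k : κ} {j' k' : κ'}
    (hk : k ∈ f j) (hk' : k' ∈ f' j') (h : nilIndex T (B j) = nilIndex T (B' j')) :
    ∃ c c' : ℂ, c ≠ 0 ∧ c' ≠ 0 ∧ B'.repr (g (B j)) j' * c' = c * B'.repr (g (B k)) k' := by
  have hgp : ∀ (n : ℕ) (v : V), (T ^ n) (g v) = g ((T ^ n) v) := by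
    intro n v
    induction n with
    | zero => simp
    | succ n ih => rw [pow_succ', Module.End.mul_apply, ih, Module.End.mul_apply, hg]
  have h1 := (A.nilIndex_op hk).1
  have h1' := (A'.nilIndex_op hk').1
  obtain ⟨c, hc, hmem⟩ := A.spec j k hk
  refine ⟨c, _, hc, A'.repr_op_ne_zero hk', ?_⟩
  -- The coefficient at `k'` of `T (g (B j)) = g (T (B j))` is computed in two ways. The error term
  -- for `j` contributes nothing, because the power of `T` that kills it does not exceed the index
  -- of `k'`.
  rw [← A'.repr_apply (v := g (B j)) ?_ hk', ← hg]
  · have h2 : B'.repr (g (T (B j) - c • B k)) k' = 0 :=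
      A'.repr_eq_zero_of_pow_eq_zero (by
        rw [hgp, LinearMap.mem_ker.1 hmem, map_zero]) (by omega)
    rw [map_sub, map_sub, map_smul, map_smul, Finsupp.sub_apply, Finsupp.smul_apply,
      sub_eq_zero] at h2
    rw [h2, smul_eq_mul]
  · rw [hgp, (A.basis_pow_eq_zero_iff j _).2 (by omega), map_zero]

end IsPerfectFor

end PerfectOperator

end

/-! ### Normality, and highest weight vectors of a perfect basis -/

noncomputable section

theorem partialZPow_natCast {κ : Type*} (f : κ ≃. κ) (n : ℕ) :
    partialZPow f (n : ℤ) = partialNPow f n := rfl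

theorem partialZPow_neg_natCast {κ : Type*} (f : κ ≃. κ) (n : ℕ) :
    partialZPow f (-(n : ℤ)) = partialNPow f.symm n := by
  cases n with
  | zero => rfl
  | succ n => rfl

namespace PerfectBasis

open DualLieAlgebra

variable {ι X Y : Type*} [AddCommGroup X] [AddCommGroup Y]
variable {P : RootDatum ι X Y} {b : P.Base}
variable {V : Type*} [AddCommGroup V] [Module ℂ V]
  [LieRingModule (DualLieAlgebra b) V] [LieModule ℂ (DualLieAlgebra b) V]
variable (B : PerfectBasis b V)

/-- A perfect basis as a family of vectors. -/
def basis : Module.Basis B.carrier ℂ V :=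
  Module.Basis.mk B.linearIndependent (by rw [Subtype.range_coe, B.span_eq_top])

@[simp] theorem basis_apply (k : B.carrier) : B.basis k = k := Module.Basis.mk_apply _ _ _

theorem isPerfectFor (hV : IsLocallyFinite b V) (i : b.support ⊕ b.support) :
    IsPerfectFor (chevalleyAct b V i) B.basis (B.op i) where
  nilpotent v := by
    obtain ⟨s, f, hf, rfl⟩ := hV.weight.exists_sum v
    choose n hn using fun μ => hV.exists_pow_eq_zero (hf μ) i
    refine ⟨∑ μ ∈ s, n μ, ?_⟩
    rw [map_sum]
    refine Finset.sum_eq_zero fun μ hμ => ?_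
    exact Module.End.pow_map_zero_of_le
      (Finset.single_le_sum (f := n) (fun _ _ => Nat.zero_le _) hμ) (hn μ)
  isSome_iff k := by rw [B.op_isSome_iff, basis_apply]
  spec k k' h := by
    obtain ⟨c, hc, h⟩ := B.op_spec i k k' h
    rw [basis_apply, basis_apply]
    exact ⟨c, hc, h⟩

theorem mem_weightSpace_of_repr_ne_zero {μ : Y} {v : V} (hv : v ∈ dualWeightSpace b V μ)
    {k : B.carrier} (hk : B.basis.repr v k ≠ 0) : (k : V) ∈ dualWeightSpace b V μ := by
  have h1 : v ∈ Submodule.span ℂ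
      (B.basis '' {k : B.carrier | (k : V) ∈ dualWeightSpace b V μ}) := by
    rw [← B.span_weight μ] at hv
    refine Submodule.span_mono ?_ hv
    rintro w ⟨hw, hwμ⟩
    exact ⟨⟨w, hw⟩, hwμ, B.basis_apply _⟩
  exact B.basis.repr_support_subset_of_mem_span _ h1 (Finsupp.mem_support_iff.2 hk)

/-! ### Normality -/

variable {B}

/-- `e_i ^ p` is injective on vectors of `α_i`-weight `-p`, so `ℓ_i ≥ p` there. -/
theorem ell_add_pairing_nonneg (hV : IsLocallyFinite b V) {μ : Y} {k : B.carrier}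
    (hk : (k : V) ∈ dualWeightSpace b V μ) (i : b.support) :
    0 ≤ (ell b (.inl i) (k : V) : ℤ) + P.toLinearMap (P.root i) μ := by
  by_contra! hneg
  obtain ⟨p, hp⟩ : ∃ p : ℕ, P.toLinearMap (P.root i) μ = -(p : ℤ) :=
    ⟨(-P.toLinearMap (P.root i) μ).toNat, by omega⟩
  have h0 : ((chevalleyAct b V (.inl i)) ^ p) (B.basis k) = 0 :=
    ((B.isPerfectFor hV (.inl i)).basis_pow_eq_zero_iff k p).2 (by
      change nilIndex (chevalleyAct b V (.inl i)) (k : V) + _ < (0 : ℤ) at hneg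
      rw [basis_apply]; omega)
  rw [basis_apply] at h0
  have h1 := hV.mem_of_pow_mem ⊥ hk i p hp (by rw [h0]; exact zero_mem _)
  exact B.basis.ne_zero k (by simpa using h1)

/-- With `l = ℓ_i(k)`, the vector `e_i ^ l k` is killed by `e_i` and has `α_i`-weight greater than
`l`, so it equals `e_i ^ (l + 1) y`. Then `k - e_i y` is killed by `e_i ^ l`; hence `k` occurs in
`e_i y` with coefficient `1`, and so lies in the image of `ẽ_i`. -/
theorem exists_op_of_pos (hV : IsLocallyFinite b V) {μ : Y} {k : B.carrier}
    (hk : (k : V) ∈ dualWeightSpace b V μ) (i : b.support)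
    (hpos : 0 < (ell b (.inl i) (k : V) : ℤ) + P.toLinearMap (P.root i) μ) :
    ∃ j, k ∈ B.op (.inl i) j := by
  have A := B.isPerfectFor hV (.inl i)
  set T := chevalleyAct b V (.inl i) with hT
  set l := nilIndex T (B.basis k) with hl
  have hell : ell b (.inl i) (k : V) = l := by rw [hl, basis_apply]; rfl
  rw [hell] at hpos
  obtain ⟨m, hm⟩ : ∃ m : ℕ,
      P.toLinearMap (P.root i) (μ + l • P.coroot i) = (m : ℤ) ∧ l + 1 ≤ m := by
    refine ⟨(P.toLinearMap (P.root i) (μ + l • P.coroot i)).toNat, ?_⟩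
    rw [map_add, map_nsmul, RootPairing.root_coroot_two, nsmul_eq_mul]
    omega
  have hx := lie_H_of_mem (chevalleyAct_pow_mem (.inl i) hk l) (P.root i)
  rw [wt_inl, hm.1] at hx
  have hex : T ((T ^ l) (k : V)) = 0 := by
    rw [← Module.End.mul_apply, ← pow_succ', ← B.basis_apply]
    exact (A.basis_pow_eq_zero_iff k _).2 (Nat.lt_succ_self l)
  obtain ⟨c, hc⟩ := (isSlTwoAction b i).exists_pow_e_eq (m := m) (by exact_mod_cast hx) hex
    (l + 1) hm.2
  set y := c • ((chevalleyAct b V (.inr i)) ^ (l + 1)) ((T ^ l) (k : V)) with hy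
  refine A.exists_mem_op (v := y) ?_ ?_
  · change (T ^ (l + 2)) y = 0
    rw [pow_succ', Module.End.mul_apply, hc, hex]
  · have h1 : (T ^ l) (B.basis k - T y) = 0 := by
      rw [map_sub, basis_apply, ← Module.End.mul_apply, ← pow_succ, hc, sub_self]
    have h2 := A.repr_eq_zero_of_pow_eq_zero h1 (le_refl l)
    rw [map_sub, B.basis.repr_self, Finsupp.sub_apply, Finsupp.single_eq_same,
      sub_eq_zero] at h2
    rw [← h2]
    exact one_ne_zero

theorem isNormal [Nontrivial V] (hV : IsLocallyFiniteDualModule b V) (B : PerfectBasis b V) :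
    (B.crystal hV).IsNormal := by
  have hV' := isLocallyFinite_of_dualModule b hV
  have hell : ∀ i (k : B.carrier), ell b (.inl i) (k : V) =
      nilIndex (chevalleyAct b V (.inl i)) (B.basis k) := fun i k => by rw [basis_apply]; rfl
  refine ⟨fun i _ k => ?_, fun i _ k => ?_, ?_⟩
  · have A := B.isPerfectFor hV' (.inl i)
    refine ⟨ell b (.inl i) (k : V), rfl, ?_⟩
    have key : ∀ n : ℕ, (partialZPow ((B.crystal hV).op i) (n : ℤ) k).isSome ↔
        n ≤ ell b (.inl i) (k : V) := fun n => by
      rw [partialZPow_natCast, hell]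
      exact partialNPow_isSome_iff A.isSome_iff_pos (fun k k' h => (A.nilIndex_op h).1) n k
    exact ⟨(key _).2 le_rfl, fun n hn => (key n).1 hn⟩
  · have A := B.isPerfectFor hV' (.inl i)
    -- `φ_i` is the rank function for the inverse of `ẽ_i`; it is nonnegative, so `toNat` loses
    -- nothing.
    let r : B.carrier → ℕ := fun k =>
      ((ell b (.inl i) (k : V) : ℤ) + P.toLinearMap (P.root i) (weight hV B k)).toNat
    have hr : ∀ k : B.carrier, (r k : ℤ) =
        (ell b (.inl i) (k : V) : ℤ) + P.toLinearMap (P.root i) (weight hV B k) := fun k =>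
      Int.toNat_of_nonneg (ell_add_pairing_nonneg hV' (weight_spec hV B k) i)
    have hstep : ∀ k k', k' ∈ (B.op (.inl i)).symm k → r k = r k' + 1 := by
      intro k k' h
      rw [PEquiv.mem_iff_mem] at h
      have h1 := (A.nilIndex_op h).1
      have h2 := weight_op hV B i k' k h
      have h3 := hr k
      have h4 := hr k'
      rw [hell] at h3 h4
      rw [h2, map_add, RootPairing.root_coroot_two] at h3
      omega
    have hsome : ∀ k, ((B.op (.inl i)).symm k).isSome ↔ 0 < r k := by
      intro k
      rw [Option.isSome_iff_exists]
      constructor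
      · rintro ⟨k', h⟩
        rw [hstep k k' h]
        exact Nat.succ_pos _
      · intro h
        obtain ⟨j, hj⟩ := exists_op_of_pos hV' (weight_spec hV B k) i (by rw [← hr]; omega)
        exact ⟨j, (PEquiv.mem_iff_mem _).2 hj⟩
    refine ⟨r k, ?_, ?_⟩
    · rw [hr]; rfl
    · have key : ∀ n : ℕ, (partialZPow ((B.crystal hV).op i) (-(n : ℤ)) k).isSome ↔ n ≤ r k :=
        fun n => by
          rw [partialZPow_neg_natCast]
          exact partialNPow_isSome_iff hsome hstep n k
      exact ⟨(key _).2 le_rfl, fun n hn => (key n).1 hn⟩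
  · refine Set.eq_univ_of_forall fun i h => ?_
    -- `ẽ_i` lowers `ℓ_i` by one, so it fixes no basis vector; one exists because `V` is nontrivial.
    obtain ⟨k⟩ := B.basis.index_nonempty
    have h1 : k ∈ B.op (.inl i) k := by
      have h2 : B.op (.inl i) = PEquiv.refl _ := h
      rw [h2]; rfl
    have := ((B.isPerfectFor hV' (.inl i)).nilIndex_op h1).1
    omega

/-! ### The highest weight vectors of a perfect basis -/

variable (b V) in
/-- The space of highest weight vectors of weight `μ`. -/
def highestWeightSpace (μ : Y) : Submodule ℂ V where
  carrier := {v | IsHighestWeightVector b μ v}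
  add_mem' {v w} hv hw := ⟨add_mem hv.mem hw.mem, fun i => by
    rw [lie_add, hv.lie_eq_zero, hw.lie_eq_zero, add_zero]⟩
  zero_mem' := ⟨zero_mem _, fun i => lie_zero _⟩
  smul_mem' c v hv := ⟨Submodule.smul_mem _ c hv.mem, fun i => by
    rw [lie_smul, hv.lie_eq_zero, smul_zero]⟩

/-- The kernel of `e_i` and the weight spaces are spanned by basis vectors, so the expansion of a
highest weight vector involves only highest weight basis vectors. -/
theorem span_highestWeightVectors (hV : IsLocallyFinite b V) (B : PerfectBasis b V) (μ : Y) :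
    Submodule.span ℂ (Set.range fun k : {k : B.carrier // IsHighestWeightVector b μ (k : V)} =>
      (k : V)) = highestWeightSpace b V μ := by
  refine le_antisymm (Submodule.span_le.2 ?_) fun v hv => ?_
  · rintro _ ⟨k, rfl⟩; exact k.2
  · have h1 : v ∈ Submodule.span ℂ
        (B.basis '' {k : B.carrier | IsHighestWeightVector b μ (k : V)}) := by
      refine B.basis.mem_span_image.2 fun k hk => ?_
      have hk' := Finsupp.mem_support_iff.1 hk
      refine ⟨B.mem_weightSpace_of_repr_ne_zero hv.mem hk', fun i => ?_⟩
      have A := B.isPerfectFor hV (.inl i)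
      have h2 := A.nilIndex_lt_of_mem_support (n := 1) (by
        rw [pow_one]; exact hv.lie_eq_zero i) hk'
      have h3 := (A.basis_pow_eq_zero_iff k 1).2 h2
      rw [pow_one, basis_apply] at h3
      exact h3
    refine Submodule.span_mono ?_ h1
    rintro _ ⟨k, hk, rfl⟩
    exact ⟨⟨k, hk⟩, (B.basis_apply k).symm⟩

/-- A weight-preserving bijection between the highest weight vectors of two perfect bases. -/
def highestEquiv (hV : IsLocallyFinite b V) (B B' : PerfectBasis b V) (μ : Y) :
    {k : B.carrier // IsHighestWeightVector b μ (k : V)} ≃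
      {k : B'.carrier // IsHighestWeightVector b μ (k : V)} :=
  Module.Basis.indexEquiv
    ((Module.Basis.span (B.linearIndependent.comp
      (fun k : {k : B.carrier // IsHighestWeightVector b μ (k : V)} => (k : B.carrier))
        Subtype.val_injective)).map (LinearEquiv.ofEq _ _ (span_highestWeightVectors hV B μ)))
    ((Module.Basis.span (B'.linearIndependent.comp
      (fun k : {k : B'.carrier // IsHighestWeightVector b μ (k : V)} => (k : B'.carrier))
        Subtype.val_injective)).map (LinearEquiv.ofEq _ _ (span_highestWeightVectors hV B' μ)))

/-- An automorphism maps the highest weight vectors of a perfect basis to elements of another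
perfect basis. -/
structure Matches (B B' : PerfectBasis b V) (g : V ≃ₗ[ℂ] V) : Prop where
  map_lie (y : DualLieAlgebra b) (v : V) : g ⁅y, v⁆ = ⁅y, g v⁆
  highest (k : B.carrier) (μ : Y) (hk : IsHighestWeightVector b μ (k : V)) :
    ∃ k' : B'.carrier, g k = k'

/-- The bijections `highestEquiv`, one for each weight, combine and extend to one automorphism. -/
theorem exists_matches [Finite ι] [P.IsReduced] (hV : IsLocallyFinite b V)
    (B B' : PerfectBasis b V) :
    ∃ g : V ≃ₗ[ℂ] V, Matches B B' g ∧ Matches B' B g.symm := by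
  let κ := Σ μ : Y, {k : B.carrier // IsHighestWeightVector b μ (k : V)}
  have huniq : ∀ (C : PerfectBasis b V) (k : C.carrier) (μ ν : Y),
      IsHighestWeightVector b μ (k : V) → IsHighestWeightVector b ν (k : V) → μ = ν :=
    fun C k μ ν h h' => weight_unique (by simpa using C.basis.ne_zero k) h.mem h'.mem
  obtain ⟨g, hg, hgs⟩ := hV.exists_equiv (fun k : κ => (k.2.1 : V))
    (fun k : κ => ((highestEquiv hV B B' k.1 k.2).1 : V))
    (fun k => ⟨k.1, k.2.2, (highestEquiv hV B B' k.1 k.2).2⟩)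
    (B.linearIndependent.comp (fun k : κ => k.2.1) (by
      rintro ⟨μ, k⟩ ⟨ν, l⟩ (h : k.1 = l.1)
      obtain rfl := huniq B k.1 μ ν k.2 (h ▸ l.2)
      rw [Subtype.ext h]))
    (B'.linearIndependent.comp (fun k : κ => (highestEquiv hV B B' k.1 k.2).1) (by
      rintro ⟨μ, k⟩ ⟨ν, l⟩ (h : (highestEquiv hV B B' μ k).1 = (highestEquiv hV B B' ν l).1)
      obtain rfl := huniq B' (highestEquiv hV B B' μ k).1 μ ν (highestEquiv hV B B' μ k).2
        (h ▸ (highestEquiv hV B B' ν l).2)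
      rw [(highestEquiv hV B B' μ).injective (Subtype.ext h)]))
    (fun μ v hv => by
      have h1 : v ∈ highestWeightSpace b V μ := hv
      rw [← span_highestWeightVectors hV B μ] at h1
      refine Submodule.span_mono ?_ h1
      rintro _ ⟨k, rfl⟩
      exact ⟨⟨μ, k⟩, rfl⟩)
    (fun μ v hv => by
      have h1 : v ∈ highestWeightSpace b V μ := hv
      rw [← span_highestWeightVectors hV B' μ] at h1
      refine Submodule.span_mono ?_ h1
      rintro _ ⟨k, rfl⟩
      exact ⟨⟨μ, (highestEquiv hV B B' μ).symm k⟩, by simp⟩)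
  refine ⟨g, ⟨hg, fun k μ hk => ⟨_, hgs ⟨μ, k, hk⟩⟩⟩, fun y v => ?_, fun k μ hk => ?_⟩
  · rw [LinearEquiv.symm_apply_eq, hg, LinearEquiv.apply_symm_apply]
  · refine ⟨((highestEquiv hV B B' μ).symm ⟨k, hk⟩).1, ?_⟩
    rw [LinearEquiv.symm_apply_eq]
    have := hgs ⟨μ, (highestEquiv hV B B' μ).symm ⟨k, hk⟩⟩
    simp only [Equiv.apply_symm_apply] at this
    exact this.symm

end PerfectBasis

end

/-! ### The isomorphism of crystals -/

noncomputable section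

namespace PerfectBasis

open DualLieAlgebra

variable {ι X Y : Type*} [AddCommGroup X] [AddCommGroup Y]
variable {P : RootDatum ι X Y} {b : P.Base}
variable {V : Type*} [AddCommGroup V] [Module ℂ V]
  [LieRingModule (DualLieAlgebra b) V] [LieModule ℂ (DualLieAlgebra b) V]

/-- Elements of two perfect bases that occur in the expansions of each other along an
automorphism. -/
def Related (B B' : PerfectBasis b V) (g : V ≃ₗ[ℂ] V) (k : B.carrier) (k' : B'.carrier) : Prop :=
  B'.basis.repr (g (B.basis k)) k' ≠ 0 ∧ B.basis.repr (g.symm (B'.basis k')) k ≠ 0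

variable {B B' : PerfectBasis b V} {g : V ≃ₗ[ℂ] V}

theorem Related.symm {k : B.carrier} {k' : B'.carrier} (h : Related B B' g k k') :
    Related B' B g.symm k' k := ⟨h.2, h.1⟩

theorem Matches.map_pow (m : Matches B B' g) (i : b.support ⊕ b.support) (n : ℕ) (v : V) :
    ((chevalleyAct b V i) ^ n) (g v) = g (((chevalleyAct b V i) ^ n) v) := by
  induction n with
  | zero => simp
  | succ n ih =>
    rw [pow_succ', Module.End.mul_apply, ih, Module.End.mul_apply, chevalleyAct_apply,
      chevalleyAct_apply, m.map_lie]

theorem Matches.map_mem_weightSpace (m : Matches B B' g) {μ : Y} {v : V}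
    (hv : v ∈ dualWeightSpace b V μ) : g v ∈ dualWeightSpace b V μ := fun x => by
  rw [← m.map_lie, hv x, map_zsmul]

theorem Matches.mem_weightSpace (m : Matches B B' g) {k : B.carrier} {k' : B'.carrier}
    (h : Related B B' g k k') {μ : Y} (hk : (k : V) ∈ dualWeightSpace b V μ) :
    (k' : V) ∈ dualWeightSpace b V μ := by
  refine B'.mem_weightSpace_of_repr_ne_zero ?_ h.1
  rw [basis_apply]
  exact m.map_mem_weightSpace hk

theorem Matches.existsUnique_of_highest (m : Matches B B' g) {k : B.carrier} {μ : Y}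
    (hk : IsHighestWeightVector b μ (k : V)) : ∃! k', Related B B' g k k' := by
  obtain ⟨k', hk'⟩ := m.highest k μ hk
  have h1 : g (B.basis k) = B'.basis k' := by rw [basis_apply, basis_apply, hk']
  refine ⟨k', ⟨?_, ?_⟩, fun k'' h => ?_⟩
  · rw [h1, B'.basis.repr_self, Finsupp.single_eq_same]; exact one_ne_zero
  · rw [← h1, LinearEquiv.symm_apply_apply, B.basis.repr_self, Finsupp.single_eq_same]
    exact one_ne_zero
  · have h2 := h.1
    rw [h1, B'.basis.repr_self] at h2
    by_contra hne
    exact h2 (Finsupp.single_eq_of_ne hne)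

section

variable (hV : IsLocallyFinite b V)
include hV

/-- `g` commutes with `e_i`, so the image of `k` is killed by the same powers and involves only
basis vectors of no greater index. The symmetry of `Related` then gives equality. -/
theorem Matches.nilIndex_le (m : Matches B B' g) {k : B.carrier} {k' : B'.carrier}
    (h : Related B B' g k k') (i : b.support ⊕ b.support) :
    nilIndex (chevalleyAct b V i) (B'.basis k') ≤ nilIndex (chevalleyAct b V i) (B.basis k) := by
  refine Nat.lt_succ_iff.1 ((B'.isPerfectFor hV i).nilIndex_lt_of_mem_support ?_ h.1)
  rw [m.map_pow, ((B.isPerfectFor hV i).basis_pow_eq_zero_iff k _).2 (Nat.lt_succ_self _), map_zero]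

theorem Matches.nilIndex_eq (m : Matches B B' g) (m' : Matches B' B g.symm) {k : B.carrier}
    {k' : B'.carrier} (h : Related B B' g k k') (i : b.support ⊕ b.support) :
    nilIndex (chevalleyAct b V i) (B.basis k) = nilIndex (chevalleyAct b V i) (B'.basis k') :=
  le_antisymm (m'.nilIndex_le hV h.symm i) (m.nilIndex_le hV h i)

theorem Matches.repr_ne_zero_iff (m : Matches B B' g) {i : b.support ⊕ b.support}
    {k k₁ : B.carrier} {k' k₁' : B'.carrier} (hk : k₁ ∈ B.op i k) (hk' : k₁' ∈ B'.op i k')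
    (h : nilIndex (chevalleyAct b V i) (B.basis k) = nilIndex (chevalleyAct b V i) (B'.basis k')) :
    B'.basis.repr (g (B.basis k)) k' ≠ 0 ↔ B'.basis.repr (g (B.basis k₁)) k₁' ≠ 0 := by
  obtain ⟨c, c', hc, hc', heq⟩ := (B.isPerfectFor hV i).repr_comm (B'.isPerfectFor hV i)
    (g := g.toLinearMap) (fun v => m.map_lie _ v) hk hk' h
  simp only [LinearEquiv.coe_coe] at heq
  constructor
  · intro h0 h1
    rw [h1, mul_zero] at heq
    exact (mul_ne_zero h0 hc') heq
  · intro h0 h1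
    rw [h1, zero_mul] at heq
    exact (mul_ne_zero hc h0) heq.symm

theorem Matches.related_iff (m : Matches B B' g) (m' : Matches B' B g.symm)
    {i : b.support ⊕ b.support} {k k₁ : B.carrier} {k' k₁' : B'.carrier} (hk : k₁ ∈ B.op i k)
    (hk' : k₁' ∈ B'.op i k')
    (h : nilIndex (chevalleyAct b V i) (B.basis k) = nilIndex (chevalleyAct b V i) (B'.basis k')) :
    Related B B' g k k' ↔ Related B B' g k₁ k₁' :=
  and_congr (m.repr_ne_zero_iff hV hk hk' h) (m'.repr_ne_zero_iff hV hk' hk h.symm)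

theorem Matches.exists_op (m : Matches B B' g) (m' : Matches B' B g.symm)
    {i : b.support ⊕ b.support} {k k₁ : B.carrier} {k' : B'.carrier} (hk : k₁ ∈ B.op i k)
    (h : Related B B' g k k') : ∃ k₁', k₁' ∈ B'.op i k' ∧ Related B B' g k₁ k₁' := by
  have h1 := m.nilIndex_eq hV m' h i
  have h2 := ((B.isPerfectFor hV i).nilIndex_op hk).1
  obtain ⟨k₁', hk'⟩ := Option.isSome_iff_exists.1
    (((B'.isPerfectFor hV i).isSome_iff_pos k').2 (by omega))
  exact ⟨k₁', hk', (m.related_iff hV m' hk hk' h1).1 h⟩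

/-- Related elements share weight and `ℓ_i`, hence `φ_i`. This is positive at `k₁`, which lies in
the image of `ẽ_i`, and positivity puts `k₁'` in the image too. -/
theorem Matches.exists_op_symm (hdm : IsLocallyFiniteDualModule b V) (m : Matches B B' g)
    (m' : Matches B' B g.symm) {i : b.support} {k k₁ : B.carrier} {k₁' : B'.carrier}
    (hk : k₁ ∈ B.op (.inl i) k) (h : Related B B' g k₁ k₁') :
    ∃ k', k₁' ∈ B'.op (.inl i) k' ∧ Related B B' g k k' := by
  have h1 := m.nilIndex_eq hV m' h (.inl i)
  have h2 := ((B.isPerfectFor hV (.inl i)).nilIndex_op hk).1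
  have hw := weight_spec hdm B k₁
  have hw' := m.mem_weightSpace h hw
  have h3 := ell_add_pairing_nonneg hV (weight_spec hdm B k) i
  have h4 := weight_op hdm B i k k₁ hk
  have hell : ∀ (C : PerfectBasis b V) (k : C.carrier), ell b (.inl i) (k : V) =
      nilIndex (chevalleyAct b V (.inl i)) (C.basis k) := fun C k => by rw [basis_apply]; rfl
  obtain ⟨k', hk'⟩ := exists_op_of_pos hV hw' i (by
    rw [hell, ← h1, h4, map_add, RootPairing.root_coroot_two]
    rw [hell] at h3
    omega)
  have h5 := ((B'.isPerfectFor hV (.inl i)).nilIndex_op hk').1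
  exact ⟨k', hk', (m.related_iff hV m' hk hk' (by omega)).2 h⟩

/-- `ẽ_i` carries partners of `k` to partners of `k₁`, and it is injective. -/
theorem Matches.existsUnique_of_op (hdm : IsLocallyFiniteDualModule b V) (m : Matches B B' g)
    (m' : Matches B' B g.symm) {i : b.support} {k k₁ : B.carrier}
    (hk : k₁ ∈ B.op (.inl i) k) (h : ∃! k', Related B B' g k₁ k') :
    ∃! k', Related B B' g k k' := by
  obtain ⟨k₁', hk₁', huniq⟩ := h
  obtain ⟨k', hk', hr⟩ := m.exists_op_symm hV hdm m' hk hk₁'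
  refine ⟨k', hr, fun k'' hr' => ?_⟩
  obtain ⟨k₁'', hk'', hr₁⟩ := m.exists_op hV m' hk hr'
  rw [huniq _ hr₁] at hk''
  exact (B'.op (.inl i)).inj hk'' hk'

theorem Matches.existsUnique_of_partialNPow (hdm : IsLocallyFiniteDualModule b V)
    (m : Matches B B' g) (m' : Matches B' B g.symm) {i : b.support} (n : ℕ) {k k₁ : B.carrier}
    (hk : k₁ ∈ partialNPow (B.op (.inl i)) n k) (h : ∃! k', Related B B' g k₁ k') :
    ∃! k', Related B B' g k k' := by
  induction n generalizing k with
  | zero =>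
    have : k = k₁ := by simpa [partialNPow] using hk
    rwa [this]
  | succ n ih =>
    obtain ⟨l, hl, hk⟩ := (mem_partialNPow_succ n).1 hk
    exact m.existsUnique_of_op hV hdm m' hl (ih hk)

variable [Finite ι] [P.IsReduced]

theorem Matches.existsUnique (hdm : IsLocallyFiniteDualModule b V) (m : Matches B B' g)
    (m' : Matches B' B g.symm) (k : B.carrier) : ∃! k', Related B B' g k k' := by
  obtain ⟨x, -, hx⟩ := exists_height b
  obtain ⟨N, hkN, _⟩ := hV.finite (k : V)
  obtain ⟨s, hs⟩ := exists_finset_weights N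
  obtain ⟨c, hc⟩ := (s.image (P.toLinearMap x)).bddAbove
  have hbdd : ∀ k : B.carrier, (k : V) ∈ N → P.toLinearMap x (weight hdm B k) ≤ c := fun k hk =>
    hc (Finset.mem_coe.2 (Finset.mem_image_of_mem _ (hs _ _ hk (weight_spec hdm B k)
      (by simpa using B.basis.ne_zero k))))
  obtain ⟨n, hn⟩ : ∃ n : ℕ, (c - P.toLinearMap x (weight hdm B k)).toNat = n := ⟨_, rfl⟩
  induction n using Nat.strong_induction_on generalizing k with
  | _ n ih =>
    by_cases hhw : ∀ i : b.support, ⁅e b (.inl i), (k : V)⁆ = 0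
    · exact m.existsUnique_of_highest ⟨weight_spec hdm B k, hhw⟩
    push Not at hhw
    obtain ⟨i, hi⟩ := hhw
    have A := B.isPerfectFor hV (.inl i)
    have hpos := (A.isSome_iff_pos k).1 ((A.isSome_iff k).2 (by rw [basis_apply]; exact hi))
    -- The maximal power of `ẽ_i` is taken instead of one step: `e_i ^ ℓ_i(k) k` is a nonzero
    -- multiple of the basis vector `k₁`, which therefore stays in `N`, where heights are at most
    -- `c`.
    obtain ⟨k₁, hk₁, r, hr, heq⟩ := A.exists_top k
    have hk₁N : (k₁ : V) ∈ N := by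
      have h := chevalleyAct_pow_mem_lieSubmodule N (.inl i) hkN
        (nilIndex (chevalleyAct b V (.inl i)) (B.basis k))
      rw [← B.basis_apply k, heq] at h
      rw [← B.basis_apply]
      exact (N.toSubmodule.smul_mem_iff hr).1 h
    refine m.existsUnique_of_partialNPow hV hdm m' _ hk₁ (ih _ ?_ k₁ ?_ rfl)
    · have h1 := weight_partialNPow (γ := weight hdm B) (weight_op hdm B i) _ k k₁ hk₁
      have h2 := hbdd k hkN
      rw [← hn, h1, map_add, map_nsmul, hx, nsmul_eq_mul]
      have h3 := hbdd k₁ hk₁N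
      rw [h1, map_add, map_nsmul, hx, nsmul_eq_mul] at h3
      omega
    · exact hk₁N

end

variable [Finite ι] [P.IsReduced]

theorem nonempty_iso (hV : IsLocallyFiniteDualModule b V) (B B' : PerfectBasis b V) :
    Nonempty ((B.crystal hV).Iso (B'.crystal hV)) := by
  have hV' := isLocallyFinite_of_dualModule b hV
  obtain ⟨g, m, m'⟩ := exists_matches hV' B B'
  choose f hf hfu using m.existsUnique hV' hV m'
  choose f' hf' hfu' using m'.existsUnique hV' hV m
  have hwt : ∀ k, weight hV B' (f k) = weight hV B k := fun k =>
    weight_unique (by simpa using B'.basis.ne_zero (f k)) (weight_spec hV B' (f k))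
      (m.mem_weightSpace (hf k) (weight_spec hV B k))
  have hell : ∀ (i : b.support) k, ell b (.inl i) (f k : V) = ell b (.inl i) (k : V) := by
    intro i k
    have := m.nilIndex_eq hV' m' (hf k) (.inl i)
    rw [basis_apply, basis_apply] at this
    exact this.symm
  -- Uniqueness of partners in both directions makes `f` and `f'` mutually inverse.
  refine ⟨⟨⟨f, f', fun k => (hfu' _ k (hf k).symm).symm, fun k => (hfu _ k (hf' k).symm).symm⟩,
    hwt, fun i k => ?_, fun i k => ?_, fun i k => ?_⟩⟩
  · change (((ell b (.inl i) (f k : V) : ℤ) + P.toLinearMap (P.root i) (weight hV B' (f k)) : ℤ) :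
      WithBot ℤ) = _
    rw [hell, hwt]
    rfl
  · change ((ell b (.inl i) (f k : V) : ℤ) : WithBot ℤ) = _
    rw [hell]
    rfl
  · change B'.op (.inl i) (f k) = (B.op (.inl i) k).map f
    rcases hop : B.op (.inl i) k with _ | k₁
    · rw [Option.map_none, ← Option.not_isSome_iff_eq_none,
        (B'.isPerfectFor hV' (.inl i)).isSome_iff_pos, ← m.nilIndex_eq hV' m' (hf k) (.inl i),
        ← (B.isPerfectFor hV' (.inl i)).isSome_iff_pos, hop]
      simp
    · obtain ⟨k₁', hk₁', hr⟩ := m.exists_op hV' m' hop (hf k)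
      rw [Option.map_some, ← hfu _ _ hr]
      exact hk₁'

end PerfectBasis

end

theorem mainTheorem4 {ι X Y : Type*} [Finite ι] [AddCommGroup X] [AddCommGroup Y]
    [Module.Finite ℤ X] [Module.Finite ℤ Y]
    (P : RootDatum ι X Y) [P.IsReduced] (b : P.Base)
    (V : Type*) [AddCommGroup V] [Module ℂ V]
    [LieRingModule (DualLieAlgebra b) V] [LieModule ℂ (DualLieAlgebra b) V]
    (hV : IsLocallyFiniteDualModule b V) (B B' : PerfectBasis b V) :
    (Nontrivial V → (B.crystal hV).IsNormal ∧ (B'.crystal hV).IsNormal) ∧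
      Nonempty ((B.crystal hV).Iso (B'.crystal hV)) := by
  exact ⟨fun _ => ⟨PerfectBasis.isNormal hV B, PerfectBasis.isNormal hV B'⟩,
    PerfectBasis.nonempty_iso hV B B'⟩
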